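/- Let $\mathbb T^3=(-\pi,\pi)^3$ with periodic boundary conditions, let $\gamma>0$ and $g\in [L^2(\mathbb T^3)]^3$, let $\mathcal H_0=\{v\in[L^2(\mathbb T^3)]^3:\operatorname{div}v=0\}$ with the $L^2$ norm, let $\Pi$ be the orthogonal (Leray) projector of $[L^2(\mathbb T^3)]^3$ onto $\mathcal H_0$ and, for $\alpha>0$, let $\mathcal H_\alpha=\{v\in[H^1(\mathbb T^3)]^3:\operatorname{div}v=0\}$ with $\|v\|_{\mathcal H_\alpha}^2=\|v\|_{L^2}^2+\alpha\|\nabla v\|_{L^2}^2$. For a smooth divergence free vector field $\varphi$ on $[0,\infty)\times\mathbb T^3$ put $$D_0(\varphi)=\partial_t\varphi+\Pi(\varphi,\nabla)\varphi+\gamma\varphi-\Pi g,\qquad e_0(\varphi)(t)=\sup_{z\in\mathcal H_0,\,z\ne0}\frac{-((z,\nabla)\varphi(t),z)}{\|z\|_{L^2}^2}.$$ A function $u:[0,\infty)\to\mathcal H_0$ that is locally bounded and weakly continuous is called a dissipative solution of the damped Euler system $\partial_tu+(u,\nabla)u+\nabla p+\gamma u=g$, $\operatorname{div}u=0$, $u|_{t=0}=\bar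 u_0$, if $u(0)=\bar u_0$ and, for all such $\varphi$ and all $t\ge0$, $$\|u(t)-\varphi(t)\|_{L^2}^2\le\|u(0)-\varphi(0)\|_{L^2}^2\,e^{-2\int_0^t(\gamma-e_0(\varphi)(s))\,ds}-2\int_0^te^{-2\int_\tau^t(\gamma-e_0(\varphi)(s))\,ds}\,(D_0(\varphi)(\tau),u(\tau)-\varphi(\tau))\,d\tau.$$ Then for every $\bar u_0\in\mathcal H_0$ the damped Euler system has at least one dissipative solution $u$. Moreover, $u$ can be chosen as a weak limit of solutions of the damped Bardina–Euler systems as $\alpha\to0$: there are $\alpha_n>0$ with $\alpha_n\to0$ and solutions $v_n\in C^1([0,\infty),\mathcal H_{\alpha_n})$ of $$\partial_tv_n-\alpha_n\partial_t\Delta v_n+(v_n,\nabla)v_n+\nabla p_n+\gamma(v_n-\alpha_n\Delta v_n)=g,\qquad\operatorname{div}v_n=0,$$ such that $v_n(0)\to\bar u_0$ in $L^2$, $\|v_n(0)\|_{\mathcal H_{\alpha_n}}\to\|\bar u_0\|_{L^2}$, and $v_n(t)\rightharpoonup u(t)$ weakly in $\mathcal H_0$ for every $t\ge0$. -/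

import Mathlib

open MeasureTheory Filter Topology Set
open scoped ContDiff

noncomputable section

namespace DampedEuler

/-- Three-dimensional Euclidean space. -/
abbrev E : Type := EuclideanSpace ℝ (Fin 3)

/-- The `i`-th standard unit vector. -/
abbrev unitVec (i : Fin 3) : E := EuclideanSpace.single i (1 : ℝ)

/-- The period cell `(-π, π)³` of the torus. Functions on the torus are functions on `ℝ³` which are
`2π`-periodic in every variable; measurable ones are determined up to null sets by their
restriction to this cell. -/
def cell : Set E := {x | ∀ i, x i ∈ Ioo (-Real.pi) Real.pi}

/-- `2π`-periodicity in every variable. -/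
def Periodic {F : Type*} (f : E → F) : Prop :=
  ∀ (x : E) (i : Fin 3), f (x + EuclideanSpace.single i (2 * Real.pi)) = f x

/-- The Hilbert space `L²(𝕋³; ℝ³)`, with Lebesgue measure on the period cell. -/
abbrev L2Field : Type := Lp E 2 ((volume : Measure E).restrict cell)

theorem cell_subset : cell ⊆ Metric.closedBall (0 : E) (Real.sqrt (3 * Real.pi ^ 2)) := by
  intro x hx
  rw [mem_closedBall_zero_iff, EuclideanSpace.norm_eq]
  apply Real.sqrt_le_sqrt
  have h : ∀ i ∈ (Finset.univ : Finset (Fin 3)), ‖x i‖ ^ 2 ≤ Real.pi ^ 2 := by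
    intro i _
    have h1 := hx i
    rw [Real.norm_eq_abs, sq_abs]
    exact sq_le_sq' h1.1.le h1.2.le
  calc ∑ i, ‖x i‖ ^ 2 ≤ ∑ _i : Fin 3, Real.pi ^ 2 := Finset.sum_le_sum h
    _ = 3 * Real.pi ^ 2 := by simp

theorem memLp_of_continuous {f : E → E} (hf : Continuous f) :
    MemLp f 2 ((volume : Measure E).restrict cell) := by
  have hK : IsCompact (Metric.closedBall (0 : E) (Real.sqrt (3 * Real.pi ^ 2))) :=
    isCompact_closedBall _ _
  have h : MemLp f 2
      ((volume : Measure E).restrict (Metric.closedBall (0 : E) (Real.sqrt (3 * Real.pi ^ 2)))) := by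
    obtain ⟨C, hC⟩ := hK.exists_bound_of_continuousOn hf.continuousOn
    have : IsFiniteMeasure ((volume : Measure E).restrict
        (Metric.closedBall (0 : E) (Real.sqrt (3 * Real.pi ^ 2)))) :=
      ⟨by rw [Measure.restrict_apply_univ]; exact hK.measure_lt_top⟩
    refine MemLp.of_bound hf.aestronglyMeasurable C ?_
    exact (ae_restrict_iff' Metric.isClosed_closedBall.measurableSet).2
      (Eventually.of_forall hC)
  exact h.mono_measure (Measure.restrict_mono cell_subset le_rfl)

/-- The element of `L²` given by a continuous vector field. -/
def toL2 (f : E → E) (hf : Continuous f) : L2Field := (memLp_of_continuous hf).toLp f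

theorem continuous_gradient {ψ : E → ℝ} (hψ : ContDiff ℝ ∞ ψ) :
    Continuous (fun x => gradient ψ x) :=
  (InnerProductSpace.toDual ℝ E).symm.continuous.comp (hψ.continuous_fderiv (by simp))

theorem continuous_partial {ψ : E → E} (hψ : ContDiff ℝ ∞ ψ) (i : Fin 3) :
    Continuous (fun x => fderiv ℝ ψ x (unitVec i)) :=
  (hψ.continuous_fderiv (by simp)).clm_apply continuous_const

/-- `𝓗₀`: the `L²` vector fields on the torus that are divergence free in the sense of
distributions, i.e. orthogonal to the gradients of all smooth functions on the torus. -/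
def H0 : Submodule ℝ L2Field where
  carrier := {v | ∀ (ψ : E → ℝ) (hψ : ContDiff ℝ ∞ ψ), Periodic ψ →
    inner ℝ v (toL2 (fun x => gradient ψ x) (continuous_gradient hψ)) = 0}
  add_mem' := by
    intro a b ha hb ψ hψ hp
    rw [inner_add_left, ha ψ hψ hp, hb ψ hψ hp, add_zero]
  zero_mem' := by
    intro ψ hψ hp
    exact inner_zero_left _
  smul_mem' := by
    intro c a ha ψ hψ hp
    rw [real_inner_smul_left, ha ψ hψ hp, mul_zero]

theorem isClosed_H0 : IsClosed (H0 : Set L2Field) := by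
  have h : (H0 : Set L2Field) = ⋂ (ψ : E → ℝ) (hψ : ContDiff ℝ ∞ ψ) (_ : Periodic ψ),
      {v | inner ℝ v (toL2 (fun x => gradient ψ x) (continuous_gradient hψ)) = 0} := by
    ext v
    simp only [mem_iInter]
    rfl
  rw [h]
  refine isClosed_iInter fun ψ => isClosed_iInter fun hψ => isClosed_iInter fun _ => ?_
  exact isClosed_eq (by fun_prop) continuous_const

instance instCompleteSpaceH0 : CompleteSpace H0 := isClosed_H0.completeSpace_coe

/-- The Leray projector: the orthogonal projection of `L²` onto the divergence free fields. -/
def leray : L2Field →L[ℝ] L2Field := H0.starProjection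

/-- `w` is the weak derivative of `v` in the direction `x_i` on the torus. -/
def HasWeakPartial (i : Fin 3) (v w : L2Field) : Prop :=
  ∀ (ψ : E → E) (hψ : ContDiff ℝ ∞ ψ), Periodic ψ →
    inner ℝ v (toL2 (fun x => fderiv ℝ ψ x (unitVec i)) (continuous_partial hψ i)) =
      - inner ℝ w (toL2 ψ hψ.continuous)

/-- The vector space underlying `𝓗_α`, `α > 0`: the divergence free fields in `H¹(𝕋³)`. An element
is a field `p.1` together with its (uniquely determined) weak partial derivatives `p.2 i`; the
norm topology inherited from the product is the topology of `H¹`. -/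
def H1 : Submodule ℝ (L2Field × (Fin 3 → L2Field)) where
  carrier := {p | p.1 ∈ H0 ∧ ∀ i, HasWeakPartial i p.1 (p.2 i)}
  add_mem' := by
    rintro a b ⟨ha, ha'⟩ ⟨hb, hb'⟩
    refine ⟨H0.add_mem ha hb, fun i ψ hψ hp => ?_⟩
    have h1 := ha' i ψ hψ hp
    have h2 := hb' i ψ hψ hp
    simp only [Prod.fst_add, Prod.snd_add, Pi.add_apply, inner_add_left, h1, h2]
    ring
  zero_mem' := by
    refine ⟨H0.zero_mem, fun i ψ hψ hp => ?_⟩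
    simp
  smul_mem' := by
    rintro c a ⟨ha, ha'⟩
    refine ⟨H0.smul_mem c ha, fun i ψ hψ hp => ?_⟩
    have h1 := ha' i ψ hψ hp
    simp only [Prod.smul_fst, Prod.smul_snd, Pi.smul_apply, real_inner_smul_left, h1]
    ring

/-- The field itself. -/
def field (p : H1) : L2Field := p.1.1

/-- Its weak partial derivatives. -/
def pd (i : Fin 3) (p : H1) : L2Field := p.1.2 i

/-- The squared norm `‖v‖² + α ‖∇v‖²` of `𝓗_α`. -/
def normSqH (α : ℝ) (p : H1) : ℝ := ‖field p‖ ^ 2 + α * ∑ i, ‖pd i p‖ ^ 2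

/-- The divergence of a smooth vector field. -/
def divergence (ψ : E → E) (x : E) : ℝ := ∑ i, (fderiv ℝ ψ x (unitVec i)) i

/-- `v` is a solution of class `C¹([0, ∞), 𝓗_α)` of the damped Bardina–Euler system
`∂ₜv - α ∂ₜΔv + (v, ∇)v + ∇p + γ (v - αΔv) = g`, `div v = 0`. The equation is understood in the
sense of distributions at every time `t ≥ 0`, and the pressure is eliminated in the usual way, by
testing with smooth divergence free fields on the torus. -/
def IsBardinaSolution (α γ : ℝ) (g : L2Field) (v : ℝ → H1) : Prop :=
  ContDiffOn ℝ 1 v (Ici 0) ∧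
  ∀ t : ℝ, 0 ≤ t → ∀ (ψ : E → E) (hψ : ContDiff ℝ ∞ ψ), Periodic ψ →
    (∀ x, divergence ψ x = 0) →
      (inner ℝ (field (derivWithin v (Ici 0) t)) (toL2 ψ hψ.continuous)
        + α * ∑ i, inner ℝ (pd i (derivWithin v (Ici 0) t))
            (toL2 (fun x => fderiv ℝ ψ x (unitVec i)) (continuous_partial hψ i)))
      + (∫ x in cell, ∑ i, field (v t) x i * inner ℝ (pd i (v t) x) (ψ x))
      + γ * (inner ℝ (field (v t)) (toL2 ψ hψ.continuous)
        + α * ∑ i, inner ℝ (pd i (v t))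
            (toL2 (fun x => fderiv ℝ ψ x (unitVec i)) (continuous_partial hψ i)))
      = inner ℝ g (toL2 ψ hψ.continuous)

/-- Smooth, time dependent, divergence free test fields on `[0, ∞) × 𝕋³` (smoothness up to `t = 0`
is expressed by a smooth extension to all times). -/
structure TestField where
  toFun : ℝ → E → E
  smooth : ContDiff ℝ ∞ (fun q : ℝ × E => toFun q.1 q.2)
  periodic : ∀ t : ℝ, 0 ≤ t → Periodic (toFun t)
  div_free : ∀ t : ℝ, 0 ≤ t → ∀ x, divergence (toFun t) x = 0

namespace TestField

theorem smooth_space (φ : TestField) (t : ℝ) : ContDiff ℝ ∞ (φ.toFun t) :=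
  φ.smooth.comp (contDiff_const.prodMk contDiff_id)

theorem deriv_time_eq (φ : TestField) (t : ℝ) (x : E) :
    deriv (fun s => φ.toFun s x) t =
      fderiv ℝ (fun q : ℝ × E => φ.toFun q.1 q.2) (t, x) ((1 : ℝ), (0 : E)) := by
  have h1 : HasFDerivAt (fun q : ℝ × E => φ.toFun q.1 q.2)
      (fderiv ℝ (fun q : ℝ × E => φ.toFun q.1 q.2) (t, x)) (t, x) :=
    (φ.smooth.differentiable (by simp) (t, x)).hasFDerivAt
  have h2 : HasDerivAt (fun s : ℝ => (s, x)) ((1 : ℝ), (0 : E)) t :=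
    (hasDerivAt_id t).prodMk (hasDerivAt_const t x)
  exact (h1.comp_hasDerivAt t h2).deriv

theorem continuous_deriv_time (φ : TestField) (t : ℝ) :
    Continuous (fun x => deriv (fun s => φ.toFun s x) t) := by
  simp only [deriv_time_eq]
  exact ((φ.smooth.continuous_fderiv (by simp)).comp
    (continuous_const.prodMk continuous_id)).clm_apply continuous_const

theorem continuous_convect (φ : TestField) (t : ℝ) :
    Continuous (fun x => fderiv ℝ (φ.toFun t) x (φ.toFun t x)) :=
  ((φ.smooth_space t).continuous_fderiv (by simp)).clm_apply (φ.smooth_space t).continuous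

/-- `φ(t)` as an element of `L²`. -/
def val (φ : TestField) (t : ℝ) : L2Field := toL2 (φ.toFun t) (φ.smooth_space t).continuous

/-- `D₀(φ)(t) = ∂ₜφ + Π (φ, ∇)φ + γ φ - Π g`. -/
def D (γ : ℝ) (g : L2Field) (φ : TestField) (t : ℝ) : L2Field :=
  toL2 (fun x => deriv (fun s => φ.toFun s x) t) (φ.continuous_deriv_time t)
    + leray (toL2 (fun x => fderiv ℝ (φ.toFun t) x (φ.toFun t x)) (φ.continuous_convect t))
    + γ • φ.val t - leray g

/-- `e₀(φ)(t)`: the supremum of `-((z, ∇)φ(t), z) / ‖z‖²` over all nonzero `z ∈ 𝓗₀`. -/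
def e (φ : TestField) (t : ℝ) : ℝ :=
  sSup {r : ℝ | ∃ z ∈ H0, z ≠ 0 ∧
    r = - (∫ x in cell, inner ℝ (fderiv ℝ (φ.toFun t) x (z x)) (z x)) / ‖z‖ ^ 2}

end TestField

/-- `u` is a dissipative solution (in the sense of P.-L. Lions) of the damped Euler system with
damping `γ`, force `g` and initial datum `u₀`; only times `t ≥ 0` matter. -/
structure IsDissipativeSolution (γ : ℝ) (g : L2Field) (u₀ : H0) (u : ℝ → H0) : Prop where
  bounded : ∀ T : ℝ, ∃ C : ℝ, ∀ t ∈ Icc 0 T, ‖u t‖ ≤ C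
  weakly_continuous : ∀ w : H0, ContinuousOn (fun t => inner ℝ (u t) w) (Ici 0)
  initial : u 0 = u₀
  inequality : ∀ (φ : TestField) (t : ℝ), 0 ≤ t →
    ‖(u t : L2Field) - φ.val t‖ ^ 2 ≤
      ‖(u 0 : L2Field) - φ.val 0‖ ^ 2 * Real.exp (-2 * ∫ s in (0 : ℝ)..t, (γ - φ.e s))
      - 2 * ∫ τ in (0 : ℝ)..t, Real.exp (-2 * ∫ s in τ..t, (γ - φ.e s)) *
          inner ℝ (φ.D γ g τ) ((u τ : L2Field) - φ.val τ)

end DampedEuler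

end

/-! ### Lebesgue measure on the period cell, completeness of trigonometric monomials, periodic
integration -/

noncomputable section

namespace DampedEuler

/-! Write `R = (1 - αΔ)⁻¹` and use `w = (1 - αΔ) v` as the unknown. The damped Bardina–Euler system
becomes `w' = Π(g - (Rw, ∇)Rw) - γ w` on `𝓗₀`. In dimension three `R` maps `L²` into `L^∞`, and
`∂ᵢR` is bounded on `L²`, so the right-hand side is a bounded quadratic map plus an affine one and
the system is an ODE in a Hilbert space. The energy `‖v‖² + α‖∇v‖²` equals `(w, Rw)`, and the
quadratic term drops out of its evolution (`inner_bil_res_self`). Gronwall bounds the energy on each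
`[0, T]`, uniformly in `α`. For fixed `α` this controls `∇v`, so the quadratic term is at most
linear in `‖w‖` and the solution is global (`exists_bardina_bound`, `exists_global_solution`).

To compare with a test field `φ`, take the relative energy `(w, Rw) - 2(w, φ) + ‖φ‖²`, which is the
squared `𝓗_α` distance from `v` to `φ` up to `α‖∇φ‖²`. Its derivative is computed exactly in
`relEnergy_rate`. The quadratic terms combine into `((z, ∇)φ, z)` with `z = v - φ`, bounded below by
`-e₀(φ)‖z‖²`. All other discrepancies from the Euler inequality have the form `(w - v, ψ) = α ∑
(∂ᵢv, ∂ᵢψ)` with `ψ` smooth, hence are `O(√α)` by the energy bound. An integrating factor gives the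
dissipative inequality for `v` up to `√α C`, with `C` independent of `α` and of the solution
(`exists_relEnergy_le`).

Finally let `α → 0` with `w(0) = u₀`. The fields `v` are bounded in `L²`, and each of their Fourier
coefficients is Lipschitz in time uniformly in `α`, because testing with a smooth divergence free
field moves all derivatives onto that field. A diagonal argument gives a subsequence converging
weakly at every `t ≥ 0` (`exists_subseq_weak_limit`). The inequality survives: its left side is
weakly lower semicontinuous, the solution enters its right side linearly, and the initial relative
energy converges since `R u₀ → u₀`. No weak limit of a quadratic term is ever taken.

Everything is done in the real orthonormal basis of Hartley functions `cos(k·x) + sin(k·x)`. There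
`R`, `∂ᵢR` and the Leray projector are explicit, so identities between bounded operators need
checking only on basis elements. -/

theorem measurableSet_cell : MeasurableSet cell := by
  have : cell = ⋂ i : Fin 3, (fun x : E => x i) ⁻¹' Ioo (-Real.pi) Real.pi := by
    ext x; simp [cell]
  rw [this]
  exact MeasurableSet.iInter fun i => (by fun_prop : Measurable fun x : E => x i) measurableSet_Ioo

section Torus

attribute [local instance] instMeasureSpaceUnitAddCircle

/-- The representative in the period cell of a point of the torus. -/
def torusRep (x : UnitAddTorus (Fin 3)) : E :=
  (2 * Real.pi) • WithLp.toLp 2 (UnitAddTorus.measurableEquivPiIoc (fun _ => (-1 / 2 : ℝ)) x).1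

theorem torusRep_apply (x : UnitAddTorus (Fin 3)) (i : Fin 3) :
    torusRep x i = 2 * Real.pi * (AddCircle.equivIoc 1 (-1 / 2 : ℝ) (x i)).1 := by
  simp [torusRep]

theorem measurable_torusRep : Measurable torusRep := by
  have h1 : Measurable fun x : UnitAddTorus (Fin 3) =>
      (UnitAddTorus.measurableEquivPiIoc (fun _ => (-1 / 2 : ℝ)) x).1 :=
    measurable_subtype_coe.comp (UnitAddTorus.measurableEquivPiIoc _).measurable
  exact (measurable_const_smul (2 * Real.pi) : Measurable fun x : E => (2 * Real.pi) • x).comp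
    ((WithLp.measurable_toLp 2 (Fin 3 → ℝ)).comp h1)

/-- The torus carries its probability measure, which accounts for the factor `(2π)⁻³`. The half-open
unit cube of representatives differs from the open one by a null set. -/
theorem map_torusRep :
    Measure.map torusRep (volume : Measure (UnitAddTorus (Fin 3))) =
      ENNReal.ofReal ((2 * Real.pi) ^ 3)⁻¹ • (volume : Measure E).restrict cell := by
  have hpi := Real.pi_pos
  set S : Set (Fin 3 → ℝ) := {x | ∀ i, x i ∈ Ioc (-1 / 2 : ℝ) (-1 / 2 + 1)} with hS
  have hSm : MeasurableSet S := MeasurableSet.univ_pi' fun i => measurableSet_Ioc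
  have h1 := (UnitAddTorus.measurePreserving_equivPiIoc (d := Fin 3) fun _ => (-1 / 2 : ℝ)).map_eq
  have h2 : Measure.map (Subtype.val : {x : Fin 3 → ℝ // ∀ i, x i ∈ Ioc (-1 / 2 : ℝ) (-1 / 2 + 1)} →
      (Fin 3 → ℝ)) (Measure.comap Subtype.val volume)
      = volume.restrict S := map_comap_subtype_coe hSm _
  have h3 : volume.restrict S = (volume : Measure (Fin 3 → ℝ)).restrict
      (WithLp.toLp 2 ⁻¹' ((fun x : E => (2 * Real.pi) • x) ⁻¹' cell)) := by
    apply Measure.restrict_congr_set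
    have e1 : (WithLp.toLp 2 ⁻¹' ((fun x : E => (2 * Real.pi) • x) ⁻¹' cell) : Set (Fin 3 → ℝ))
        = univ.pi fun _ => Ioo (-1 / 2 : ℝ) (1 / 2) := by
      ext x
      simp only [cell, mem_preimage, mem_ofPred_eq, mem_univ_pi, PiLp.smul_apply, smul_eq_mul, mem_Ioo]
      refine forall_congr' fun i => ?_
      constructor
      · rintro ⟨a, b⟩; constructor <;> nlinarith
      · rintro ⟨a, b⟩; constructor <;> nlinarith
    have e2 : S = univ.pi fun _ => Ioc (-1 / 2 : ℝ) (1 / 2) := by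
      ext x
      simp only [hS, mem_ofPred_eq, mem_univ_pi]
      norm_num
    rw [e1, e2]
    exact (Measure.univ_pi_Ioc_ae_eq_Icc (f := fun _ : Fin 3 => (-1 / 2 : ℝ))
      (g := fun _ => 1 / 2)).trans Measure.univ_pi_Ioo_ae_eq_Icc.symm
  have hcell := measurableSet_cell
  have hsm : Measurable fun x : E => (2 * Real.pi) • x := measurable_const_smul _
  have h4 := ((PiLp.volume_preserving_toLp (Fin 3)).restrict_preimage (hsm hcell)).map_eq
  have h5 : Measure.map (fun x : E => (2 * Real.pi) • x)
      ((volume : Measure E).restrict ((fun x : E => (2 * Real.pi) • x) ⁻¹' cell)) =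
      ENNReal.ofReal ((2 * Real.pi) ^ 3)⁻¹ • (volume : Measure E).restrict cell := by
    rw [← Measure.restrict_map hsm hcell, Measure.map_addHaar_smul _ (by positivity),
      Measure.restrict_smul, finrank_euclideanSpace_fin, abs_of_pos (by positivity)]
  rw [← h5, ← h4, ← h3, ← h2, ← h1]
  rw [Measure.map_map measurable_subtype_coe (UnitAddTorus.measurableEquivPiIoc _).measurable,
    Measure.map_map (WithLp.measurable_toLp 2 (Fin 3 → ℝ))
      (measurable_subtype_coe.comp (UnitAddTorus.measurableEquivPiIoc _).measurable),
    Measure.map_map hsm ((WithLp.measurable_toLp 2 (Fin 3 → ℝ)).comp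
      (measurable_subtype_coe.comp (UnitAddTorus.measurableEquivPiIoc _).measurable))]
  rfl

theorem mFourier_eq_torusRep (n : Fin 3 → ℤ) (x : UnitAddTorus (Fin 3)) :
    UnitAddTorus.mFourier n x =
      Complex.exp (((∑ i, (n i : ℝ) * torusRep x i : ℝ) : ℂ) * Complex.I) := by
  simp only [UnitAddTorus.mFourier, ContinuousMap.coe_mk]
  push_cast
  rw [Finset.sum_mul, Complex.exp_sum]
  refine Finset.prod_congr rfl fun i _ => ?_
  have h : ((AddCircle.equivIoc 1 (-1 / 2 : ℝ) (x i)).1 : UnitAddCircle) = x i :=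
    AddCircle.coe_equivIoc 
  conv_lhs => rw [← h]
  rw [fourier_coe_apply, torusRep_apply]
  congr 1
  push_cast
  ring

/-- A square integrable function on the period cell which is orthogonal to all trigonometric
monomials vanishes. -/
theorem ae_eq_zero_of_integral_exp_eq_zero {f : E → ℂ}
    (hf : MemLp f 2 ((volume : Measure E).restrict cell))
    (h : ∀ n : Fin 3 → ℤ, ∫ x in cell,
      Complex.exp (((∑ i, (n i : ℝ) * x i : ℝ) : ℂ) * Complex.I) * f x = 0) :
    f =ᵐ[(volume : Measure E).restrict cell] 0 := by
  have hpi := Real.pi_pos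
  set c : ENNReal := ENNReal.ofReal ((2 * Real.pi) ^ 3)⁻¹ with hc
  have hc0 : c ≠ 0 := by rw [hc]; simp; positivity
  have hct : c ≠ ⊤ := ENNReal.ofReal_ne_top
  have hmp : MeasurePreserving torusRep (volume : Measure (UnitAddTorus (Fin 3)))
      (c • (volume : Measure E).restrict cell) := ⟨measurable_torusRep, map_torusRep⟩
  have hf' : MemLp f 2 (c • (volume : Measure E).restrict cell) := hf.smul_measure hct
  have hF : MemLp (f ∘ torusRep) 2 (volume : Measure (UnitAddTorus (Fin 3))) :=
    hf'.comp_measurePreserving hmp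
  have hz : hF.toLp _ = 0 := by
    apply (UnitAddTorus.mFourierBasis (d := Fin 3)).repr.injective
    rw [map_zero]
    ext n
    rw [UnitAddTorus.mFourierBasis_repr, UnitAddTorus.mFourierCoeff]
    have e1 : ∫ t, UnitAddTorus.mFourier (-n) t • (hF.toLp (f ∘ torusRep)) t =
        ∫ t, (fun y : E => Complex.exp (((∑ i, ((-n) i : ℝ) * y i : ℝ) : ℂ) * Complex.I) * f y)
          (torusRep t) := by
      refine integral_congr_ae ?_
      filter_upwards [hF.coeFn_toLp] with t ht
      rw [ht, mFourier_eq_torusRep, smul_eq_mul]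
      rfl
    have hm : AEStronglyMeasurable
        (fun y : E => Complex.exp (((∑ i, ((-n) i : ℝ) * y i : ℝ) : ℂ) * Complex.I) * f y)
        (Measure.map torusRep volume) := by
      rw [map_torusRep]
      exact (by fun_prop : Continuous fun y : E =>
        Complex.exp (((∑ i, ((-n) i : ℝ) * y i : ℝ) : ℂ) * Complex.I)).aestronglyMeasurable.mul
          hf'.aestronglyMeasurable
    rw [e1, ← integral_map measurable_torusRep.aemeasurable hm, map_torusRep,
      integral_smul_measure]
    have := h (-n)
    simp only [Pi.neg_apply] at this ⊢
    rw [this, smul_zero]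
    rfl
  have hF0 : f ∘ torusRep =ᵐ[volume] 0 := by
    have := hF.coeFn_toLp
    rw [hz] at this
    exact this.symm.trans (Lp.coeFn_zero _ _ _)
  have h6 : eLpNorm f 2 (c • (volume : Measure E).restrict cell) = 0 := by
    rw [← eLpNorm_comp_measurePreserving hf'.aestronglyMeasurable hmp, eLpNorm_congr_ae hF0]
    simp
  rw [eLpNorm_eq_zero_iff hf'.aestronglyMeasurable (by simp)] at h6
  exact (Measure.ae_ennreal_smul_measure_iff hc0).1 h6

end Torus

/-- The integral over the period cell of a partial derivative of a periodic function vanishes. -/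
theorem integral_partial_eq_zero {f : E → ℝ} (hf : ContDiff ℝ 1 f) (hp : Periodic f) (i : Fin 3) :
    ∫ x in cell, fderiv ℝ f x (unitVec i) = 0 := by
  have hpi := Real.pi_pos
  have hcd : Continuous fun x => fderiv ℝ f x (unitVec i) :=
    (hf.continuous_fderiv (by simp)).clm_apply continuous_const
  let L : (Fin 3 → ℝ) →L[ℝ] E := (EuclideanSpace.equiv (Fin 3) ℝ).symm.toContinuousLinearMap
  have hL : ∀ y, L y = WithLp.toLp 2 y := fun y => rfl
  have h1 : ∫ x in cell, fderiv ℝ f x (unitVec i) =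
      ∫ y in (univ.pi fun _ : Fin 3 => Ioo (-Real.pi) Real.pi),
        fderiv ℝ f (L y) (unitVec i) := by
    have := (PiLp.volume_preserving_toLp (Fin 3)).setIntegral_preimage_emb
      (MeasurableEquiv.toLp 2 (Fin 3 → ℝ)).measurableEmbedding
      (fun x => fderiv ℝ f x (unitVec i)) cell
    rw [← this]
    congr 2
    ext x
    simp [cell]
  rw [h1, volume_pi, setIntegral_congr_set Measure.univ_pi_Ioo_ae_eq_Icc]
  -- Divergence theorem for the field with `f` in slot `i` and zero elsewhere; by periodicity the
  -- two opposite faces cancel.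
  have key := integral_divergence_of_hasFDerivAt_off_countable' (n := 2)
    (fun _ => -Real.pi) (fun _ => Real.pi) (fun _ => by linarith)
    (fun j y => if j = i then f (L y) else 0)
    (fun j y => if j = i then (fderiv ℝ f (L y)).comp L else 0) ∅ countable_empty
    (by
      intro j
      by_cases hj : j = i
      · simp only [hj, if_true]; exact (hf.continuous.comp L.continuous).continuousOn
      · simp only [hj, if_false]; exact continuousOn_const)
    (by
      intro x _ j
      by_cases hj : j = i
      · simp only [hj, if_true]
        exact (hf.differentiable (by simp) _).hasFDerivAt.comp x L.hasFDerivAt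
      · simp only [hj, if_false]; exact hasFDerivAt_const _ _)
    (by
      apply Continuous.integrableOn_Icc
      refine continuous_finsetSum _ fun j _ => ?_
      by_cases hj : j = i
      · simp only [hj, if_true]
        exact ((hf.continuous_fderiv (by simp)).comp L.continuous).clm_apply continuous_const
      · simp only [hj, if_false]; exact continuous_const)
  have e : ∀ y, ∑ j, (if j = i then (fderiv ℝ f (L y)).comp L else 0) (Pi.single j 1) =
      fderiv ℝ f (L y) (unitVec i) := by
    intro y
    rw [Finset.sum_eq_single i]
    · simp [hL]
    · intro j _ hj; simp [hj]
    · simp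
  simp only [e] at key
  rw [← volume_pi, key]
  refine Finset.sum_eq_zero fun j _ => ?_
  rw [sub_eq_zero]
  refine integral_congr_ae (Eventually.of_forall fun y => ?_)
  by_cases hj : j = i
  · simp only [hj, if_true]
    refine Eq.trans ?_ (hp _ i)
    congr 1
    ext k
    rcases eq_or_ne k i with rfl | hk
    · simp [hL]; ring
    · obtain ⟨k', rfl⟩ := Fin.exists_succAbove_eq hk
      simp [hL]
  · simp only [hj, if_false]

end DampedEuler
end

/-! ### The Hartley orthonormal basis of `L²` -/

noncomputable section

namespace DampedEuler

theorem isCompact_bigBall :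
    IsCompact (Metric.closedBall (0 : E) (Real.sqrt (3 * Real.pi ^ 2))) :=
  isCompact_closedBall _ _

theorem volume_cell : (volume : Measure E) cell = ENNReal.ofReal ((2 * Real.pi) ^ 3) := by
  have h := (PiLp.volume_preserving_toLp (Fin 3)).measure_preimage
    measurableSet_cell.nullMeasurableSet
  have e : (WithLp.toLp 2 ⁻¹' cell : Set (Fin 3 → ℝ)) =
      univ.pi fun _ => Ioo (-Real.pi) Real.pi := by
    ext x; simp [cell]
  have h2 := Real.volume_pi_Ioo (a := fun _ : Fin 3 => -Real.pi) (b := fun _ => Real.pi)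
  rw [← h, e, h2]
  simp only [Finset.prod_const, Finset.card_univ, Fintype.card_fin]
  rw [← ENNReal.ofReal_pow (by linarith [Real.pi_pos])]
  congr 2
  ring

instance instIsFiniteMeasureCell : IsFiniteMeasure ((volume : Measure E).restrict cell) :=
  ⟨by rw [Measure.restrict_apply_univ, volume_cell]; exact ENNReal.ofReal_lt_top⟩

theorem coeFn_toL2 {f : E → E} (hf : Continuous f) :
    toL2 f hf =ᵐ[(volume : Measure E).restrict cell] f :=
  MemLp.coeFn_toLp _

theorem inner_toL2 (v : L2Field) {f : E → E} (hf : Continuous f) :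
    inner ℝ v (toL2 f hf) = ∫ x in cell, inner ℝ (v x) (f x) := by
  rw [L2.inner_def]
  refine integral_congr_ae ?_
  filter_upwards [coeFn_toL2 hf] with x hx
  rw [hx]

theorem toL2_inner_toL2 {f g : E → E} (hf : Continuous f) (hg : Continuous g) :
    inner ℝ (toL2 f hf) (toL2 g hg) = ∫ x in cell, inner ℝ (f x) (g x) := by
  rw [inner_toL2]
  refine integral_congr_ae ?_
  filter_upwards [coeFn_toL2 hf] with x hx
  rw [hx]

theorem integrableOn_cell_of_continuous {F : Type*} [NormedAddCommGroup F] {f : E → F}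
    (hf : Continuous f) : IntegrableOn f cell :=
  (hf.continuousOn.integrableOn_compact isCompact_bigBall).mono_set cell_subset

theorem toL2_sub {f g : E → E} (hf : Continuous f) (hg : Continuous g) :
    toL2 (fun x => f x - g x) (hf.sub hg) = toL2 f hf - toL2 g hg := by
  rw [toL2, toL2, toL2, ← MemLp.toLp_sub]; rfl

theorem toL2_smul {f : E → E} (hf : Continuous f) (c : ℝ) :
    toL2 (fun x => c • f x) (hf.const_smul c) = c • toL2 f hf := by
  rw [toL2, toL2, ← MemLp.toLp_const_smul]; rfl

theorem norm_toL2_le {f : E → E} (hf : Continuous f) {C : ℝ} (hC : 0 ≤ C)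
    (h : ∀ x ∈ cell, ‖f x‖ ≤ C) : ‖toL2 f hf‖ ≤ Real.sqrt ((2 * Real.pi) ^ 3) * C := by
  have h1 := Lp.norm_le_of_ae_bound (f := toL2 f hf) hC (by
    filter_upwards [coeFn_toL2 hf, ae_restrict_mem measurableSet_cell] with x hx hm
    rw [hx]; exact h x hm)
  refine h1.trans (mul_le_mul_of_nonneg_right (le_of_eq ?_) hC)
  have : (measureUnivNNReal ((volume : Measure E).restrict cell) : ℝ) = (2 * Real.pi) ^ 3 := by
    rw [measureUnivNNReal, ENNReal.coe_toNNReal_eq_toReal, Measure.restrict_apply_univ,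
      volume_cell, ENNReal.toReal_ofReal (by have := Real.pi_pos; positivity)]
  rw [this, Real.sqrt_eq_rpow]
  simp

/-- The wave `x ↦ k · x` of integer frequency `k`. -/
def phase (k : Fin 3 → ℤ) : E →L[ℝ] ℝ :=
  ∑ i, (k i : ℝ) • (EuclideanSpace.proj i : E →L[ℝ] ℝ)

theorem phase_apply (k : Fin 3 → ℤ) (x : E) : phase k x = ∑ i, (k i : ℝ) * x i := by
  simp [phase]

theorem phase_unitVec (k : Fin 3 → ℤ) (i : Fin 3) : phase k (unitVec i) = k i := by
  rw [phase_apply, Finset.sum_eq_single i]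
  · simp
  · intro j _ hj; simp [hj]
  · simp

theorem phase_single (k : Fin 3 → ℤ) (i : Fin 3) (c : ℝ) :
    phase k (EuclideanSpace.single i c) = k i * c := by
  rw [phase_apply, Finset.sum_eq_single i]
  · simp
  · intro j _ hj; simp [hj]
  · simp

theorem phase_neg (k : Fin 3 → ℤ) (x : E) : phase (-k) x = -phase k x := by
  simp [phase_apply]

theorem phase_add (k l : Fin 3 → ℤ) (x : E) : phase (k + l) x = phase k x + phase l x := by
  simp [phase_apply, add_mul, Finset.sum_add_distrib]

theorem phase_sub (k l : Fin 3 → ℤ) (x : E) : phase (k - l) x = phase k x - phase l x := by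
  rw [sub_eq_add_neg, phase_add, phase_neg]; ring

theorem phase_periodic (k : Fin 3 → ℤ) (x : E) (i : Fin 3) :
    phase k (x + EuclideanSpace.single i (2 * Real.pi)) = phase k x + k i * (2 * Real.pi) := by
  rw [map_add, phase_single]

/-- If `k i ≠ 0`, then `k i * cos (k·x)` is the `i`-th partial derivative of the periodic function
`sin (k·x)`. -/
theorem integral_cos_phase (k : Fin 3 → ℤ) :
    ∫ x in cell, Real.cos (phase k x) = if k = 0 then (2 * Real.pi) ^ 3 else 0 := by
  split_ifs with h
  · subst h
    have : ∀ x : E, Real.cos (phase 0 x) = 1 := fun x => by simp [phase_apply]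
    simp only [this]
    rw [setIntegral_const, smul_eq_mul, mul_one, measureReal_def, volume_cell,
      ENNReal.toReal_ofReal (by have := Real.pi_pos; positivity)]
  · obtain ⟨i, hi⟩ := Function.ne_iff.1 h
    have hd : ∀ x, HasFDerivAt (fun x => Real.sin (phase k x)) (Real.cos (phase k x) • phase k) x :=
      fun x => ((phase k).hasFDerivAt (x := x)).sin
    have := integral_partial_eq_zero (f := fun x => Real.sin (phase k x))
      (Real.contDiff_sin.comp (phase k).contDiff)
      (fun x i => by
        simp only [phase_periodic]
        exact Real.sin_add_int_mul_two_pi _ _) i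
    simp only [(hd _).fderiv, _root_.smul_apply, phase_unitVec, smul_eq_mul] at this
    rw [integral_mul_const] at this
    have hi' : (k i : ℝ) ≠ 0 := by exact_mod_cast hi
    exact (mul_eq_zero.1 this).resolve_right hi'

theorem integral_sin_phase (k : Fin 3 → ℤ) : ∫ x in cell, Real.sin (phase k x) = 0 := by
  by_cases h : k = 0
  · subst h; simp [phase_apply]
  · obtain ⟨i, hi⟩ := Function.ne_iff.1 h
    have hd : ∀ x, HasFDerivAt (fun x => Real.cos (phase k x))
        (-Real.sin (phase k x) • phase k) x :=
      fun x => ((phase k).hasFDerivAt (x := x)).cos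
    have := integral_partial_eq_zero (f := fun x => Real.cos (phase k x))
      (Real.contDiff_cos.comp (phase k).contDiff)
      (fun x i => by
        simp only [phase_periodic]
        exact Real.cos_add_int_mul_two_pi _ _) i
    simp only [(hd _).fderiv, _root_.smul_apply, phase_unitVec, smul_eq_mul] at this
    rw [integral_mul_const, integral_neg] at this
    have hi' : (k i : ℝ) ≠ 0 := by exact_mod_cast hi
    exact neg_eq_zero.1 ((mul_eq_zero.1 this).resolve_right hi')

/-- The normalizing constant `(2π)^(-3/2)`. -/
def hartConst : ℝ := (Real.sqrt ((2 * Real.pi) ^ 3))⁻¹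

theorem hartConst_pos : 0 < hartConst := by
  have := Real.pi_pos
  unfold hartConst; positivity

theorem hartConst_sq : hartConst ^ 2 * (2 * Real.pi) ^ 3 = 1 := by
  have := Real.pi_pos
  rw [hartConst, inv_pow, Real.sq_sqrt (by positivity), inv_mul_cancel₀ (by positivity)]

/-- The normalized Hartley function of frequency `k`. These form a real orthonormal basis. -/
def hart (k : Fin 3 → ℤ) (x : E) : ℝ :=
  hartConst * (Real.cos (phase k x) + Real.sin (phase k x))

theorem contDiff_hart (k : Fin 3 → ℤ) : ContDiff ℝ ∞ (hart k) :=
  contDiff_const.mul ((Real.contDiff_cos.comp (phase k).contDiff).add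
    (Real.contDiff_sin.comp (phase k).contDiff))

theorem periodic_hart (k : Fin 3 → ℤ) : Periodic (hart k) := fun x i => by
  rw [hart, phase_periodic, Real.cos_add_int_mul_two_pi, Real.sin_add_int_mul_two_pi, hart]

/-- The derivative of `cos + sin` is `cos - sin`, the Hartley function of the opposite frequency.
Differentiation thus sends `k` to `-k`, and doing it twice gives an eigenfunction of the Laplacian.
-/
theorem hasFDerivAt_hart (k : Fin 3 → ℤ) (x : E) :
    HasFDerivAt (hart k) (hart (-k) x • phase k) x := by
  have h := ((((phase k).hasFDerivAt (x := x)).cos).add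
    (((phase k).hasFDerivAt (x := x)).sin)).const_mul hartConst
  refine h.congr_fderiv ?_
  ext v
  simp [hart, phase_neg]
  ring

theorem abs_hart_le (k : Fin 3 → ℤ) (x : E) : |hart k x| ≤ 2 * hartConst := by
  rw [hart, abs_mul, abs_of_pos hartConst_pos, mul_comm]
  gcongr
  · exact hartConst_pos.le
  calc _ ≤ _ := abs_add_le _ _
    _ ≤ 1 + 1 := add_le_add (Real.abs_cos_le_one _) (Real.abs_sin_le_one _)
    _ = 2 := by norm_num

/-- The product of two Hartley functions is `cos` of the difference of the phases plus `sin` of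
their sum. Only the cosine can have nonzero mean, and only when the frequencies agree. -/
theorem integral_hart_mul_hart (k l : Fin 3 → ℤ) :
    ∫ x in cell, hart k x * hart l x = if k = l then 1 else 0 := by
  have e : ∀ x, hart k x * hart l x = hartConst ^ 2 * Real.cos (phase (k - l) x)
      + hartConst ^ 2 * Real.sin (phase (k + l) x) := by
    intro x
    rw [phase_sub, phase_add, Real.cos_sub, Real.sin_add, hart, hart]
    ring
  simp only [e]
  have hc : Continuous fun x : E => Real.cos (phase (k - l) x) := by fun_prop
  have hs : Continuous fun x : E => Real.sin (phase (k + l) x) := by fun_prop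
  rw [integral_add ((integrableOn_cell_of_continuous hc).const_mul _)
    ((integrableOn_cell_of_continuous hs).const_mul _), integral_const_mul, integral_const_mul,
    integral_cos_phase, integral_sin_phase]
  simp only [sub_eq_zero]
  split_ifs
  · rw [hartConst_sq]; ring
  · ring

/-- The vector valued Hartley function of frequency `p.1` in direction `p.2`. -/
def hartVec (p : (Fin 3 → ℤ) × Fin 3) (x : E) : E := hart p.1 x • unitVec p.2

theorem contDiff_hartVec (p : (Fin 3 → ℤ) × Fin 3) : ContDiff ℝ ∞ (hartVec p) :=
  (contDiff_hart p.1).smul contDiff_const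

theorem periodic_hartVec (p : (Fin 3 → ℤ) × Fin 3) : Periodic (hartVec p) := fun x i => by
  rw [hartVec, periodic_hart, hartVec]

theorem inner_unitVec (v : E) (j : Fin 3) : inner ℝ v (unitVec j) = v j := by
  simp [EuclideanSpace.inner_single_right]

theorem inner_hartVec (v : E) (p : (Fin 3 → ℤ) × Fin 3) (x : E) :
    inner ℝ v (hartVec p x) = hart p.1 x * v p.2 := by
  rw [hartVec, inner_smul_right, inner_unitVec]

/-- `hartVec p` as an element of `L²`. -/
def hartL2 (p : (Fin 3 → ℤ) × Fin 3) : L2Field := toL2 (hartVec p) (contDiff_hartVec p).continuous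

theorem inner_hartL2 (v : L2Field) (p : (Fin 3 → ℤ) × Fin 3) :
    inner ℝ v (hartL2 p) = ∫ x in cell, hart p.1 x * v x p.2 := by
  rw [hartL2, inner_toL2]
  simp only [inner_hartVec]

theorem orthonormal_hartL2 : Orthonormal ℝ hartL2 := by
  rw [orthonormal_iff_ite]
  intro p q
  rw [hartL2, hartL2, toL2_inner_toL2]
  simp only [inner_hartVec]
  have e : ∀ x, hart q.1 x * (hartVec p x) q.2 =
      hart q.1 x * hart p.1 x * (if p.2 = q.2 then 1 else 0) := by
    intro x
    simp only [hartVec, PiLp.smul_apply, smul_eq_mul, unitVec, PiLp.single_apply]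
    rw [mul_assoc]
    simp only [eq_comm]
  simp only [e]
  rw [integral_mul_const, integral_hart_mul_hart]
  by_cases h1 : q.1 = p.1 <;> by_cases h2 : p.2 = q.2 <;> simp [h1, h2, Prod.ext_iff]
  intro h; exact absurd h.symm h1

theorem memLp_component (v : L2Field) (j : Fin 3) :
    MemLp (fun x => v x j) 2 ((volume : Measure E).restrict cell) :=
  (EuclideanSpace.proj j : E →L[ℝ] ℝ).comp_memLp' (Lp.memLp v)

theorem integrableOn_mul_component (v : L2Field) (j : Fin 3) {f : E → ℝ} (hf : Continuous f) :
    IntegrableOn (fun x => f x * v x j) cell := by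
  have hv : IntegrableOn (fun x => v x j) cell := (memLp_component v j).integrable (by norm_num)
  obtain ⟨C, hC⟩ := isCompact_bigBall.exists_bound_of_continuousOn hf.continuousOn
  refine hv.bdd_mul (c := C) hf.aestronglyMeasurable ?_
  exact (ae_restrict_iff' measurableSet_cell).2 (Eventually.of_forall fun x hx =>
    hC x (cell_subset hx))

theorem eq_zero_of_inner_hartL2 (v : L2Field) (h : ∀ p, inner ℝ v (hartL2 p) = 0) : v = 0 := by
  have hj : ∀ j : Fin 3, ∀ᵐ x ∂((volume : Measure E).restrict cell), v x j = 0 := by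
    intro j
    have hcos : ∀ n : Fin 3 → ℤ, ∫ x in cell, Real.cos (phase n x) * v x j = 0 ∧
        ∫ x in cell, Real.sin (phase n x) * v x j = 0 := by
      intro n
      have hc : IntegrableOn (fun x => Real.cos (phase n x) * v x j) cell :=
        integrableOn_mul_component v j (by fun_prop)
      have hs : IntegrableOn (fun x => Real.sin (phase n x) * v x j) cell :=
        integrableOn_mul_component v j (by fun_prop)
      -- The coefficients at `n` and `-n` are, up to the constant, the sum and the difference of the
      -- cosine and sine integrals, so both integrals vanish. This yields the vanishing of the
      -- complex Fourier coefficients.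
      have h1 := h (n, j)
      have h2 := h (-n, j)
      rw [inner_hartL2] at h1 h2
      simp only [hart, phase_neg, Real.cos_neg, Real.sin_neg, mul_assoc, add_mul] at h1 h2
      rw [integral_const_mul, integral_add hc hs] at h1
      rw [integral_const_mul] at h2
      have e : ∫ x in cell, (Real.cos (phase n x) * v x j + -Real.sin (phase n x) * v x j) =
          (∫ x in cell, Real.cos (phase n x) * v x j)
            - ∫ x in cell, Real.sin (phase n x) * v x j := by
        rw [← integral_sub hc hs]
        congr 1; ext x; ring
      rw [e] at h2
      have h1' := (mul_eq_zero.1 h1).resolve_left hartConst_pos.ne'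
      have h2' := (mul_eq_zero.1 h2).resolve_left hartConst_pos.ne'
      constructor <;> linarith
    have key := ae_eq_zero_of_integral_exp_eq_zero (f := fun x => ((v x j : ℝ) : ℂ))
      ((memLp_component v j).ofReal) (by
        intro n
        have e : ∀ x : E, Complex.exp (((∑ i, (n i : ℝ) * x i : ℝ) : ℂ) * Complex.I)
            * ((v x j : ℝ) : ℂ) = ((Real.cos (phase n x) * v x j : ℝ) : ℂ)
              + ((Real.sin (phase n x) * v x j : ℝ) : ℂ) * Complex.I := by
          intro x
          rw [← phase_apply, Complex.exp_mul_I, ← Complex.ofReal_cos, ← Complex.ofReal_sin]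
          push_cast; ring
        simp only [e]
        have hc : IntegrableOn (fun x => Real.cos (phase n x) * v x j) cell :=
          integrableOn_mul_component v j (by fun_prop)
        have hs : IntegrableOn (fun x => Real.sin (phase n x) * v x j) cell :=
          integrableOn_mul_component v j (by fun_prop)
        rw [integral_add hc.ofReal (hs.ofReal.mul_const _), integral_mul_const,
          integral_complex_ofReal, integral_complex_ofReal, (hcos n).1, (hcos n).2]
        simp)
    filter_upwards [key] with x hx
    simpa using hx
  rw [Lp.eq_zero_iff_ae_eq_zero]
  filter_upwards [hj 0, hj 1, hj 2] with x h0 h1 h2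
  ext j
  fin_cases j
  · exact h0
  · exact h1
  · exact h2

/-- The Hartley basis of `L²`. -/
def hartBasis : HilbertBasis ((Fin 3 → ℤ) × Fin 3) ℝ L2Field :=
  HilbertBasis.mkOfOrthogonalEqBot orthonormal_hartL2 (by
    rw [Submodule.eq_bot_iff]
    intro v hv
    refine eq_zero_of_inner_hartL2 v fun p => ?_
    rw [real_inner_comm]
    exact hv _ (Submodule.subset_span (mem_range_self p)))

theorem coe_hartBasis (p : (Fin 3 → ℤ) × Fin 3) : hartBasis p = hartL2 p := by
  rw [hartBasis, HilbertBasis.coe_mkOfOrthogonalEqBot]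

/-- Bounded linear maps which agree on the Hartley basis are equal. -/
theorem clm_ext_hart {F : Type*} [NormedAddCommGroup F] [NormedSpace ℝ F] {S T : L2Field →L[ℝ] F}
    (h : ∀ p, S (hartL2 p) = T (hartL2 p)) : S = T := by
  refine ContinuousLinearMap.ext_on (s := range hartL2) ?_ (by rintro _ ⟨p, rfl⟩; exact h p)
  have := hartBasis.dense_span
  have e : (hartBasis : (Fin 3 → ℤ) × Fin 3 → L2Field) = hartL2 := funext coe_hartBasis
  rw [e] at this
  exact Submodule.dense_iff_topologicalClosure_eq_top.2 this

end DampedEuler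
end

/-! ### The resolvent `(1 - αΔ)⁻¹` as a Fourier multiplier -/

noncomputable section

namespace DampedEuler

/-- Prescribing the images of a Hilbert basis defines a bounded operator as soon as finite
combinations are controlled by the `ℓ²` norm of the coefficients. -/
theorem exists_clm_of_hilbertBasis {ι H Y : Type*} [NormedAddCommGroup H] [InnerProductSpace ℝ H]
    [NormedAddCommGroup Y] [NormedSpace ℝ Y] [CompleteSpace Y] (b : HilbertBasis ι ℝ H)
    (f : ι → Y) (M : ℝ) (hM : 0 ≤ M)
    (hf : ∀ (s : Finset ι) (c : ι → ℝ), ‖∑ i ∈ s, c i • f i‖ ≤ M * Real.sqrt (∑ i ∈ s, c i ^ 2)) :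
    ∃ T : H →L[ℝ] Y, ‖T‖ ≤ M ∧ ∀ i, T (b i) = f i := by
  have hsq : ∀ x : H, Summable fun i => (b.repr x i) ^ 2 := by
    intro x
    have := b.summable_inner_mul_inner x x
    refine this.congr fun i => ?_
    rw [b.repr_apply_apply, real_inner_comm x, sq]
  have hbes : ∀ (x : H) (s : Finset ι), Real.sqrt (∑ i ∈ s, (b.repr x i) ^ 2) ≤ ‖x‖ := by
    intro x s
    apply Real.sqrt_le_iff.2 ⟨norm_nonneg _, ?_⟩
    have := b.orthonormal.sum_inner_products_le x (s := s)
    simpa [b.repr_apply_apply] using this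
  have hsum : ∀ x : H, Summable fun i => b.repr x i • f i := by
    intro x
    rw [summable_iff_vanishing_norm]
    intro ε hε
    -- Square summability of the coefficients makes the tails of the series small; `M + 1` replaces
    -- `M` to avoid dividing by zero.
    obtain ⟨s, hs⟩ := summable_iff_vanishing_norm.1 (hsq x) ((ε / (M + 1)) ^ 2) (by positivity)
    refine ⟨s, fun t ht => ?_⟩
    have h1 := hs t ht
    rw [Real.norm_of_nonneg (Finset.sum_nonneg fun i _ => sq_nonneg _)] at h1
    have h2 : Real.sqrt (∑ i ∈ t, (b.repr x i) ^ 2) < ε / (M + 1) :=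
      (Real.sqrt_lt' (by positivity)).2 h1
    calc _ ≤ M * Real.sqrt (∑ i ∈ t, (b.repr x i) ^ 2) := hf t _
      _ ≤ (M + 1) * Real.sqrt (∑ i ∈ t, (b.repr x i) ^ 2) := by gcongr; linarith
      _ < (M + 1) * (ε / (M + 1)) := by gcongr
      _ = ε := by field_simp
  let T₀ : H →ₗ[ℝ] Y :=
    { toFun := fun x => ∑' i, b.repr x i • f i
      map_add' := fun x y => by
        rw [← (hsum x).tsum_add (hsum y)]
        simp [add_smul]
      map_smul' := fun c x => by
        rw [RingHom.id_apply, ← (hsum x).tsum_const_smul]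
        simp [smul_smul] }
  have hT : ∀ x, ‖T₀ x‖ ≤ M * ‖x‖ := by
    intro x
    refine le_of_tendsto ((hsum x).hasSum.norm) (Eventually.of_forall fun s => ?_)
    exact (hf s _).trans (mul_le_mul_of_nonneg_left (hbes x s) hM)
  refine ⟨T₀.mkContinuous M hT, T₀.mkContinuous_norm_le hM hT, fun i => ?_⟩
  change ∑' j, b.repr (b i) j • f j = f i
  classical
  rw [tsum_eq_single i]
  · rw [b.repr_self, lp.single_apply_self, one_smul]
  · intro j hj
    rw [b.repr_self, lp.single_apply_ne _ _ _ hj, zero_smul]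

/-- The Fourier multiplier of `(1 - αΔ)⁻¹`. -/
def mult (α : ℝ) (k : Fin 3 → ℤ) : ℝ := (1 + α * ∑ i, (k i : ℝ) ^ 2)⁻¹

theorem mult_denom_pos {α : ℝ} (hα : 0 ≤ α) (k : Fin 3 → ℤ) :
    0 < 1 + α * ∑ i, (k i : ℝ) ^ 2 := by positivity

theorem mult_pos {α : ℝ} (hα : 0 ≤ α) (k : Fin 3 → ℤ) : 0 < mult α k :=
  inv_pos.2 (mult_denom_pos hα k)

theorem mult_le_one {α : ℝ} (hα : 0 ≤ α) (k : Fin 3 → ℤ) : mult α k ≤ 1 := by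
  apply inv_le_one_of_one_le₀
  have : 0 ≤ α * ∑ i, (k i : ℝ) ^ 2 := by positivity
  linarith

theorem mult_mul_denom {α : ℝ} (hα : 0 ≤ α) (k : Fin 3 → ℤ) :
    mult α k * (1 + α * ∑ i, (k i : ℝ) ^ 2) = 1 :=
  inv_mul_cancel₀ (mult_denom_pos hα k).ne'

/-- For an integer, `|k i| ≤ (k i)²`, which the denominator `1 + α|k|²` absorbs. This makes `∂ᵢ(1 -
αΔ)⁻¹` bounded on `L²`. -/
theorem abs_mult_mul_le {α : ℝ} (hα : 0 < α) (k : Fin 3 → ℤ) (i : Fin 3) :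
    |mult α k * k i| ≤ α⁻¹ := by
  rw [abs_mul, abs_of_pos (mult_pos hα.le k), mult, inv_mul_le_iff₀ (mult_denom_pos hα.le k)]
  have h1 : |(k i : ℝ)| ≤ (k i : ℝ) ^ 2 := by
    have : |k i| ≤ (k i) ^ 2 := by
      rw [← sq_abs]; nlinarith [abs_nonneg (k i), Int.one_le_abs (z := k i),
        (by by_cases h : k i = 0 <;> [left; right] <;> assumption : k i = 0 ∨ k i ≠ 0)]
    exact_mod_cast this
  have h2 : (k i : ℝ) ^ 2 ≤ ∑ i, (k i : ℝ) ^ 2 :=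
    Finset.single_le_sum (f := fun i => (k i : ℝ) ^ 2) (fun _ _ => sq_nonneg _) (Finset.mem_univ i)
  rw [← div_eq_mul_inv, le_div_iff₀ hα]
  nlinarith

/-- The terms decay like `|k|⁻⁴`, and `4` exceeds the rank `3` of the lattice. The frequency `0`
needs its own summand, since there the comparison term is `0⁻¹ = 0`. -/
theorem summable_mult_sq {α : ℝ} (hα : 0 < α) : Summable fun k : Fin 3 → ℤ => mult α k ^ 2 := by
  let L : Submodule ℤ (Fin 3 → ℝ) := Submodule.span ℤ (range (Pi.basisFun ℝ (Fin 3)))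
  have hmem : ∀ k : Fin 3 → ℤ, (fun i => (k i : ℝ)) ∈ L := by
    intro k
    have e : (fun i => (k i : ℝ)) = ∑ i, k i • Pi.basisFun ℝ (Fin 3) i := by
      ext j
      simp [Finset.sum_apply, Pi.single_apply]
    rw [e]
    exact Submodule.sum_mem _ fun i _ =>
      Submodule.smul_mem _ _ (Submodule.subset_span (mem_range_self i))
  have hrank : Module.finrank ℤ L < 4 := by
    rw [ZLattice.rank ℝ L]
    simp
  have h1 := ZLattice.summable_norm_pow_inv L 4 hrank
  let emb : (Fin 3 → ℤ) → L := fun k => ⟨fun i => (k i : ℝ), hmem k⟩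
  have hinj : Function.Injective emb := by
    intro k l h
    have := congrArg Subtype.val h
    ext i
    exact Int.cast_injective (α := ℝ) (congrFun this i)
  have h2 := h1.comp_injective hinj
  have h3 : Summable fun k : Fin 3 → ℤ => (if k = 0 then (1 : ℝ) else 0) :=
    (hasSum_ite_eq 0 (1 : ℝ)).summable
  refine Summable.of_nonneg_of_le (fun _ => sq_nonneg _) (fun k => ?_)
    (h3.add (h2.mul_left (α⁻¹ ^ 2)))
  by_cases hk : k = 0
  · have : mult α k ^ 2 ≤ 1 := pow_le_one₀ (mult_pos hα.le k).le (mult_le_one hα.le k)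
    simp only [hk, if_true] at this ⊢
    have : 0 ≤ α⁻¹ ^ 2 * ((fun z : L => ‖z‖⁻¹ ^ 4) ∘ emb) 0 := by
      simp only [Function.comp]; positivity
    linarith
  · simp only [hk, if_false, zero_add, Function.comp]
    have hpos : 0 < ‖emb k‖ := norm_pos_iff.2 fun h => hk (hinj (h.trans (by ext; simp [emb])))
    have hle : ‖emb k‖ ^ 2 ≤ ∑ i, (k i : ℝ) ^ 2 := by
      have h4 : ‖emb k‖ ≤ Real.sqrt (∑ i, (k i : ℝ) ^ 2) := by
        change ‖(fun i => (k i : ℝ))‖ ≤ _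
        refine (pi_norm_le_iff_of_nonneg (Real.sqrt_nonneg _)).2 fun i => ?_
        rw [Real.norm_eq_abs]
        apply Real.abs_le_sqrt
        exact Finset.single_le_sum (f := fun i => (k i : ℝ) ^ 2) (fun _ _ => sq_nonneg _)
          (Finset.mem_univ i)
      calc _ ≤ Real.sqrt (∑ i, (k i : ℝ) ^ 2) ^ 2 := by gcongr
        _ = _ := Real.sq_sqrt (by positivity)
    have : mult α k ≤ α⁻¹ * ‖emb k‖⁻¹ ^ 2 := by
      rw [mult, inv_pow, ← mul_inv]
      apply inv_anti₀ (by positivity)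
      nlinarith
    calc mult α k ^ 2 ≤ (α⁻¹ * ‖emb k‖⁻¹ ^ 2) ^ 2 := by
          gcongr; exact (mult_pos hα.le k).le
      _ = _ := by ring

/-- `hartVec p` as an element of `L^∞`. -/
def hartLinf (p : (Fin 3 → ℤ) × Fin 3) : Lp E ⊤ ((volume : Measure E).restrict cell) :=
  (memLp_top_of_bound (contDiff_hartVec p).continuous.aestronglyMeasurable (2 * hartConst)
    (Eventually.of_forall fun x => by
      rw [hartVec, norm_smul, Real.norm_eq_abs]
      simpa using abs_hart_le p.1 x)).toLp (hartVec p)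

theorem coeFn_hartLinf (p : (Fin 3 → ℤ) × Fin 3) :
    hartLinf p =ᵐ[(volume : Measure E).restrict cell] hartVec p := MemLp.coeFn_toLp _

theorem norm_hartLinf_le (p : (Fin 3 → ℤ) × Fin 3) : ‖hartLinf p‖ ≤ 2 * hartConst := by
  have hc := hartConst_pos
  have h1 := Lp.norm_le_of_ae_bound (f := hartLinf p) (C := 2 * hartConst) (by positivity) (by
    filter_upwards [coeFn_hartLinf p] with x hx
    rw [hx, hartVec, norm_smul, Real.norm_eq_abs]
    simpa using abs_hart_le p.1 x)
  simpa using h1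

/-- The map `e` only permutes basis vectors injectively, so Pythagoras applies. It is the identity
for `res` and the reflection of frequencies for `resPartial`. -/
theorem norm_sum_hartL2_le {m : (Fin 3 → ℤ) × Fin 3 → ℝ} {M : ℝ} (hM : 0 ≤ M)
    (hm : ∀ p, |m p| ≤ M) (e : (Fin 3 → ℤ) × Fin 3 → (Fin 3 → ℤ) × Fin 3)
    (he : Function.Injective e) (s : Finset ((Fin 3 → ℤ) × Fin 3)) (c : (Fin 3 → ℤ) × Fin 3 → ℝ) :
    ‖∑ p ∈ s, c p • (m p • hartL2 (e p))‖ ≤ M * Real.sqrt (∑ p ∈ s, c p ^ 2) := by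
  have ho := orthonormal_hartL2.comp e he
  rw [← Real.sqrt_sq hM, ← Real.sqrt_mul (sq_nonneg M)]
  apply Real.le_sqrt_of_sq_le
  rw [← real_inner_self_eq_norm_sq]
  simp only [smul_smul]
  have h1 := ho.inner_sum (fun p => c p * m p) (fun p => c p * m p) s
  simp only [Function.comp_apply, conj_trivial] at h1
  rw [h1, Finset.mul_sum]
  refine Finset.sum_le_sum fun p _ => ?_
  have : m p ^ 2 ≤ M ^ 2 := sq_le_sq' (abs_le.1 (hm p)).1 (abs_le.1 (hm p)).2
  nlinarith [sq_nonneg (c p)]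

section Resolvent

variable {α : ℝ} (hα : 0 < α)

-- This is the embedding of `H²` in `L^∞` in dimension three: the basis functions are uniformly
-- bounded, and Cauchy–Schwarz pairs the coefficients with the square summable multiplier.
include hα in
theorem exists_resLinf : ∃ T : L2Field →L[ℝ] Lp E ⊤ ((volume : Measure E).restrict cell),
    ∀ p, T (hartL2 p) = mult α p.1 • hartLinf p := by
  have hs : Summable fun p : (Fin 3 → ℤ) × Fin 3 => mult α p.1 ^ 2 := by
    have := (summable_mult_sq hα).mul_of_nonneg (g := fun _ : Fin 3 => (1 : ℝ))
      (hasSum_fintype _).summable (fun _ => sq_nonneg _) (fun _ => zero_le_one)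
    simpa using this
  have hc := hartConst_pos
  obtain ⟨T, -, hT⟩ := exists_clm_of_hilbertBasis hartBasis (fun p => mult α p.1 • hartLinf p)
    (2 * hartConst * Real.sqrt (∑' p : (Fin 3 → ℤ) × Fin 3, mult α p.1 ^ 2)) (by positivity) (by
      intro s c
      calc ‖∑ p ∈ s, c p • mult α p.1 • hartLinf p‖
          ≤ ∑ p ∈ s, |c p| * |mult α p.1| * (2 * hartConst) := by
            refine norm_sum_le_of_le _ fun p _ => ?_
            rw [norm_smul, norm_smul, Real.norm_eq_abs, Real.norm_eq_abs, mul_assoc]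
            gcongr
            exact norm_hartLinf_le p
        _ = (2 * hartConst) * ∑ p ∈ s, |mult α p.1| * |c p| := by
            rw [Finset.mul_sum]; congr 1; ext p; ring
        _ ≤ (2 * hartConst) * (Real.sqrt (∑ p ∈ s, mult α p.1 ^ 2)
              * Real.sqrt (∑ p ∈ s, c p ^ 2)) := by
            gcongr
            have := Real.sum_mul_le_sqrt_mul_sqrt s (fun p => |mult α p.1|) (fun p => |c p|)
            simpa only [sq_abs] using this
        _ ≤ (2 * hartConst) * (Real.sqrt (∑' p : (Fin 3 → ℤ) × Fin 3, mult α p.1 ^ 2)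
              * Real.sqrt (∑ p ∈ s, c p ^ 2)) := by
            gcongr
            exact hs.sum_le_tsum s fun _ _ => sq_nonneg _
        _ = _ := by ring)
  exact ⟨T, fun p => by rw [← coe_hartBasis, hT]⟩

/-- The operator `(1 - αΔ)⁻¹` from `L²` to `L^∞`. -/
def resLinf : L2Field →L[ℝ] Lp E ⊤ ((volume : Measure E).restrict cell) :=
  (exists_resLinf hα).choose

theorem resLinf_hart (p : (Fin 3 → ℤ) × Fin 3) :
    resLinf hα (hartL2 p) = mult α p.1 • hartLinf p := (exists_resLinf hα).choose_spec p

include hα in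
theorem exists_res : ∃ T : L2Field →L[ℝ] L2Field, ‖T‖ ≤ 1 ∧
    ∀ p, T (hartL2 p) = mult α p.1 • hartL2 p := by
  obtain ⟨T, h1, hT⟩ := exists_clm_of_hilbertBasis hartBasis (fun p => mult α p.1 • hartL2 p)
    1 zero_le_one (norm_sum_hartL2_le zero_le_one (m := fun p => mult α p.1)
      (fun p => by rw [abs_of_pos (mult_pos hα.le _)]; exact mult_le_one hα.le _) id
      Function.injective_id)
  exact ⟨T, h1, fun p => by rw [← coe_hartBasis, hT, coe_hartBasis]⟩

/-- The operator `(1 - αΔ)⁻¹` on `L²`. -/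
def res : L2Field →L[ℝ] L2Field := (exists_res hα).choose

theorem res_hart (p : (Fin 3 → ℤ) × Fin 3) : res hα (hartL2 p) = mult α p.1 • hartL2 p :=
  (exists_res hα).choose_spec.2 p

theorem norm_res_le (x : L2Field) : ‖res hα x‖ ≤ ‖x‖ := by
  have := (res hα).le_of_opNorm_le (exists_res hα).choose_spec.1 x
  simpa using this

include hα in
theorem exists_resPartial (i : Fin 3) : ∃ T : L2Field →L[ℝ] L2Field,
    ∀ p, T (hartL2 p) = (mult α p.1 * p.1 i) • hartL2 (-p.1, p.2) := by
  obtain ⟨T, -, hT⟩ := exists_clm_of_hilbertBasis hartBasis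
    (fun p => (mult α p.1 * p.1 i) • hartL2 (-p.1, p.2)) α⁻¹ (by positivity)
    (norm_sum_hartL2_le (by positivity) (m := fun p => mult α p.1 * p.1 i)
      (fun p => abs_mult_mul_le hα p.1 i) (fun p => (-p.1, p.2)) (by
        rintro ⟨a, b⟩ ⟨c, d⟩ h
        simpa using h))
  exact ⟨T, fun p => by rw [← coe_hartBasis, hT]⟩

/-- The operator `∂ᵢ(1 - αΔ)⁻¹` on `L²`. -/
def resPartial (i : Fin 3) : L2Field →L[ℝ] L2Field := (exists_resPartial hα i).choose

theorem resPartial_hart (i : Fin 3) (p : (Fin 3 → ℤ) × Fin 3) :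
    resPartial hα i (hartL2 p) = (mult α p.1 * p.1 i) • hartL2 (-p.1, p.2) :=
  (exists_resPartial hα i).choose_spec p

theorem inner_hartL2_hartL2 (p q : (Fin 3 → ℤ) × Fin 3) :
    inner ℝ (hartL2 p) (hartL2 q) = if p = q then (1 : ℝ) else 0 :=
  orthonormal_iff_ite.1 orthonormal_hartL2 p q

/-- Bounded bilinear forms which agree on the Hartley basis are equal. -/
theorem clm_ext_hart₂ {F : Type*} [NormedAddCommGroup F] [NormedSpace ℝ F]
    {S T : L2Field →L[ℝ] L2Field →L[ℝ] F}
    (h : ∀ p q, S (hartL2 p) (hartL2 q) = T (hartL2 p) (hartL2 q)) : S = T :=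
  clm_ext_hart fun p => clm_ext_hart fun q => h p q

theorem inner_res_left (x y : L2Field) : inner ℝ (res hα x) y = inner ℝ x (res hα y) := by
  have : (innerSL ℝ).comp (res hα) = ((innerSL ℝ : L2Field →L[ℝ] L2Field →L[ℝ] ℝ).flip.comp
      (res hα)).flip := by
    refine clm_ext_hart₂ fun p q => ?_
    simp only [ContinuousLinearMap.comp_apply, ContinuousLinearMap.flip_apply, innerSL_apply_apply,
      res_hart, real_inner_smul_left, real_inner_smul_right, inner_hartL2_hartL2]
    split_ifs with h
    · rw [h]
    · simp
  exact congrArg (fun T => T x y) this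

/-- On the basis this reads `mult² (1 + α|k|²) = mult`. It expresses the `𝓗_α` product of two
regularized fields as an `L²` product. -/
theorem inner_res_add (x y : L2Field) :
    inner ℝ (res hα x) (res hα y) + α * ∑ i, inner ℝ (resPartial hα i x) (resPartial hα i y)
      = inner ℝ x (res hα y) := by
  let I : L2Field →L[ℝ] L2Field →L[ℝ] ℝ := innerSL ℝ
  have hI : ∀ a b, I a b = inner ℝ a b := fun _ _ => rfl
  have : I.bilinearComp (res hα) (res hα) +
      α • ∑ i, I.bilinearComp (resPartial hα i) (resPartial hα i)
      = I.bilinearComp (ContinuousLinearMap.id ℝ _) (res hα) := by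
    refine clm_ext_hart₂ fun p q => ?_
    simp only [add_apply, smul_apply, _root_.sum_apply, smul_eq_mul, hI,
      ContinuousLinearMap.bilinearComp_apply, ContinuousLinearMap.id_apply,
      res_hart, resPartial_hart, real_inner_smul_left, real_inner_smul_right, inner_hartL2_hartL2]
    by_cases h : p = q
    · subst h
      simp only [if_true, mul_one]
      have := mult_mul_denom hα.le p.1
      have e : ∑ i, mult α p.1 * (p.1 i : ℝ) * (mult α p.1 * (p.1 i : ℝ)) =
          mult α p.1 ^ 2 * ∑ i, (p.1 i : ℝ) ^ 2 := by
        rw [Finset.mul_sum]; congr 1; ext i; ring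
      rw [e]
      linear_combination (mult α p.1) * this
    · have h' : ¬ ((-p.1, p.2) = (-q.1, q.2)) := by
        simpa [Prod.ext_iff] using h
      simp [h, h']
  have h2 := congrArg (fun T => T x y) this
  simpa [hI] using h2

theorem energy_res (x : L2Field) :
    ‖res hα x‖ ^ 2 + α * ∑ i, ‖resPartial hα i x‖ ^ 2 = inner ℝ x (res hα x) := by
  have := inner_res_add hα x x
  simpa only [real_inner_self_eq_norm_sq] using this

end Resolvent

end DampedEuler
end

/-! ### Weak derivatives of the resolvent, the bilinear term and the transport operator -/

noncomputable section

namespace DampedEuler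

/-- Integration by parts on the torus. -/
theorem integral_mul_partial {f g : E → ℝ} (hf : ContDiff ℝ 1 f) (hg : ContDiff ℝ 1 g)
    (hfp : Periodic f) (hgp : Periodic g) (i : Fin 3) :
    ∫ x in cell, f x * fderiv ℝ g x (unitVec i) =
      -∫ x in cell, fderiv ℝ f x (unitVec i) * g x := by
  have h := integral_partial_eq_zero (hf.mul hg) (fun x i => by
    simp only [hfp x i, hgp x i]) i
  have e : ∀ x, fderiv ℝ (fun y => f y * g y) x (unitVec i) =
      f x * fderiv ℝ g x (unitVec i) + fderiv ℝ f x (unitVec i) * g x := by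
    intro x
    rw [fderiv_fun_mul (hf.differentiable (by simp) x) (hg.differentiable (by simp) x)]
    simp [mul_comm]
  simp only [e] at h
  have c1 : Continuous fun x => f x * fderiv ℝ g x (unitVec i) :=
    hf.continuous.mul ((hg.continuous_fderiv (by simp)).clm_apply continuous_const)
  have c2 : Continuous fun x => fderiv ℝ f x (unitVec i) * g x :=
    ((hf.continuous_fderiv (by simp)).clm_apply continuous_const).mul hg.continuous
  rw [integral_add (integrableOn_cell_of_continuous c1) (integrableOn_cell_of_continuous c2)] at h
  linarith

theorem fderiv_component {ψ : E → E} (hψ : ContDiff ℝ ∞ ψ) (x v : E) (j : Fin 3) :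
    fderiv ℝ (fun y => ψ y j) x v = (fderiv ℝ ψ x v) j := by
  have h : HasFDerivAt (fun y => ψ y j)
      ((EuclideanSpace.proj j : E →L[ℝ] ℝ).comp (fderiv ℝ ψ x)) x :=
    (EuclideanSpace.proj j : E →L[ℝ] ℝ).hasFDerivAt.comp x
      (hψ.differentiable (by simp) x).hasFDerivAt
  rw [h.fderiv]
  rfl

theorem contDiff_component {ψ : E → E} (hψ : ContDiff ℝ ∞ ψ) (j : Fin 3) :
    ContDiff ℝ ∞ fun y => ψ y j :=
  (EuclideanSpace.proj j : E →L[ℝ] ℝ).contDiff.comp hψ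

theorem fderiv_hart (k : Fin 3 → ℤ) (x v : E) :
    fderiv ℝ (hart k) x v = hart (-k) x * phase k v := by
  rw [(hasFDerivAt_hart k x).fderiv]; simp

theorem hartL2_inner_partial (p : (Fin 3 → ℤ) × Fin 3) {ψ : E → E} (hψ : ContDiff ℝ ∞ ψ)
    (hp : Periodic ψ) (i : Fin 3) :
    inner ℝ (hartL2 p) (toL2 (fun x => fderiv ℝ ψ x (unitVec i)) (continuous_partial hψ i)) =
      -(p.1 i : ℝ) * inner ℝ (hartL2 (-p.1, p.2)) (toL2 ψ hψ.continuous) := by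
  rw [real_inner_comm, real_inner_comm (toL2 ψ _), hartL2, hartL2, toL2_inner_toL2, toL2_inner_toL2]
  simp only [inner_hartVec]
  have h := integral_mul_partial ((contDiff_hart p.1).of_le (by simp))
    ((contDiff_component hψ p.2).of_le (by simp)) (periodic_hart p.1)
    (fun x i => by simp only [hp x i]) i
  simp only [fderiv_component hψ, fderiv_hart, phase_unitVec] at h
  rw [h, ← integral_neg, ← integral_const_mul]
  congr 1; ext x; ring

section Resolvent

variable {α : ℝ} (hα : 0 < α)

theorem hasWeakPartial_res (i : Fin 3) (x : L2Field) :
    HasWeakPartial i (res hα x) (resPartial hα i x) := by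
  intro ψ hψ hp
  let I : L2Field →L[ℝ] L2Field →L[ℝ] ℝ := innerSL ℝ
  have hI : ∀ a b, I a b = inner ℝ a b := fun _ _ => rfl
  have : (I.flip (toL2 _ (continuous_partial hψ i))).comp (res hα) =
      -(I.flip (toL2 ψ hψ.continuous)).comp (resPartial hα i) := by
    refine clm_ext_hart fun p => ?_
    simp only [ContinuousLinearMap.comp_apply, ContinuousLinearMap.flip_apply, hI, res_hart,
      resPartial_hart, real_inner_smul_left, neg_apply, hartL2_inner_partial p hψ hp]
    ring
  exact congrArg (fun T => T x) this

/-- The weak form of `(1 - αΔ)R = 1`. It turns the `𝓗_α` pairings of the Bardina–Euler equation into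
`L²` pairings, and it identifies `(x - Rx, ψ)` as a term carrying a factor `α`. -/
theorem inner_eq_res_add (x : L2Field) {ψ : E → E} (hψ : ContDiff ℝ ∞ ψ) (hp : Periodic ψ) :
    inner ℝ x (toL2 ψ hψ.continuous) = inner ℝ (res hα x) (toL2 ψ hψ.continuous) +
      α * ∑ i, inner ℝ (resPartial hα i x)
        (toL2 (fun x => fderiv ℝ ψ x (unitVec i)) (continuous_partial hψ i)) := by
  let I : L2Field →L[ℝ] L2Field →L[ℝ] ℝ := innerSL ℝ
  have hI : ∀ a b, I a b = inner ℝ a b := fun _ _ => rfl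
  have : I.flip (toL2 ψ hψ.continuous) = (I.flip (toL2 ψ hψ.continuous)).comp (res hα) +
      α • ∑ i, (I.flip (toL2 _ (continuous_partial hψ i))).comp (resPartial hα i) := by
    refine clm_ext_hart fun p => ?_
    simp only [ContinuousLinearMap.comp_apply, ContinuousLinearMap.flip_apply, hI, res_hart,
      resPartial_hart, real_inner_smul_left, hartL2_inner_partial _ hψ hp, add_apply, smul_apply,
      _root_.sum_apply, smul_eq_mul, neg_neg, Pi.neg_apply, Int.cast_neg, Prod.mk.eta]
    have e : ∑ i, mult α p.1 * (p.1 i : ℝ) * ((p.1 i : ℝ) *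
        inner ℝ (hartL2 p) (toL2 ψ hψ.continuous)) =
          (∑ i, (p.1 i : ℝ) ^ 2) * (mult α p.1 * inner ℝ (hartL2 p) (toL2 ψ hψ.continuous)) := by
      rw [Finset.sum_mul]; congr 1; ext i; ring
    rw [e]
    linear_combination (-inner ℝ (hartL2 p) (toL2 ψ hψ.continuous)) * mult_mul_denom hα.le p.1
  have h2 := congrArg (fun T => T x) this
  simpa [hI] using h2

theorem coeFn_resLinf (x : L2Field) :
    resLinf hα x =ᵐ[(volume : Measure E).restrict cell] res hα x := by
  let one : Lp ℝ 2 ((volume : Measure E).restrict cell) := (memLp_const (1 : ℝ)).toLp _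
  have hone : one =ᵐ[(volume : Measure E).restrict cell] fun _ => (1 : ℝ) := MemLp.coeFn_toLp _
  let B : E →L[ℝ] ℝ →L[ℝ] E := (ContinuousLinearMap.lsmul ℝ ℝ).flip
  -- The embedding of `L^∞` in `L²`, realized as the Hölder product with the constant function `1`.
  let J : Lp E ⊤ ((volume : Measure E).restrict cell) →L[ℝ] L2Field :=
    (B.holderL ((volume : Measure E).restrict cell) ⊤ 2 2).flip one
  have hJ : ∀ f, J f =ᵐ[(volume : Measure E).restrict cell] f := by
    intro f
    have : J f = B.holder 2 f one := rfl
    rw [this]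
    filter_upwards [B.coeFn_holder (r := 2) f one, hone] with y h1 h2
    rw [h1, h2]; simp [B]
  have hJR : J.comp (resLinf hα) = res hα := by
    refine clm_ext_hart fun p => ?_
    rw [ContinuousLinearMap.comp_apply, resLinf_hart, res_hart, map_smul]
    congr 1
    apply Lp.ext
    exact (hJ _).trans ((coeFn_hartLinf p).trans (coeFn_toL2 _).symm)
  rw [← hJR]
  exact (hJ _).symm

/-- Multiplication of a square integrable vector field by the `i`-th component of a bounded one. -/
def componentMul (i : Fin 3) : E →L[ℝ] E →L[ℝ] E :=
  (ContinuousLinearMap.lsmul ℝ ℝ : ℝ →L[ℝ] E →L[ℝ] E).comp (EuclideanSpace.proj i : E →L[ℝ] ℝ)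

/-- The bilinear term `(R x, ∇) R y`, where `R = (1 - αΔ)⁻¹`. -/
def bil : L2Field →L[ℝ] L2Field →L[ℝ] L2Field :=
  ∑ i, ((componentMul i).holderL ((volume : Measure E).restrict cell) ⊤ 2 2).bilinearComp
    (resLinf hα) (resPartial hα i)

theorem coeFn_bil (x y : L2Field) : bil hα x y =ᵐ[(volume : Measure E).restrict cell]
    fun z => ∑ i, (res hα x z) i • resPartial hα i y z := by
  have e : bil hα x y = ∑ i, (componentMul i).holder 2 (resLinf hα x) (resPartial hα i y) := by
    simp [bil]
  rw [e]
  have h := fun i => (componentMul i).coeFn_holder (r := 2) (resLinf hα x) (resPartial hα i y)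
  have hs := Lp.coeFn_finsetSum (p := 2) Finset.univ
    fun i => (componentMul i).holder 2 (resLinf hα x) (resPartial hα i y)
  filter_upwards [hs, coeFn_resLinf hα x, eventually_all.2 h] with z h1 h2 h3
  rw [h1, Finset.sum_apply]
  refine Finset.sum_congr rfl fun i _ => ?_
  rw [h3, h2]; rfl

/-- The gradient factor is kept apart instead of being estimated by `‖y‖`: the energy controls it,
so along a solution the quadratic term grows only linearly in `‖x‖`. -/
theorem exists_norm_bil_le : ∃ C : ℝ, 0 ≤ C ∧ ∀ x y,
    ‖bil hα x y‖ ≤ C * ‖x‖ * ∑ i, ‖resPartial hα i y‖ := by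
  refine ⟨∑ i, ‖(componentMul i)‖ * ‖resLinf hα‖, by positivity, fun x y => ?_⟩
  have e : bil hα x y = ∑ i, (componentMul i).holder 2 (resLinf hα x) (resPartial hα i y) := by
    simp [bil]
  rw [e, Finset.sum_mul, Finset.sum_mul]
  refine norm_sum_le_of_le _ fun i _ => ?_
  refine ((componentMul i).norm_holder_apply_apply_le _ _).trans ?_
  have h1 : ‖resLinf hα x‖ ≤ ‖resLinf hα‖ * ‖x‖ := (resLinf hα).le_opNorm x
  have h2 : ‖resPartial hα i y‖ ≤ ∑ i, ‖resPartial hα i y‖ :=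
    Finset.single_le_sum (f := fun i => ‖resPartial hα i y‖) (fun _ _ => norm_nonneg _)
      (Finset.mem_univ i)
  calc _ ≤ ‖componentMul i‖ * (‖resLinf hα‖ * ‖x‖) * ∑ i, ‖resPartial hα i y‖ := by gcongr
    _ = _ := by ring

end Resolvent

theorem exists_bound_cell {F : Type*} [NormedAddCommGroup F] {A : E → F} (hA : Continuous A) :
    ∃ C, 0 ≤ C ∧ ∀ x ∈ cell, ‖A x‖ ≤ C := by
  obtain ⟨C, hC⟩ := isCompact_bigBall.exists_bound_of_continuousOn hA.continuousOn
  exact ⟨max C 0, le_max_right _ _, fun x hx => (hC x (cell_subset hx)).trans (le_max_left _ _)⟩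

theorem memLp_top_of_continuous {F : Type*} [NormedAddCommGroup F] [SecondCountableTopology F]
    {A : E → F} (hA : Continuous A) : MemLp A ⊤ ((volume : Measure E).restrict cell) := by
  obtain ⟨C, -, hC⟩ := exists_bound_cell hA
  exact memLp_top_of_bound hA.aestronglyMeasurable C
    ((ae_restrict_iff' measurableSet_cell).2 (Eventually.of_forall hC))

/-- Multiplication by a continuous matrix valued function. -/
def mulOp (A : E → E →L[ℝ] E) (hA : Continuous A) : L2Field →L[ℝ] L2Field :=
  ((ContinuousLinearMap.id ℝ (E →L[ℝ] E)).holderL ((volume : Measure E).restrict cell) ⊤ 2 2)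
    ((memLp_top_of_continuous hA).toLp A)

theorem coeFn_mulOp {A : E → E →L[ℝ] E} (hA : Continuous A) (v : L2Field) :
    mulOp A hA v =ᵐ[(volume : Measure E).restrict cell] fun x => A x (v x) := by
  have e : mulOp A hA v = (ContinuousLinearMap.id ℝ (E →L[ℝ] E)).holder 2
    ((memLp_top_of_continuous hA).toLp A) v := rfl
  rw [e]
  filter_upwards [(ContinuousLinearMap.id ℝ (E →L[ℝ] E)).coeFn_holder (r := 2)
    ((memLp_top_of_continuous hA).toLp A) v, (memLp_top_of_continuous hA).coeFn_toLp] with x h1 h2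
  rw [h1, h2]; rfl

theorem norm_mulOp_le {A : E → E →L[ℝ] E} (hA : Continuous A) {C : ℝ}
    (hC : ∀ x ∈ cell, ‖A x‖ ≤ C) (v : L2Field) : ‖mulOp A hA v‖ ≤ C * ‖v‖ := by
  apply Lp.norm_le_mul_norm_of_ae_le_mul
  filter_upwards [coeFn_mulOp hA v, ae_restrict_mem measurableSet_cell] with x hx hm
  rw [hx]
  exact (A x).le_of_opNorm_le (hC x hm) _

theorem mulOp_inner {A : E → E →L[ℝ] E} (hA : Continuous A) (v w : L2Field) :
    inner ℝ (mulOp A hA v) w = ∫ x in cell, inner ℝ (A x (v x)) (w x) := by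
  rw [L2.inner_def]
  refine integral_congr_ae ?_
  filter_upwards [coeFn_mulOp hA v] with x hx
  rw [hx]

theorem mulOp_toL2 {A : E → E →L[ℝ] E} (hA : Continuous A) {f : E → E} (hf : Continuous f) :
    mulOp A hA (toL2 f hf) = toL2 (fun x => A x (f x)) (hA.clm_apply hf) := by
  apply Lp.ext
  filter_upwards [coeFn_mulOp hA (toL2 f hf), coeFn_toL2 hf, coeFn_toL2 (hA.clm_apply hf)]
    with x h1 h2 h3
  rw [h1, h2, h3]

theorem continuous_fderiv_of_smooth {ψ : E → E} (hψ : ContDiff ℝ ∞ ψ) :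
    Continuous (fun x => fderiv ℝ ψ x) := hψ.continuous_fderiv (by simp)

/-- The operator `v ↦ (v, ∇)ψ`. -/
def transport (ψ : E → E) (hψ : ContDiff ℝ ∞ ψ) : L2Field →L[ℝ] L2Field :=
  mulOp (fun x => fderiv ℝ ψ x) (continuous_fderiv_of_smooth hψ)

theorem inner_gradient {f : E → ℝ} (x v : E) : inner ℝ v (gradient f x) = fderiv ℝ f x v := by
  rw [real_inner_comm, gradient, InnerProductSpace.toDual_symm_apply]

/-- The transport term is skew symmetric for divergence free advecting fields. -/
theorem transport_skew {v : L2Field} (hv : v ∈ H0) {a c : E → E} (ha : ContDiff ℝ ∞ a)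
    (hc : ContDiff ℝ ∞ c) (hap : Periodic a) (hcp : Periodic c) :
    inner ℝ (transport a ha v) (toL2 c hc.continuous) +
      inner ℝ (transport c hc v) (toL2 a ha.continuous) = 0 := by
  -- The field `v` is orthogonal to the gradient of the smooth periodic function `a · c`, and the
  -- product rule splits this gradient into the two terms.
  have h := hv (fun x => inner ℝ (a x) (c x)) (ha.inner ℝ hc) (fun x i => by simp only [hap x i, hcp x i])
  rw [inner_toL2] at h
  simp only [inner_gradient] at h
  rw [← h, L2.inner_def, L2.inner_def, ← integral_add (L2.integrable_inner _ _)
    (L2.integrable_inner _ _)]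
  refine integral_congr_ae ?_
  filter_upwards [coeFn_mulOp (continuous_fderiv_of_smooth ha) v, coeFn_toL2 ha.continuous,
    coeFn_mulOp (continuous_fderiv_of_smooth hc) v, coeFn_toL2 hc.continuous] with x h1 h2 h3 h4
  rw [transport, transport, h1, h2, h3, h4, fderiv_inner_apply ℝ
    (ha.differentiable (by simp) x) (hc.differentiable (by simp) x),
    real_inner_comm (fderiv ℝ c x (v x))]
  ring

/-- Smooth divergence free fields belong to `𝓗₀`. -/
theorem toL2_mem_H0 {ψ : E → E} (hψ : ContDiff ℝ ∞ ψ) (hp : Periodic ψ)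
    (hd : ∀ x, divergence ψ x = 0) : toL2 ψ hψ.continuous ∈ H0 := by
  intro f hf hfp
  rw [toL2_inner_toL2]
  simp only [inner_gradient]
  have e : ∀ x, fderiv ℝ f x (ψ x) = ∑ i, ψ x i * fderiv ℝ f x (unitVec i) := by
    intro x
    have : ψ x = ∑ i, ψ x i • unitVec i := by
      ext j; simp [Finset.sum_apply, Pi.single_apply]
    conv_lhs => rw [this]
    simp
  simp only [e]
  have hi : ∀ i, Continuous fun x => ψ x i * fderiv ℝ f x (unitVec i) := fun i =>
    (contDiff_component hψ i).continuous.mul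
      ((hf.continuous_fderiv (by simp)).clm_apply continuous_const)
  have hi' : ∀ i, Continuous fun x => fderiv ℝ ψ x (unitVec i) i * f x := fun i =>
    ((EuclideanSpace.proj i : E →L[ℝ] ℝ).continuous.comp (continuous_partial hψ i)).mul
      hf.continuous
  rw [integral_finsetSum _ fun i _ => integrableOn_cell_of_continuous (hi i)]
  have h2 := fun i => integral_mul_partial ((contDiff_component hψ i).of_le (by simp))
    (hf.of_le (by simp)) (fun x k => by simp only [hp x k]) hfp i
  simp only [h2, fderiv_component hψ, Finset.sum_neg_distrib]
  rw [← integral_finsetSum _ fun i _ => integrableOn_cell_of_continuous (hi' i)]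
  simp only [← Finset.sum_mul]
  have : ∀ x, ∑ i, fderiv ℝ ψ x (unitVec i) i = 0 := hd
  simp [this]

end DampedEuler
end

/-! ### The Leray projector on the basis and the skew symmetry of the bilinear term -/

noncomputable section

namespace DampedEuler

/-- The projection of the `j`-th unit vector onto the plane orthogonal to the frequency `k`, for
`p = (k, j)`. -/
def helmDir (p : (Fin 3 → ℤ) × Fin 3) : E :=
  unitVec p.2 - ((p.1 p.2 : ℝ) / ∑ i, (p.1 i : ℝ) ^ 2) • WithLp.toLp 2 fun i => (p.1 i : ℝ)

/-- For `k = 0` the quotient in `helmDir` is `0 / 0 = 0`, and the claim holds because the phase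
itself vanishes. -/
theorem phase_helmDir (p : (Fin 3 → ℤ) × Fin 3) : phase p.1 (helmDir p) = 0 := by
  rw [helmDir, map_sub, map_smul, phase_unitVec, phase_apply, smul_eq_mul]
  have e : ∑ i, (p.1 i : ℝ) * (WithLp.toLp 2 (fun i => (p.1 i : ℝ)) : E) i
      = ∑ i, (p.1 i : ℝ) ^ 2 := Finset.sum_congr rfl fun i _ => (sq _).symm
  rw [e]
  by_cases h : ∑ i, (p.1 i : ℝ) ^ 2 = 0
  · have := (Finset.sum_eq_zero_iff_of_nonneg (fun i _ => sq_nonneg _)).1 h p.2 (Finset.mem_univ _)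
    rw [h, mul_zero, sub_zero]
    exact pow_eq_zero_iff (two_ne_zero) |>.1 this
  · rw [div_mul_cancel₀ _ h, sub_self]

/-- The divergence free part of `hartVec p`. -/
def helm (p : (Fin 3 → ℤ) × Fin 3) (x : E) : E := hart p.1 x • helmDir p

theorem contDiff_helm (p : (Fin 3 → ℤ) × Fin 3) : ContDiff ℝ ∞ (helm p) :=
  (contDiff_hart p.1).smul contDiff_const

theorem periodic_helm (p : (Fin 3 → ℤ) × Fin 3) : Periodic (helm p) := fun x i => by
  rw [helm, periodic_hart, helm]

theorem fderiv_hart_smul (k : Fin 3 → ℤ) (a x v : E) :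
    fderiv ℝ (fun y => hart k y • a) x v = (hart (-k) x * phase k v) • a := by
  rw [((hasFDerivAt_hart k x).smul_const a).fderiv]
  simp

theorem divergence_helm (p : (Fin 3 → ℤ) × Fin 3) (x : E) : divergence (helm p) x = 0 := by
  have e : ∀ i, (fderiv ℝ (helm p) x (unitVec i)) i = hart (-p.1) x * (p.1 i * helmDir p i) := by
    intro i
    have := fderiv_hart_smul p.1 (helmDir p) x (unitVec i)
    change fderiv ℝ (helm p) x (unitVec i) = _ at this
    rw [this, phase_unitVec]
    simp [mul_assoc]
  simp only [divergence, e]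
  rw [← Finset.mul_sum, ← phase_apply, phase_helmDir, mul_zero]

theorem helm_mem_H0 (p : (Fin 3 → ℤ) × Fin 3) :
    toL2 (helm p) (contDiff_helm p).continuous ∈ H0 :=
  toL2_mem_H0 (contDiff_helm p) (periodic_helm p) (divergence_helm p)

/-- With `k = p.1` and `c` the quotient in `helmDir`, the discarded part `c • k * hart k` is the
gradient of `-c * hart (-k)`, hence orthogonal to every divergence free field. -/
theorem leray_hartL2 (p : (Fin 3 → ℤ) × Fin 3) :
    leray (hartL2 p) = toL2 (helm p) (contDiff_helm p).continuous := by
  refine Submodule.eq_starProjection_of_mem_of_inner_eq_zero (helm_mem_H0 p) fun w hw => ?_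
  set c : ℝ := (p.1 p.2 : ℝ) / ∑ i, (p.1 i : ℝ) ^ 2
  have hf : ContDiff ℝ ∞ fun x => -c * hart (-p.1) x := contDiff_const.mul (contDiff_hart _)
  have h := hw _ hf (fun x i => by simp only [periodic_hart (-p.1) x i])
  rw [real_inner_comm, ← h]
  congr 1
  rw [hartL2, ← toL2_sub]
  congr 1
  ext1 x
  refine ext_inner_left ℝ fun v => ?_
  rw [inner_gradient, fderiv_const_mul ((contDiff_hart _).differentiable (by simp) x)]
  simp only [smul_apply, fderiv_hart, neg_neg, hartVec, helm, ← smul_sub, inner_smul_right,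
    helmDir, sub_sub_cancel, phase_neg, smul_eq_mul]
  have : inner ℝ v (WithLp.toLp 2 fun i => (p.1 i : ℝ) : E) = phase p.1 v := by
    rw [phase_apply, PiLp.inner_apply]
    simp
  rw [this]
  ring

theorem leray_eq_self {v : L2Field} (hv : v ∈ H0) : leray v = v :=
  Submodule.starProjection_eq_self_iff.2 hv

theorem leray_mem_H0 (v : L2Field) : leray v ∈ H0 := Submodule.starProjection_apply_mem _ _

theorem inner_leray_left (v w : L2Field) : inner ℝ (leray v) w = inner ℝ v (leray w) :=
  H0.inner_starProjection_left_eq_right v w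

theorem inner_leray_of_mem (v : L2Field) {w : L2Field} (hw : w ∈ H0) :
    inner ℝ (leray v) w = inner ℝ v w := by
  rw [inner_leray_left, leray_eq_self hw]

/-- The Fourier coefficients of a divergence free field are its products with smooth divergence
free fields. -/
theorem inner_hartL2_of_mem {v : L2Field} (hv : v ∈ H0) (p : (Fin 3 → ℤ) × Fin 3) :
    inner ℝ v (hartL2 p) = inner ℝ v (toL2 (helm p) (contDiff_helm p).continuous) := by
  rw [← leray_hartL2, ← inner_leray_left, leray_eq_self hv]

section Resolvent

variable {α : ℝ} (hα : 0 < α)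

/-- The Leray projector mixes only directions within one frequency, where the resolvent acts as a
scalar. -/
theorem res_leray (v : L2Field) : res hα (leray v) = leray (res hα v) := by
  have : (res hα).comp leray = leray.comp (res hα) := by
    refine clm_ext_hart fun p => ?_
    simp only [ContinuousLinearMap.comp_apply, res_hart, map_smul, leray_hartL2]
    have e : toL2 (helm p) (contDiff_helm p).continuous
        = ∑ j, helmDir p j • hartL2 (p.1, j) := by
      apply Lp.ext
      have hs := Lp.coeFn_finsetSum (p := 2) Finset.univ fun j => helmDir p j • hartL2 (p.1, j)
      have h1 := fun j => Lp.coeFn_smul (helmDir p j) (hartL2 (p.1, j))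
      have h2 := fun j : Fin 3 => coeFn_toL2 (contDiff_hartVec (p.1, j)).continuous
      filter_upwards [hs, eventually_all.2 h1, eventually_all.2 h2,
        coeFn_toL2 (contDiff_helm p).continuous] with x h3 h4 h5 h6
      rw [h3, h6, Finset.sum_apply]
      have : ∀ j, (helmDir p j • hartL2 (p.1, j) : L2Field) x =
          helmDir p j • (hart p.1 x • unitVec j) := by
        intro j
        rw [h4, Pi.smul_apply, hartL2, h5]; rfl
      simp only [this]
      ext i
      simp [helm, Finset.sum_apply, Pi.single_apply, mul_comm]
    rw [e, map_sum, Finset.smul_sum]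
    refine Finset.sum_congr rfl fun j _ => ?_
    rw [map_smul, res_hart, smul_comm]
  exact congrArg (fun T => T v) this

theorem res_mem_H0 {v : L2Field} (hv : v ∈ H0) : res hα v ∈ H0 := by
  rw [← leray_eq_self hv, res_leray]
  exact leray_mem_H0 _

theorem bil_hart (x : L2Field) (q : (Fin 3 → ℤ) × Fin 3) :
    bil hα x (hartL2 q) = mult α q.1 • transport (hartVec q) (contDiff_hartVec q) (res hα x) := by
  apply Lp.ext
  have h1 := fun i => Lp.coeFn_smul (mult α q.1 * q.1 i) (hartL2 (-q.1, q.2))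
  filter_upwards [coeFn_bil hα x (hartL2 q), eventually_all.2 h1,
    coeFn_toL2 (contDiff_hartVec (-q.1, q.2)).continuous,
    Lp.coeFn_smul (mult α q.1) (transport (hartVec q) (contDiff_hartVec q) (res hα x)),
    coeFn_mulOp (continuous_fderiv_of_smooth (contDiff_hartVec q)) (res hα x)]
    with z h2 h3 h4 h5 h6
  rw [h2, h5, Pi.smul_apply, transport, h6]
  have h7 := fderiv_hart_smul q.1 (unitVec q.2) z (res hα x z)
  change fderiv ℝ (hartVec q) z _ = _ at h7
  rw [h7, phase_apply]
  simp only [resPartial_hart, h3, Pi.smul_apply]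
  rw [hartL2, h4]
  simp only [hartVec, smul_smul, ← Finset.sum_smul]
  congr 1
  rw [Finset.mul_sum, Finset.mul_sum]
  refine Finset.sum_congr rfl fun i _ => ?_
  ring

/-- Integration by parts with an advecting field that is only weakly divergence free. For `y` a
basis element it is `transport_skew`; the general case follows by continuity. All derivatives now
fall on the smooth field `ψ`. -/
theorem inner_bil_toL2 {x : L2Field} (hx : x ∈ H0) (y : L2Field) {ψ : E → E}
    (hψ : ContDiff ℝ ∞ ψ) (hp : Periodic ψ) :
    inner ℝ (bil hα x y) (toL2 ψ hψ.continuous) =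
      -inner ℝ (transport ψ hψ (res hα x)) (res hα y) := by
  let I : L2Field →L[ℝ] L2Field →L[ℝ] ℝ := innerSL ℝ
  have hI : ∀ a b, I a b = inner ℝ a b := fun _ _ => rfl
  have : (I.flip (toL2 ψ hψ.continuous)).comp (bil hα x) =
      -(I (transport ψ hψ (res hα x))).comp (res hα) := by
    refine clm_ext_hart fun p => ?_
    simp only [ContinuousLinearMap.comp_apply, ContinuousLinearMap.flip_apply, hI, res_hart,
      bil_hart, real_inner_smul_left, neg_apply, real_inner_smul_right]
    have := transport_skew (res_mem_H0 hα hx) (contDiff_hartVec p) hψ (periodic_hartVec p) hp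
    rw [hartL2]
    linear_combination (mult α p.1) * this
  exact congrArg (fun T => T y) this

/-- Taking `z` in the basis reduces this to `inner_bil_toL2`. Its diagonal case is the cancellation
behind the energy estimate. -/
theorem inner_bil_res_skew {x : L2Field} (hx : x ∈ H0) (y z : L2Field) :
    inner ℝ (bil hα x y) (res hα z) = -inner ℝ (bil hα x z) (res hα y) := by
  let I : L2Field →L[ℝ] L2Field →L[ℝ] ℝ := innerSL ℝ
  have hI : ∀ a b, I a b = inner ℝ a b := fun _ _ => rfl
  have : (I (bil hα x y)).comp (res hα) = -(I.flip (res hα y)).comp (bil hα x) := by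
    refine clm_ext_hart fun p => ?_
    simp only [ContinuousLinearMap.comp_apply, ContinuousLinearMap.flip_apply, hI, res_hart,
      bil_hart, real_inner_smul_left, neg_apply, real_inner_smul_right]
    have := inner_bil_toL2 hα hx y (contDiff_hartVec p) (periodic_hartVec p)
    rw [hartL2, this]
    ring
  exact congrArg (fun T => T z) this

theorem inner_bil_res_self {x : L2Field} (hx : x ∈ H0) (y : L2Field) :
    inner ℝ (bil hα x y) (res hα y) = 0 := by
  have := inner_bil_res_skew hα hx y y
  linarith

/-- The element of `𝓗_α` given by `(1 - αΔ)⁻¹ w`. -/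
def resH1 : H0 →L[ℝ] H1 :=
  (((res hα).prod (ContinuousLinearMap.pi fun i => resPartial hα i)).comp H0.subtypeL).codRestrict
    H1 fun w => ⟨res_mem_H0 hα w.2, fun i => hasWeakPartial_res hα i w⟩

theorem field_resH1 (w : H0) : field (resH1 hα w) = res hα w := rfl

theorem pd_resH1 (i : Fin 3) (w : H0) : pd i (resH1 hα w) = resPartial hα i w := rfl

theorem normSqH_resH1 (w : H0) : normSqH α (resH1 hα w) = inner ℝ (w : L2Field) (res hα w) :=
  energy_res hα w

theorem integral_convect (w : L2Field) {ψ : E → E} (hψ : Continuous ψ) :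
    ∫ x in cell, ∑ i, res hα w x i * inner ℝ (resPartial hα i w x) (ψ x) =
      inner ℝ (bil hα w w) (toL2 ψ hψ) := by
  rw [inner_toL2]
  refine integral_congr_ae ?_
  filter_upwards [coeFn_bil hα w w] with x hx
  rw [hx, sum_inner]
  simp only [real_inner_smul_left]

end Resolvent

end DampedEuler
end

/-! ### Global solvability of locally Lipschitz ODEs under an a priori bound -/

noncomputable section

namespace DampedEuler

section GlobalODE

variable {H : Type*} [NormedAddCommGroup H]

/-- The factor of the radial retraction onto the ball of radius `K`. -/
def truncFactor (K : ℝ) (x : H) : ℝ := K / max K ‖x‖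

theorem truncFactor_mem {K : ℝ} (hK : 0 < K) (x : H) : truncFactor K x ∈ Icc (0 : ℝ) 1 :=
  ⟨by unfold truncFactor; positivity,
    div_le_one_of_le₀ (le_max_left _ _) (hK.le.trans (le_max_left _ _))⟩

theorem truncFactor_eq_one {K : ℝ} (hK : 0 < K) {x : H} (hx : ‖x‖ ≤ K) : truncFactor K x = 1 := by
  rw [truncFactor, max_eq_left hx, div_self hK.ne']

variable [NormedSpace ℝ H]

theorem norm_trunc_le {K : ℝ} (hK : 0 < K) (x : H) : ‖truncFactor K x • x‖ ≤ K := by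
  have hm : 0 < max K ‖x‖ := lt_of_lt_of_le hK (le_max_left _ _)
  rw [norm_smul, Real.norm_of_nonneg (truncFactor_mem hK x).1, truncFactor, div_mul_eq_mul_div,
    div_le_iff₀ hm]
  gcongr
  exact le_max_right _ _

theorem lipschitzWith_trunc {K : ℝ} (hK : 0 < K) :
    LipschitzWith 2 fun x : H => truncFactor K x • x := by
  refine LipschitzWith.of_dist_le_mul fun x y => ?_
  rw [dist_eq_norm, dist_eq_norm]
  set a := max K ‖x‖ with ha
  set b := max K ‖y‖ with hb
  have ha0 : 0 < a := lt_of_lt_of_le hK (le_max_left _ _)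
  have hb0 : 0 < b := lt_of_lt_of_le hK (le_max_left _ _)
  have hKa : K ≤ a := le_max_left _ _
  have hyb : ‖y‖ ≤ b := le_max_right _ _
  have hab : |b - a| ≤ ‖x - y‖ := by
    rw [abs_sub_comm]
    refine (abs_max_sub_max_le_max K ‖x‖ K ‖y‖).trans (max_le ?_ (abs_norm_sub_norm_le x y))
    simp
  have e : truncFactor K x • x - truncFactor K y • y =
      (K / a) • (x - y) + (K / a * ((b - a) / b)) • y := by
    have : K / a * ((b - a) / b) = K / a - K / b := by field_simp
    rw [this, truncFactor, truncFactor, sub_smul, smul_sub]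
    abel
  have h1 : K / a ≤ 1 := div_le_one_of_le₀ hKa ha0.le
  rw [e]
  calc _ ≤ ‖(K / a) • (x - y)‖ + ‖(K / a * ((b - a) / b)) • y‖ := norm_add_le _ _
    _ ≤ ‖x - y‖ + ‖x - y‖ := by
        refine add_le_add ?_ ?_
        · rw [norm_smul, Real.norm_of_nonneg (by positivity)]
          exact mul_le_of_le_one_left (norm_nonneg _) h1
        · rw [norm_smul, norm_mul, Real.norm_of_nonneg (by positivity : 0 ≤ K / a), norm_div,
            Real.norm_eq_abs, Real.norm_of_nonneg hb0.le]
          calc K / a * (|b - a| / b) * ‖y‖ ≤ 1 * (|b - a| / b) * b := by gcongr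
            _ = |b - a| := by field_simp
            _ ≤ _ := hab
    _ = _ := by simp; ring

/-- Composing `F` with the radial retraction onto the ball of radius `K` makes it bounded and
globally Lipschitz. The a priori bound is required for every damping factor `θ` so that it also
covers the truncated equation. -/
theorem exists_solution_Icc [CompleteSpace H] {F : H → H} {x₀ : H}
    (hF : ∀ K : ℝ, ∃ L : NNReal, LipschitzOnWith L F (Metric.closedBall 0 K)) {T K : ℝ}
    (hT : 0 ≤ T) (hK : 0 < K)
    (hb : ∀ (w : ℝ → H) (θ : ℝ → ℝ), (∀ t, θ t ∈ Icc (0 : ℝ) 1) → w 0 = x₀ →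
      (∀ t ∈ Icc 0 T, HasDerivWithinAt w (F (θ t • w t)) (Icc 0 T) t) →
      ∀ t ∈ Icc 0 T, ‖w t‖ ≤ K) :
    ∃ w : ℝ → H, w 0 = x₀ ∧ (∀ t ∈ Icc 0 T, HasDerivWithinAt w (F (w t)) (Icc 0 T) t) ∧
      ∀ t ∈ Icc 0 T, ‖w t‖ ≤ K := by
  obtain ⟨L, hL⟩ := hF K
  have hmem : ∀ x : H, truncFactor K x • x ∈ Metric.closedBall (0 : H) K := fun x => by
    rw [mem_closedBall_zero_iff]; exact norm_trunc_le hK x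
  have hlip : LipschitzWith (L * 2) fun x : H => F (truncFactor K x • x) := by
    rw [← lipschitzOnWith_univ]
    exact hL.comp (lipschitzWith_trunc hK).lipschitzOnWith fun x _ => hmem x
  have hbd : ∀ x : H, ‖F (truncFactor K x • x)‖ ≤ ‖F 0‖ + L * K := by
    intro x
    have h1 := hL.dist_le_mul _ (hmem x) 0 (Metric.mem_closedBall_self hK.le)
    rw [dist_eq_norm, dist_zero_right] at h1
    have h2 := norm_trunc_le hK x
    have h3 : ‖F (truncFactor K x • x)‖ ≤ ‖F (truncFactor K x • x) - F 0‖ + ‖F 0‖ := by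
      simpa using norm_add_le (F (truncFactor K x • x) - F 0) (F 0)
    have h4 : (L : ℝ) * ‖truncFactor K x • x‖ ≤ L * K := by gcongr
    linarith
  let M : NNReal := Real.toNNReal (‖F 0‖ + L * K)
  have hM : (M : ℝ) = ‖F 0‖ + L * K := Real.coe_toNNReal _ (by positivity)
  -- A solution with speed at most `M` moves at most `M T`; as the truncated field is globally
  -- Lipschitz, a ball of that radius is allowed and no smallness of `T` is needed.
  have hPL : IsPicardLindelof (fun _ x => F (truncFactor K x • x)) (tmin := 0) (tmax := T)
      ⟨0, le_rfl, hT⟩ x₀ (M * Real.toNNReal T) 0 M (L * 2) :=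
    IsPicardLindelof.of_time_independent (fun x _ => (hbd x).trans_eq hM.symm) hlip.lipschitzOnWith (by
      simp [hT])
  obtain ⟨w, hw0, hw⟩ := hPL.exists_eq_forall_mem_Icc_hasDerivWithinAt₀
  -- Here `θ` is the truncation factor along the solution. The bound places the solution in the ball
  -- where that factor is `1`.
  have hle := hb w (fun t => truncFactor K (w t)) (fun t => truncFactor_mem hK _) hw0 hw
  refine ⟨w, hw0, fun t ht => ?_, hle⟩
  have := hw t ht
  simpa only [truncFactor_eq_one hK (hle t ht), one_smul] using this

/-- Global existence for locally Lipschitz vector fields under an a priori bound which is stable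
under damping the argument. -/
theorem exists_global_solution [CompleteSpace H] {F : H → H} {x₀ : H}
    (hF : ∀ K : ℝ, ∃ L : NNReal, LipschitzOnWith L F (Metric.closedBall 0 K))
    (hb : ∀ T : ℝ, 0 ≤ T → ∃ K : ℝ, ∀ (w : ℝ → H) (θ : ℝ → ℝ), (∀ t, θ t ∈ Icc (0 : ℝ) 1) →
      w 0 = x₀ → (∀ t ∈ Icc 0 T, HasDerivWithinAt w (F (θ t • w t)) (Icc 0 T) t) →
      ∀ t ∈ Icc 0 T, ‖w t‖ ≤ K) :
    ∃ w : ℝ → H, w 0 = x₀ ∧ ∀ t ∈ Ici (0 : ℝ), HasDerivWithinAt w (F (w t)) (Ici 0) t := by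
  have h1 : ∀ n : ℕ, ∃ K : ℝ, ∃ w : ℝ → H, w 0 = x₀ ∧
      (∀ t ∈ Icc 0 ((n : ℝ) + 1), HasDerivWithinAt w (F (w t)) (Icc 0 ((n : ℝ) + 1)) t) ∧
      ∀ t ∈ Icc 0 ((n : ℝ) + 1), ‖w t‖ ≤ K := by
    intro n
    obtain ⟨K, hK⟩ := hb (n + 1) (by positivity)
    exact ⟨_, exists_solution_Icc hF (by positivity) (lt_of_lt_of_le one_pos (le_max_right K 1))
      fun w θ h1 h2 h3 t ht => (hK w θ h1 h2 h3 t ht).trans (le_max_left _ _)⟩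
  choose K w hw0 hw hwK using h1
  have huniq : ∀ n m : ℕ, n ≤ m → ∀ t ∈ Icc 0 ((n : ℝ) + 1), w n t = w m t := by
    intro n m hnm
    have hsub : Icc 0 ((n : ℝ) + 1) ⊆ Icc 0 ((m : ℝ) + 1) :=
      Icc_subset_Icc_right (by gcongr)
    obtain ⟨L, hL⟩ := hF (max (K n) (K m))
    have hder : ∀ k : ℕ, n ≤ k → ∀ t ∈ Ico 0 ((n : ℝ) + 1),
        HasDerivWithinAt (w k) (F (w k t)) (Ici t) t := by
      intro k hk t ht
      have hlt : t < (k : ℝ) + 1 := ht.2.trans_le (by gcongr)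
      refine (hw k t ⟨ht.1, hlt.le⟩).mono_of_mem_nhdsWithin ?_
      exact mem_of_superset (Icc_mem_nhdsGE hlt) (Icc_subset_Icc_left ht.1)
    exact ODE_solution_unique_of_mem_Icc_right (v := fun _ => F)
      (s := fun _ => Metric.closedBall 0 (max (K n) (K m))) (fun _ _ => hL)
      (fun t ht => (hw n t ht).continuousWithinAt) (hder n le_rfl)
      (fun t ht => mem_closedBall_zero_iff.2
        ((hwK n t (Ico_subset_Icc_self ht)).trans (le_max_left _ _)))
      (fun t ht => ((hw m t (hsub ht)).continuousWithinAt).mono hsub) (hder m hnm)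
      (fun t ht => mem_closedBall_zero_iff.2
        ((hwK m t (hsub (Ico_subset_Icc_self ht))).trans (le_max_right _ _)))
      ((hw0 n).trans (hw0 m).symm)
  have hglue : ∀ N : ℕ, ∀ s ∈ Ico 0 ((N : ℝ) + 1), w ⌊s⌋₊ s = w N s := by
    intro N s hs
    refine huniq _ _ ?_ s ⟨hs.1, (Nat.lt_floor_add_one s).le⟩
    exact Nat.lt_succ_iff.1 ((Nat.floor_lt hs.1).2 (by exact_mod_cast hs.2))
  -- Since `t < ⌊t⌋ + 1`, the solution on `[0, ⌊t⌋ + 1]` is defined on a neighbourhood of `t`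
  -- relative to `[0, ∞)`, and by uniqueness the glued curve coincides with it there.
  refine ⟨fun t => w ⌊t⌋₊ t, by simp [hw0], fun t ht => ?_⟩
  set N := ⌊t⌋₊
  have htN : t < (N : ℝ) + 1 := Nat.lt_floor_add_one t
  have hnhds : Ico 0 ((N : ℝ) + 1) ∈ 𝓝[Ici 0] t := by
    rw [← Ici_inter_Iio]
    exact inter_mem_nhdsWithin _ (Iio_mem_nhds htN)
  have h2 : HasDerivWithinAt (w N) (F (w N t)) (Ici 0) t :=
    (hw N t ⟨ht, htN.le⟩).mono_of_mem_nhdsWithin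
      (mem_of_superset hnhds Ico_subset_Icc_self)
  exact h2.congr_of_eventuallyEq (mem_of_superset hnhds fun s hs => hglue N s hs) rfl

end GlobalODE

end DampedEuler
end

/-! ### Global solutions of the damped Bardina–Euler systems -/

noncomputable section

namespace DampedEuler

/-- The vector field of the damped Bardina–Euler system for `w = (1 - αΔ) v`. -/
def bardinaField {α : ℝ} (hα : 0 < α) (γ : ℝ) (g : L2Field) (w : H0) : H0 :=
  H0.orthogonalProjectionOnto (g - bil hα w w) - γ • w

section Bardina

variable {α : ℝ} (hα : 0 < α) {γ : ℝ} {g : L2Field}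

theorem coe_bardinaField (w : H0) :
    (bardinaField hα γ g w : L2Field) = leray (g - bil hα w w) - γ • (w : L2Field) := rfl

theorem inner_bardinaField (w : H0) {z : L2Field} (hz : z ∈ H0) :
    inner ℝ (bardinaField hα γ g w : L2Field) z =
      inner ℝ g z - inner ℝ (bil hα w w) z - γ * inner ℝ (w : L2Field) z := by
  rw [coe_bardinaField, inner_sub_left, inner_leray_of_mem _ hz, inner_sub_left,
    real_inner_smul_left]

theorem lipschitzOn_bardinaField (γ : ℝ) (g : L2Field) (K : ℝ) :
    ∃ L : NNReal, LipschitzOnWith L (bardinaField hα γ g) (Metric.closedBall 0 K) := by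
  refine ⟨Real.toNNReal (2 * ‖bil hα‖ * |K| + |γ|), LipschitzOnWith.of_dist_le_mul
    fun x hx y hy => ?_⟩
  rw [mem_closedBall_zero_iff] at hx hy
  rw [dist_eq_norm, dist_eq_norm, Real.coe_toNNReal _ (by positivity)]
  have e : bardinaField hα γ g x - bardinaField hα γ g y =
      -(H0.orthogonalProjectionOnto (bil hα (x - y : H0) x + bil hα y (x - y : H0)))
        - γ • (x - y) := by
    have : bil hα (x - y : H0) x + bil hα y (x - y : H0) = bil hα x x - bil hα y y := by
      simp only [Submodule.coe_sub, map_sub, sub_apply]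
      abel
    rw [this, bardinaField, bardinaField, map_sub, map_sub, map_sub, smul_sub]
    abel
  have hn : ∀ z : H0, ‖(z : L2Field)‖ = ‖z‖ := fun z => rfl
  have hx' : ‖x‖ ≤ |K| := hx.trans (le_abs_self _)
  have hy' : ‖y‖ ≤ |K| := hy.trans (le_abs_self _)
  rw [e]
  calc _ ≤ ‖H0.orthogonalProjectionOnto (bil hα (x - y : H0) x + bil hα y (x - y : H0))‖
        + ‖γ • (x - y)‖ := by rw [← norm_neg (H0.orthogonalProjectionOnto _)]; exact norm_sub_le _ _
    _ ≤ ‖bil hα (x - y : H0) x + bil hα y (x - y : H0)‖ + |γ| * ‖x - y‖ := by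
        rw [norm_smul, Real.norm_eq_abs]
        gcongr
        have := H0.orthogonalProjectionOnto.le_of_opNorm_le H0.orthogonalProjectionOnto_norm_le
          (bil hα (x - y : H0) x + bil hα y (x - y : H0))
        simpa using this
    _ ≤ (‖bil hα‖ * ‖x - y‖ * |K| + ‖bil hα‖ * |K| * ‖x - y‖) + |γ| * ‖x - y‖ := by
        gcongr
        refine (norm_add_le _ _).trans (add_le_add ?_ ?_)
        · refine ((bil hα).le_opNorm₂ _ _).trans ?_
          rw [hn, hn]
          gcongr
        · refine ((bil hα).le_opNorm₂ _ _).trans ?_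
          rw [hn, hn]
          gcongr
    _ = _ := by ring

theorem hasDerivWithinAt_energy {w : ℝ → H0} {w' : H0} {s : Set ℝ} {t : ℝ}
    (h : HasDerivWithinAt w w' s t) :
    HasDerivWithinAt (fun t => inner ℝ (w t : L2Field) (res hα (w t)))
      (2 * inner ℝ (w' : L2Field) (res hα (w t))) s t := by
  have h1 : HasDerivWithinAt (fun t => (w t : L2Field)) (w' : L2Field) s t :=
    H0.subtypeL.hasFDerivAt.comp_hasDerivWithinAt t h
  have h2 : HasDerivWithinAt (fun t => res hα (w t : L2Field)) (res hα w') s t :=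
    (res hα).hasFDerivAt.comp_hasDerivWithinAt t h1
  refine (h1.inner ℝ h2).congr_deriv ?_
  rw [← inner_res_left, real_inner_comm]
  ring

theorem inner_res_nonneg (x : L2Field) : 0 ≤ inner ℝ x (res hα x) := by
  rw [← energy_res]; positivity

theorem norm_res_sq_le (x : L2Field) : ‖res hα x‖ ^ 2 ≤ inner ℝ x (res hα x) := by
  rw [← energy_res]
  have : 0 ≤ α * ∑ i, ‖resPartial hα i x‖ ^ 2 := by positivity
  linarith

/-- The quadratic term is orthogonal to `Rx` for every `θ`, the damping has a good sign, and `2(g,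
Rx) ≤ ‖g‖² + ‖Rx‖²`. The growth rate `1` involves neither `α` nor `θ`. -/
theorem energy_rate_le (hγ : 0 < γ) (x : H0) {θ : ℝ} (hθ : θ ∈ Icc (0 : ℝ) 1) :
    2 * inner ℝ (bardinaField hα γ g (θ • x) : L2Field) (res hα x) ≤
      1 * inner ℝ (x : L2Field) (res hα x) + ‖g‖ ^ 2 := by
  rw [inner_bardinaField hα _ (res_mem_H0 hα x.2), Submodule.coe_smul, map_smul, map_smul]
  simp only [smul_apply, real_inner_smul_left, inner_bil_res_self hα x.2]
  have h1 := norm_res_sq_le hα (x : L2Field)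
  have h2 : inner ℝ g (res hα x) ≤ ‖g‖ * ‖res hα x‖ := real_inner_le_norm _ _
  have h3 : 0 ≤ γ * (θ * inner ℝ (x : L2Field) (res hα x)) :=
    mul_nonneg hγ.le (mul_nonneg hθ.1 (inner_res_nonneg hα _))
  nlinarith [sq_nonneg (‖g‖ - ‖res hα x‖)]

theorem energy_le (hγ : 0 < γ) {w : ℝ → H0} {θ : ℝ → ℝ} (hθ : ∀ t, θ t ∈ Icc (0 : ℝ) 1) {T : ℝ}
    (hw : ∀ t ∈ Icc 0 T, HasDerivWithinAt w (bardinaField hα γ g (θ t • w t)) (Icc 0 T) t) :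
    ∀ t ∈ Icc 0 T, inner ℝ (w t : L2Field) (res hα (w t)) ≤
      gronwallBound (inner ℝ (w 0 : L2Field) (res hα (w 0))) 1 (‖g‖ ^ 2) T := by
  intro t ht
  have hT : 0 ≤ T := ht.1.trans ht.2
  have h1 := le_gronwallBound_of_liminf_deriv_right_le
    (f := fun t => inner ℝ (w t : L2Field) (res hα (w t)))
    (f' := fun t => 2 * inner ℝ (bardinaField hα γ g (θ t • w t) : L2Field) (res hα (w t)))
    (a := 0) (b := T) (δ := inner ℝ (w 0 : L2Field) (res hα (w 0))) (K := 1) (ε := ‖g‖ ^ 2)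
    (fun t ht => (hasDerivWithinAt_energy hα (hw t ht)).continuousWithinAt)
    (fun t ht r hr => ((hasDerivWithinAt_energy hα (hw t (Ico_subset_Icc_self ht))).mono_of_mem_nhdsWithin
      (mem_of_superset (Icc_mem_nhdsGE ht.2) (Icc_subset_Icc_left ht.1))).liminf_right_slope_le hr)
    le_rfl (fun t _ => energy_rate_le hα hγ (w t) (hθ t)) t ht
  refine h1.trans (gronwallBound_mono (inner_res_nonneg hα _) (sq_nonneg _) zero_le_one ?_)
  simpa using ht.2

theorem norm_bardinaField_le (w : H0) :
    ‖bardinaField hα γ g w‖ ≤ ‖g‖ + ‖bil hα w w‖ + |γ| * ‖w‖ := by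
  rw [bardinaField]
  have h1 := H0.orthogonalProjectionOnto.le_of_opNorm_le H0.orthogonalProjectionOnto_norm_le
          (g - bil hα w w)
  rw [one_mul] at h1
  calc _ ≤ ‖H0.orthogonalProjectionOnto (g - bil hα w w)‖ + ‖γ • w‖ := norm_sub_le _ _
    _ ≤ ‖g - bil hα w w‖ + ‖γ • w‖ := by gcongr
    _ ≤ (‖g‖ + ‖bil hα w w‖) + ‖γ • w‖ := by gcongr; exact norm_sub_le _ _
    _ = _ := by rw [norm_smul, Real.norm_eq_abs]

/-- Two applications of Gronwall: the first, for the energy, bounds the gradient of the regularized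
field; the second, for `‖w‖`, uses that the vector field is then of linear growth. -/
theorem exists_bardina_bound (hγ : 0 < γ) (g : L2Field) (w₀ : H0) (T : ℝ) : ∃ K : ℝ,
    ∀ (w : ℝ → H0) (θ : ℝ → ℝ), (∀ t, θ t ∈ Icc (0 : ℝ) 1) → w 0 = w₀ →
      (∀ t ∈ Icc 0 T, HasDerivWithinAt w (bardinaField hα γ g (θ t • w t)) (Icc 0 T) t) →
      ∀ t ∈ Icc 0 T, ‖w t‖ ≤ K := by
  obtain ⟨C, hC, hbil⟩ := exists_norm_bil_le hα
  set Y := gronwallBound (inner ℝ (w₀ : L2Field) (res hα w₀)) 1 (‖g‖ ^ 2) T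
  -- The energy bound `α‖∂ᵢv‖² ≤ Y`, summed over the three directions.
  set S := 3 * Real.sqrt (Y / α)
  have hS : 0 ≤ S := by positivity
  refine ⟨gronwallBound ‖w₀‖ (C * S + γ) ‖g‖ T, fun w θ hθ h0 hw t ht => ?_⟩
  have hen := energy_le hα hγ hθ hw
  rw [h0] at hen
  have hpart : ∀ t ∈ Icc 0 T, ∑ i, ‖resPartial hα i (w t)‖ ≤ S := by
    intro t ht
    have h1 := hen t ht
    rw [← energy_res] at h1
    have h2 : ∀ i, ‖resPartial hα i (w t)‖ ≤ Real.sqrt (Y / α) := by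
      intro i
      apply Real.le_sqrt_of_sq_le
      rw [le_div_iff₀ hα]
      have h3 : ‖resPartial hα i (w t)‖ ^ 2 ≤ ∑ i, ‖resPartial hα i (w t)‖ ^ 2 :=
        Finset.single_le_sum (f := fun i => ‖resPartial hα i (w t : L2Field)‖ ^ 2)
          (fun _ _ => sq_nonneg _) (Finset.mem_univ i)
      nlinarith [sq_nonneg ‖res hα (w t)‖]
    calc _ ≤ ∑ _i : Fin 3, Real.sqrt (Y / α) := Finset.sum_le_sum fun i _ => h2 i
      _ = S := by simp [S]
  have h1 := norm_le_gronwallBound_of_norm_deriv_right_le (f := w)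
    (f' := fun t => bardinaField hα γ g (θ t • w t)) (δ := ‖w₀‖) (K := C * S + γ) (ε := ‖g‖)
    (a := 0) (b := T) (fun t ht => (hw t ht).continuousWithinAt)
    (fun t ht => (hw t (Ico_subset_Icc_self ht)).mono_of_mem_nhdsWithin
      (mem_of_superset (Icc_mem_nhdsGE ht.2) (Icc_subset_Icc_left ht.1)))
    (by rw [h0]) (fun t ht => by
      refine (norm_bardinaField_le hα _).trans ?_
      have hθ1 := (hθ t).2
      have hθ0 := (hθ t).1
      have h2 := hbil (w t) (w t)
      have h3 : ‖bil hα (θ t • w t : H0) (θ t • w t : H0)‖ ≤ ‖bil hα (w t) (w t)‖ := by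
        rw [Submodule.coe_smul, map_smul, map_smul, smul_apply, norm_smul, norm_smul,
          Real.norm_of_nonneg hθ0]
        calc _ ≤ 1 * (1 * ‖bil hα (w t) (w t)‖) := by gcongr
          _ = _ := by ring
      have h4 : ‖θ t • w t‖ ≤ ‖w t‖ := by
        rw [norm_smul, Real.norm_of_nonneg hθ0]
        exact mul_le_of_le_one_left (norm_nonneg _) hθ1
      have h5 : C * ‖(w t : L2Field)‖ * ∑ i, ‖resPartial hα i (w t)‖ ≤ C * ‖w t‖ * S := by
        have := hpart t (Ico_subset_Icc_self ht)
        have e : ‖(w t : L2Field)‖ = ‖w t‖ := rfl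
        rw [e]
        gcongr
      have h6 : |γ| * ‖θ t • w t‖ ≤ γ * ‖w t‖ := by
        rw [abs_of_pos hγ]; gcongr
      nlinarith) t ht
  refine h1.trans (gronwallBound_mono (norm_nonneg _) (norm_nonneg _) (by positivity) ?_)
  simpa using ht.2

theorem exists_bardina_flow (hγ : 0 < γ) (g : L2Field) (w₀ : H0) :
    ∃ w : ℝ → H0, w 0 = w₀ ∧
      ∀ t ∈ Ici (0 : ℝ), HasDerivWithinAt w (bardinaField hα γ g (w t)) (Ici 0) t :=
  exists_global_solution (lipschitzOn_bardinaField hα γ g)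
    fun T _ => exists_bardina_bound hα hγ g w₀ T

theorem continuous_bardinaField (γ : ℝ) (g : L2Field) : Continuous (bardinaField hα γ g) := by
  unfold bardinaField
  fun_prop

/-- The regularized field of a solution `w` is a solution of the damped Bardina–Euler system. -/
theorem isBardinaSolution_resH1 {w : ℝ → H0}
    (hw : ∀ t ∈ Ici (0 : ℝ), HasDerivWithinAt w (bardinaField hα γ g (w t)) (Ici 0) t) :
    IsBardinaSolution α γ g fun t => resH1 hα (w t) := by
  have hd : ∀ t ∈ Ici (0 : ℝ), HasDerivWithinAt (fun t => resH1 hα (w t))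
      (resH1 hα (bardinaField hα γ g (w t))) (Ici 0) t := fun t ht =>
    (resH1 hα).hasFDerivAt.comp_hasDerivWithinAt t (hw t ht)
  have hdw : ∀ t ∈ Ici (0 : ℝ), derivWithin (fun t => resH1 hα (w t)) (Ici 0) t =
      resH1 hα (bardinaField hα γ g (w t)) := fun t ht =>
    (hd t ht).derivWithin (uniqueDiffOn_Ici 0 t ht)
  constructor
  · rw [show (1 : WithTop ℕ∞) = 0 + 1 from rfl, contDiffOn_succ_iff_derivWithin (uniqueDiffOn_Ici 0)]
    refine ⟨fun t ht => (hd t ht).differentiableWithinAt, by simp, ?_⟩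
    rw [contDiffOn_zero]
    refine ContinuousOn.congr ?_ hdw
    exact (resH1 hα).continuous.comp_continuousOn ((continuous_bardinaField hα γ g).comp_continuousOn
      fun t ht => (hw t ht).continuousWithinAt)
  · intro t ht ψ hψ hp hdiv
    have hmem := toL2_mem_H0 hψ hp hdiv
    simp only [hdw t ht, field_resH1, pd_resH1]
    -- Both `𝓗_α` pairings become `L²` pairings with `w'` and `w`; membership of the test field in
    -- `𝓗₀` removes the projector.
    rw [integral_convect hα (w t : L2Field) hψ.continuous, ← inner_eq_res_add hα _ hψ hp,
      ← inner_eq_res_add hα _ hψ hp, inner_bardinaField hα _ hmem]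
    ring

end Bardina

end DampedEuler
end

/-! ### Regularity in time of test fields, of `D₀(φ)` and of `e₀(φ)` -/

noncomputable section

namespace DampedEuler

theorem eventually_forall_cell_norm_sub_lt {F : Type*} [NormedAddCommGroup F] {G : ℝ → E → F}
    (hG : Continuous fun q : ℝ × E => G q.1 q.2) (t : ℝ) {ε : ℝ} (hε : 0 < ε) :
    ∀ᶠ s in 𝓝 t, ∀ x ∈ cell, ‖G s x - G t x‖ < ε := by
  have h : ∀ᶠ s in 𝓝 t, ∀ x ∈ Metric.closedBall (0 : E) (Real.sqrt (3 * Real.pi ^ 2)),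
      ‖G s x - G t x‖ < ε := by
    refine isCompact_bigBall.eventually_forall_of_forall_eventually fun x _ => ?_
    have hc : Continuous fun q : ℝ × E => ‖G q.1 q.2 - G t q.2‖ :=
      (hG.sub (hG.comp (continuous_const.prodMk continuous_snd))).norm
    refine (hc.tendsto (t, x)).eventually (Iio_mem_nhds ?_)
    simpa using hε
  exact h.mono fun s hs x hx => hs x (cell_subset hx)

theorem continuous_toL2 {G : ℝ → E → E} (hG : Continuous fun q : ℝ × E => G q.1 q.2)
    (hG' : ∀ t, Continuous (G t)) : Continuous fun t => toL2 (G t) (hG' t) := by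
  rw [continuous_iff_continuousAt]
  intro t
  rw [ContinuousAt, Metric.tendsto_nhds]
  intro ε hε
  have hpi := Real.pi_pos
  set c := Real.sqrt ((2 * Real.pi) ^ 3)
  have hc : 0 < c := by positivity
  filter_upwards [eventually_forall_cell_norm_sub_lt hG t (ε := ε / (2 * c)) (by positivity)]
    with s hs
  rw [dist_eq_norm, ← toL2_sub]
  refine (norm_toL2_le _ (C := ε / (2 * c)) (by positivity) fun x hx => (hs x hx).le).trans_lt ?_
  change c * _ < ε
  field_simp
  linarith

/-- `t ↦ fderiv (ψ t) x` is jointly smooth for jointly smooth `ψ`. -/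
theorem contDiff_fderiv_space {ψ : ℝ → E → E}
    (hψ : ContDiff ℝ ∞ fun q : ℝ × E => ψ q.1 q.2) :
    ContDiff ℝ ∞ fun q : ℝ × E => fderiv ℝ (ψ q.1) q.2 := by
  have e : ∀ q : ℝ × E, fderiv ℝ (ψ q.1) q.2 =
      (fderiv ℝ (fun q : ℝ × E => ψ q.1 q.2) q).comp (ContinuousLinearMap.inr ℝ ℝ E) := by
    rintro ⟨t, x⟩
    exact ((hψ.differentiable (by simp) (t, x)).hasFDerivAt.comp x
      (hasFDerivAt_prodMk_right t x)).fderiv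
  simp only [e]
  exact (hψ.fderiv_right (m := ∞) (by simp)).clm_comp contDiff_const

/-- The sum of the `L²` norms of the spatial derivatives of a smooth family is locally bounded
in time. -/
theorem exists_bound_partial {ψ : ℝ → E → E}
    (hψ : ContDiff ℝ ∞ fun q : ℝ × E => ψ q.1 q.2) (hs : ∀ t, ContDiff ℝ ∞ (ψ t)) (T : ℝ) :
    ∃ C, 0 ≤ C ∧ ∀ t ∈ Icc 0 T, ∑ i, ‖toL2 (fun x => fderiv ℝ (ψ t) x (unitVec i))
      (continuous_partial (hs t) i)‖ ≤ C := by
  have hc : Continuous fun t => ∑ i, ‖toL2 (fun x => fderiv ℝ (ψ t) x (unitVec i))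
      (continuous_partial (hs t) i)‖ :=
    continuous_finsetSum _ fun i _ => (continuous_toL2 (G := fun t x =>
      fderiv ℝ (ψ t) x (unitVec i)) ((contDiff_fderiv_space hψ).continuous.clm_apply
        continuous_const) _).norm
  obtain ⟨C, hC⟩ := isCompact_Icc.exists_bound_of_continuousOn (s := Icc 0 T) hc.continuousOn
  exact ⟨max C 0, le_max_right _ _, fun t ht => (le_abs_self _).trans
    ((hC t ht).trans (le_max_left _ _))⟩

namespace TestField

variable (φ : TestField)

/-- The derivative of the joint function in the time direction. -/
theorem contDiff_timeDeriv :
    ContDiff ℝ ∞ fun q : ℝ × E => deriv (fun s => φ.toFun s q.2) q.1 := by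
  simp only [deriv_time_eq]
  exact (φ.smooth.fderiv_right (m := ∞) (by simp)).clm_apply contDiff_const

theorem hasDerivAt_time (t : ℝ) (x : E) :
    HasDerivAt (fun s => φ.toFun s x) (deriv (fun s => φ.toFun s x) t) t := by
  have h : ContDiff ℝ ∞ fun s => φ.toFun s x := φ.smooth.comp (contDiff_id.prodMk contDiff_const)
  exact (h.differentiable (by simp) t).hasDerivAt

theorem contDiff_timeDeriv_space (t : ℝ) :
    ContDiff ℝ ∞ fun x => deriv (fun s => φ.toFun s x) t :=
  φ.contDiff_timeDeriv.comp (contDiff_const.prodMk contDiff_id)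

/-- Periodicity of a test field is known for nonnegative times only, so the two-sided time
derivative is covered at positive times. -/
theorem periodic_timeDeriv {t : ℝ} (ht : 0 < t) :
    Periodic fun x => deriv (fun s => φ.toFun s x) t := by
  intro x i
  apply Filter.EventuallyEq.deriv_eq
  filter_upwards [Ioi_mem_nhds ht] with s hs
  exact φ.periodic s (le_of_lt hs) x i

/-- `∂ₜφ(t)` as an element of `L²`. -/
def dtVal (t : ℝ) : L2Field :=
  toL2 (fun x => deriv (fun s => φ.toFun s x) t) (φ.continuous_deriv_time t)

theorem hasDerivAt_val (t : ℝ) : HasDerivAt φ.val (φ.dtVal t) t := by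
  rw [hasDerivAt_iff_isLittleO, Asymptotics.isLittleO_iff]
  intro ε hε
  have hpi := Real.pi_pos
  set c := Real.sqrt ((2 * Real.pi) ^ 3) with hcdef
  have hc : 0 < c := by positivity
  obtain ⟨δ, hδ, hball⟩ := Metric.eventually_nhds_iff_ball.1
    (eventually_forall_cell_norm_sub_lt (G := fun t x => deriv (fun s => φ.toFun s x) t)
      φ.contDiff_timeDeriv.continuous t (ε := ε / c)
      (by positivity))
  filter_upwards [Metric.ball_mem_nhds t hδ] with s hs
  have hsm : Continuous fun x => (s - t) • deriv (fun r => φ.toFun r x) t :=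
    (φ.continuous_deriv_time t).const_smul (s - t)
  have hcont : Continuous fun x => φ.toFun s x - φ.toFun t x -
      (s - t) • deriv (fun r => φ.toFun r x) t :=
    (((φ.smooth_space s).continuous.sub (φ.smooth_space t).continuous)).sub
      hsm
  have e : φ.val s - φ.val t - (s - t) • φ.dtVal t = toL2 _ hcont := by
    rw [val, val, dtVal, ← toL2_smul, ← toL2_sub, ← toL2_sub]
  rw [e]
  refine (norm_toL2_le hcont (C := ε / c * ‖s - t‖) (by positivity) fun x hx => ?_).trans_eq ?_
  · have hd : ∀ r ∈ Metric.ball t δ, HasDerivWithinAt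
        (fun r => φ.toFun r x - r • deriv (fun r => φ.toFun r x) t)
        (deriv (fun r => φ.toFun r x) r - (1 : ℝ) • deriv (fun r => φ.toFun r x) t)
        (Metric.ball t δ) r := fun r _ =>
      ((φ.hasDerivAt_time r x).sub ((hasDerivAt_id r).smul_const _)).hasDerivWithinAt
    have := (convex_ball t δ).norm_image_sub_le_of_norm_hasDerivWithin_le hd
      (fun r hr => by rw [one_smul]; exact (hball r hr x hx).le)
      (Metric.mem_ball_self hδ) hs
    refine le_trans (le_of_eq ?_) this
    congr 1
    rw [sub_smul]; abel
  · rw [← hcdef]; field_simp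

theorem continuous_val : Continuous φ.val :=
  continuous_iff_continuousAt.2 fun t => (φ.hasDerivAt_val t).continuousAt

theorem continuous_dtVal : Continuous φ.dtVal :=
  continuous_toL2 φ.contDiff_timeDeriv.continuous φ.continuous_deriv_time

theorem continuous_D (γ : ℝ) (g : L2Field) : Continuous (φ.D γ g) := by
  have h1 : Continuous fun t => toL2 (fun x => fderiv ℝ (φ.toFun t) x (φ.toFun t x))
      (φ.continuous_convect t) :=
    continuous_toL2 ((contDiff_fderiv_space φ.smooth).continuous.clm_apply φ.smooth.continuous)
      φ.continuous_convect
  exact ((φ.continuous_dtVal.add (leray.continuous.comp h1)).add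
    (φ.continuous_val.const_smul γ)).sub continuous_const

theorem val_mem_H0 {t : ℝ} (ht : 0 ≤ t) : φ.val t ∈ H0 :=
  toL2_mem_H0 (φ.smooth_space t) (φ.periodic t ht) (φ.div_free t ht)

/-- The quotients whose supremum is `e φ t`. -/
def eSet (t : ℝ) : Set ℝ := {r : ℝ | ∃ z ∈ H0, z ≠ 0 ∧
    r = - (∫ x in cell, inner ℝ (fderiv ℝ (φ.toFun t) x (z x)) (z x)) / ‖z‖ ^ 2}

theorem integral_eq_transport (t : ℝ) (z : L2Field) :
    ∫ x in cell, inner ℝ (fderiv ℝ (φ.toFun t) x (z x)) (z x) =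
      inner ℝ (transport (φ.toFun t) (φ.smooth_space t) z) z :=
  (mulOp_inner _ z z).symm

theorem bddAbove_eSet (t : ℝ) : BddAbove (φ.eSet t) := by
  obtain ⟨C, hC, hCb⟩ := exists_bound_cell (continuous_fderiv_of_smooth (φ.smooth_space t))
  refine ⟨C, ?_⟩
  rintro r ⟨z, -, hz, rfl⟩
  rw [integral_eq_transport]
  have hz' : 0 < ‖z‖ := norm_pos_iff.2 hz
  rw [div_le_iff₀ (by positivity)]
  have h1 := abs_real_inner_le_norm (transport (φ.toFun t) (φ.smooth_space t) z) z
  have h2 := norm_mulOp_le (continuous_fderiv_of_smooth (φ.smooth_space t)) hCb z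
  have h3 := neg_le_abs (inner ℝ (transport (φ.toFun t) (φ.smooth_space t) z) z)
  calc _ ≤ ‖transport (φ.toFun t) (φ.smooth_space t) z‖ * ‖z‖ := h3.trans h1
    _ ≤ C * ‖z‖ * ‖z‖ := by gcongr; exact h2
    _ = _ := by ring

theorem neg_transport_le {t : ℝ} {z : L2Field} (hz : z ∈ H0) :
    -inner ℝ (transport (φ.toFun t) (φ.smooth_space t) z) z ≤ φ.e t * ‖z‖ ^ 2 := by
  by_cases h0 : z = 0
  · simp [h0]
  · have hz' : 0 < ‖z‖ := norm_pos_iff.2 h0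
    rw [← div_le_iff₀ (by positivity)]
    refine le_csSup (φ.bddAbove_eSet t) ⟨z, hz, h0, ?_⟩
    rw [integral_eq_transport]

/-- The constant vector field of direction `e₀`. -/
def constField : L2Field := toL2 (fun _ => unitVec 0) continuous_const

theorem constField_mem : constField ∈ H0 :=
  toL2_mem_H0 contDiff_const (fun _ _ => rfl) (fun x => by simp [divergence])

theorem constField_ne_zero : constField ≠ 0 := by
  intro h
  have h1 : inner ℝ constField constField = (2 * Real.pi) ^ 3 := by
    rw [constField, toL2_inner_toL2]
    simp only [inner_unitVec]
    have : (unitVec 0 : E) 0 = 1 := by simp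
    rw [this, setIntegral_const, smul_eq_mul, mul_one, measureReal_def, volume_cell,
      ENNReal.toReal_ofReal (by have := Real.pi_pos; positivity)]
  rw [h, inner_zero_left] at h1
  have := Real.pi_pos
  have : (0 : ℝ) < (2 * Real.pi) ^ 3 := by positivity
  linarith

theorem eSet_nonempty (t : ℝ) : (φ.eSet t).Nonempty :=
  ⟨_, constField, constField_mem, constField_ne_zero, rfl⟩

/-- A constant field `z` gives the quotient `0`, the mean of a derivative of a periodic function.
The sign allows upper bounds on `‖v - φ‖²` to be multiplied by `e₀(φ)`. -/
theorem e_nonneg {t : ℝ} (ht : 0 ≤ t) : 0 ≤ φ.e t := by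
  refine le_csSup (φ.bddAbove_eSet t) ⟨constField, constField_mem, constField_ne_zero, ?_⟩
  rw [integral_eq_transport, transport, constField, mulOp_toL2, toL2_inner_toL2]
  simp only [inner_unitVec, ← fderiv_component (φ.smooth_space t)]
  rw [integral_partial_eq_zero ((contDiff_component (φ.smooth_space t) 0).of_le (by simp))
    (fun x i => by simp only [φ.periodic t ht x i])]
  simp

/-- Perturbing `∇φ` by `ε` uniformly changes each quotient by at most `ε`. Continuity of `e₀(φ)`
follows, which makes the exponential weight differentiable. -/
theorem e_le_add {s t ε : ℝ} (h : ∀ x ∈ cell,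
    ‖fderiv ℝ (φ.toFun s) x - fderiv ℝ (φ.toFun t) x‖ ≤ ε) : φ.e t ≤ φ.e s + ε := by
  refine csSup_le (φ.eSet_nonempty t) ?_
  rintro r ⟨z, hz, hz0, rfl⟩
  have hz' : 0 < ‖z‖ := norm_pos_iff.2 hz0
  rw [integral_eq_transport, div_le_iff₀ (by positivity), add_mul]
  have h1 := φ.neg_transport_le (t := s) hz
  have hc := (continuous_fderiv_of_smooth (φ.smooth_space s)).sub
    (continuous_fderiv_of_smooth (φ.smooth_space t))
  have h2 := norm_mulOp_le hc h z
  have e : transport (φ.toFun s) (φ.smooth_space s) z - transport (φ.toFun t) (φ.smooth_space t) z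
      = mulOp _ hc z := by
    apply Lp.ext
    filter_upwards [Lp.coeFn_sub (transport (φ.toFun s) (φ.smooth_space s) z)
      (transport (φ.toFun t) (φ.smooth_space t) z), coeFn_mulOp hc z,
      coeFn_mulOp (continuous_fderiv_of_smooth (φ.smooth_space s)) z,
      coeFn_mulOp (continuous_fderiv_of_smooth (φ.smooth_space t)) z] with x a1 a2 a3 a4
    rw [a1, a2, Pi.sub_apply, transport, transport, a3, a4]
    rfl
  have h3 : inner ℝ (transport (φ.toFun s) (φ.smooth_space s) z) z -
      inner ℝ (transport (φ.toFun t) (φ.smooth_space t) z) z ≤ ε * ‖z‖ ^ 2 := by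
    rw [← inner_sub_left, e]
    calc _ ≤ ‖mulOp _ hc z‖ * ‖z‖ := real_inner_le_norm _ _
      _ ≤ ε * ‖z‖ * ‖z‖ := by gcongr
      _ = _ := by ring
  linarith

theorem continuous_e : Continuous φ.e := by
  rw [continuous_iff_continuousAt]
  intro t
  rw [ContinuousAt, Metric.tendsto_nhds]
  intro ε hε
  filter_upwards [eventually_forall_cell_norm_sub_lt
    (G := fun t x => fderiv ℝ (φ.toFun t) x) (contDiff_fderiv_space φ.smooth).continuous t
    (half_pos hε)] with s hs
  have h1 := φ.e_le_add (fun x hx => (hs x hx).le)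
  have h2 := φ.e_le_add (s := t) (t := s) (ε := ε / 2)
    (fun x hx => by rw [norm_sub_rev]; exact (hs x hx).le)
  rw [Real.dist_eq, abs_lt]
  constructor <;> linarith

end TestField

end DampedEuler
end

/-! ### Relative energy and the approximate dissipative inequality -/

noncomputable section

namespace DampedEuler

section Approx

variable {α : ℝ} (hα : 0 < α) {γ : ℝ} {g : L2Field}

/-- The difference is `α ∑ (∂ᵢRx, ∂ᵢψ)`. One factor `√α` is absorbed by the energy bound `√α ‖∂ᵢRx‖
≤ √Y`; the other remains as the rate of convergence. -/
theorem abs_inner_sub_res_le {x : L2Field} {Y : ℝ} (hY : inner ℝ x (res hα x) ≤ Y) {ψ : E → E}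
    (hψ : ContDiff ℝ ∞ ψ) (hp : Periodic ψ) :
    |inner ℝ x (toL2 ψ hψ.continuous) - inner ℝ (res hα x) (toL2 ψ hψ.continuous)| ≤
      Real.sqrt α * (Real.sqrt Y * ∑ i, ‖toL2 (fun x => fderiv ℝ ψ x (unitVec i))
        (continuous_partial hψ i)‖) := by
  rw [inner_eq_res_add hα x hψ hp, add_sub_cancel_left, Finset.mul_sum, Finset.mul_sum,
    Finset.mul_sum]
  refine (Finset.abs_sum_le_sum_abs _ _).trans (Finset.sum_le_sum fun i _ => ?_)
  have h1 : Real.sqrt α * ‖resPartial hα i x‖ ≤ Real.sqrt Y := by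
    apply Real.le_sqrt_of_sq_le
    rw [mul_pow, Real.sq_sqrt hα.le]
    have h3 : ‖resPartial hα i x‖ ^ 2 ≤ ∑ i, ‖resPartial hα i x‖ ^ 2 :=
      Finset.single_le_sum (f := fun i => ‖resPartial hα i x‖ ^ 2)
        (fun _ _ => sq_nonneg _) (Finset.mem_univ i)
    rw [← energy_res] at hY
    nlinarith [sq_nonneg ‖res hα x‖]
  have h2 := abs_real_inner_le_norm (resPartial hα i x)
    (toL2 (fun x => fderiv ℝ ψ x (unitVec i)) (continuous_partial hψ i))
  rw [abs_mul, abs_of_pos hα]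
  calc _ ≤ α * (‖resPartial hα i x‖ * ‖toL2 (fun x => fderiv ℝ ψ x (unitVec i))
        (continuous_partial hψ i)‖) := by gcongr
    _ = Real.sqrt α * ((Real.sqrt α * ‖resPartial hα i x‖) *
        ‖toL2 (fun x => fderiv ℝ ψ x (unitVec i)) (continuous_partial hψ i)‖) := by
        have hs := Real.mul_self_sqrt hα.le
        linear_combination (-(‖resPartial hα i x‖ *
          ‖toL2 (fun x => fderiv ℝ ψ x (unitVec i)) (continuous_partial hψ i)‖)) * hs
    _ ≤ _ := by gcongr

/-- The relative energy of `v = (1 - αΔ)⁻¹ w` and a test field, up to the term `α ‖∇φ‖²`. -/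
def relEnergy (φ : TestField) (t : ℝ) (w : L2Field) : ℝ :=
  inner ℝ w (res hα w) - 2 * inner ℝ w (φ.val t) + ‖φ.val t‖ ^ 2

theorem norm_sub_sq_le_relEnergy (φ : TestField) (t : ℝ) (w : L2Field) :
    ‖res hα w - φ.val t‖ ^ 2 ≤ relEnergy hα φ t w +
      2 * (inner ℝ w (φ.val t) - inner ℝ (res hα w) (φ.val t)) := by
  rw [norm_sub_sq_real, relEnergy]
  have := norm_res_sq_le hα w
  linarith

/-- With `T z = (z, ∇)φ` and `v = Rw`, the cubic term in `v` vanishes and `(T v, φ) = 0`, so `(T v,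
v) - (T φ, v - φ)` equals `(T (v - φ), v - φ)`. The last two lines are consistency errors caused by
`w ≠ v`. -/
theorem relEnergy_rate (φ : TestField) {t : ℝ} (ht : 0 ≤ t) (w : H0) :
    2 * inner ℝ (bardinaField hα γ g w : L2Field) (res hα w)
      - 2 * (inner ℝ (w : L2Field) (φ.dtVal t)
        + inner ℝ (bardinaField hα γ g w : L2Field) (φ.val t))
      + 2 * inner ℝ (φ.val t) (φ.dtVal t) =
    -2 * γ * relEnergy hα φ t w
      - 2 * inner ℝ (transport (φ.toFun t) (φ.smooth_space t) (res hα w - φ.val t))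
          (res hα w - φ.val t)
      - 2 * inner ℝ (φ.D γ g t) (res hα w - φ.val t)
      - 2 * γ * (inner ℝ (w : L2Field) (φ.val t) - inner ℝ (res hα w) (φ.val t))
      - 2 * (inner ℝ (w : L2Field) (φ.dtVal t) - inner ℝ (res hα w) (φ.dtVal t)) := by
  have hv := res_mem_H0 hα w.2
  have hφ := φ.val_mem_H0 ht
  have hz := H0.sub_mem hv hφ
  set v := res hα (w : L2Field) with hvdef
  set T := transport (φ.toFun t) (φ.smooth_space t) with hT
  have e1 : inner ℝ (bardinaField hα γ g w : L2Field) v =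
      inner ℝ g v - γ * inner ℝ (w : L2Field) v := by
    rw [inner_bardinaField hα w hv, hvdef, inner_bil_res_self hα w.2]; ring
  have e2 : inner ℝ (bardinaField hα γ g w : L2Field) (φ.val t) =
      inner ℝ g (φ.val t) + inner ℝ (T v) v - γ * inner ℝ (w : L2Field) (φ.val t) := by
    rw [inner_bardinaField hα w hφ]
    have := inner_bil_toL2 hα w.2 (w : L2Field) (φ.smooth_space t) (φ.periodic t ht)
    change inner ℝ (bil hα w w) (φ.val t) = _ at this
    rw [this]; ring
  have e3 : inner ℝ (T v) (φ.val t) = 0 := by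
    have := transport_skew hv (φ.smooth_space t) (φ.smooth_space t) (φ.periodic t ht)
      (φ.periodic t ht)
    change inner ℝ (T v) (φ.val t) + inner ℝ (T v) (φ.val t) = 0 at this
    linarith
  have e4 : toL2 (fun x => fderiv ℝ (φ.toFun t) x (φ.toFun t x)) (φ.continuous_convect t)
      = T (φ.val t) := (mulOp_toL2 _ _).symm
  have e5 : inner ℝ (φ.D γ g t) (v - φ.val t) = inner ℝ (φ.dtVal t) (v - φ.val t) +
      inner ℝ (T (φ.val t)) (v - φ.val t) + γ * inner ℝ (φ.val t) (v - φ.val t)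
        - inner ℝ g (v - φ.val t) := by
    have : φ.D γ g t = φ.dtVal t + leray (T (φ.val t)) + γ • φ.val t - leray g := by
      rw [← e4]; rfl
    rw [this, inner_sub_left, inner_add_left, inner_add_left, inner_leray_of_mem _ hz,
      inner_leray_of_mem _ hz, real_inner_smul_left]
  rw [e1, e2, e5, relEnergy, ← hvdef, map_sub]
  simp only [inner_sub_left, inner_sub_right, e3, real_inner_self_eq_norm_sq]
  rw [real_inner_comm (φ.dtVal t) v, real_inner_comm (φ.val t) v,
    real_inner_comm (φ.dtVal t) (φ.val t)]
  ring

theorem hasDerivWithinAt_relEnergy (φ : TestField) {w : ℝ → H0} {w' : H0} {s : Set ℝ} {t : ℝ}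
    (h : HasDerivWithinAt w w' s t) :
    HasDerivWithinAt (fun t => relEnergy hα φ t (w t))
      (2 * inner ℝ (w' : L2Field) (res hα (w t))
      - 2 * (inner ℝ (w t : L2Field) (φ.dtVal t) + inner ℝ (w' : L2Field) (φ.val t))
      + 2 * inner ℝ (φ.val t) (φ.dtVal t)) s t := by
  have h1 : HasDerivWithinAt (fun t => (w t : L2Field)) (w' : L2Field) s t :=
    H0.subtypeL.hasFDerivAt.comp_hasDerivWithinAt t h
  have h2 := (φ.hasDerivAt_val t).hasDerivWithinAt (s := s)
  exact ((hasDerivWithinAt_energy hα h).sub ((h1.inner ℝ h2).const_mul 2)).add h2.norm_sq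

/-- The exponent `∫₀ᵗ (γ - e₀(φ))` of the weight. -/
def weightExp (γ : ℝ) (φ : TestField) (t : ℝ) : ℝ := ∫ s in (0 : ℝ)..t, (γ - φ.e s)

theorem hasDerivAt_weightExp (γ : ℝ) (φ : TestField) (t : ℝ) :
    HasDerivAt (weightExp γ φ) (γ - φ.e t) t := by
  have hc : Continuous fun s => γ - φ.e s := continuous_const.sub φ.continuous_e
  exact hc.integral_hasStrictDerivAt 0 t |>.hasDerivAt

theorem continuous_weightExp (γ : ℝ) (φ : TestField) : Continuous (weightExp γ φ) :=
  continuous_iff_continuousAt.2 fun t => (hasDerivAt_weightExp γ φ t).continuousAt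

theorem integral_eq_weightExp (γ : ℝ) (φ : TestField) (τ t : ℝ) :
    ∫ s in τ..t, (γ - φ.e s) = weightExp γ φ t - weightExp γ φ τ := by
  have hc : Continuous fun s => γ - φ.e s := continuous_const.sub φ.continuous_e
  exact (intervalIntegral.integral_interval_sub_left (hc.intervalIntegrable _ _)
    (hc.intervalIntegrable _ _)).symm

/-- The bound `-2(T z, z) ≤ 2 e₀ ‖z‖²` is converted to relative energy, at the price of `4 e₀` times
the first discrepancy. That discrepancy returns with factor `2γ` from the damping, and the second
enters with factor `2`: hence `4 M + 2 γ + 2`. -/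
theorem relEnergy_rate_le (φ : TestField) {t : ℝ} (ht : 0 ≤ t) (w : H0) {M r : ℝ}
    (hM : φ.e t ≤ M) (hγ : 0 < γ)
    (h1 : |inner ℝ (w : L2Field) (φ.val t) - inner ℝ (res hα w) (φ.val t)| ≤ r)
    (h2 : |inner ℝ (w : L2Field) (φ.dtVal t) - inner ℝ (res hα w) (φ.dtVal t)| ≤ r) :
    2 * inner ℝ (bardinaField hα γ g w : L2Field) (res hα w)
      - 2 * (inner ℝ (w : L2Field) (φ.dtVal t)
        + inner ℝ (bardinaField hα γ g w : L2Field) (φ.val t))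
      + 2 * inner ℝ (φ.val t) (φ.dtVal t) + 2 * (γ - φ.e t) * relEnergy hα φ t w ≤
    -2 * inner ℝ (φ.D γ g t) (res hα w - φ.val t) + (4 * M + 2 * γ + 2) * r := by
  rw [relEnergy_rate hα φ ht]
  have hz := H0.sub_mem (res_mem_H0 hα w.2) (φ.val_mem_H0 ht)
  have h3 := φ.neg_transport_le (t := t) hz
  have h4 := norm_sub_sq_le_relEnergy hα φ t (w : L2Field)
  have h5 := φ.e_nonneg ht
  have hr : 0 ≤ r := (abs_nonneg _).trans h1
  set d1 := inner ℝ (w : L2Field) (φ.val t) - inner ℝ (res hα w) (φ.val t)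
  set d2 := inner ℝ (w : L2Field) (φ.dtVal t) - inner ℝ (res hα w) (φ.dtVal t)
  have h6 : φ.e t * ‖res hα (w : L2Field) - φ.val t‖ ^ 2 ≤
      φ.e t * (relEnergy hα φ t w + 2 * d1) := mul_le_mul_of_nonneg_left h4 h5
  have h7 : φ.e t * d1 ≤ M * r := by
    calc φ.e t * d1 ≤ φ.e t * r := mul_le_mul_of_nonneg_left ((le_abs_self _).trans h1) h5
      _ ≤ M * r := mul_le_mul_of_nonneg_right hM hr
  have h8 : -(γ * d1) ≤ γ * r := by
    rw [← mul_neg]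
    exact mul_le_mul_of_nonneg_left ((neg_le_abs _).trans h1) hγ.le
  have h9 : -d2 ≤ r := (neg_le_abs _).trans h2
  linarith

end Approx

/-- The approximate dissipative inequality for the regularized problems. -/
theorem exists_relEnergy_le {γ : ℝ} (hγ : 0 < γ) (g : L2Field) (φ : TestField) {T : ℝ} (Y : ℝ) :
    ∃ C : ℝ, 0 ≤ C ∧ ∀ (α : ℝ) (hα : 0 < α) (w : ℝ → H0),
      (∀ t ∈ Ici (0 : ℝ), HasDerivWithinAt w (bardinaField hα γ g (w t)) (Ici 0) t) →
      (∀ t ∈ Icc 0 T, inner ℝ (w t : L2Field) (res hα (w t)) ≤ Y) →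
      ∀ t ∈ Icc 0 T, ‖res hα (w t : L2Field) - φ.val t‖ ^ 2 ≤
        relEnergy hα φ 0 (w 0) * Real.exp (-2 * ∫ s in (0 : ℝ)..t, (γ - φ.e s))
        - 2 * (∫ τ in (0 : ℝ)..t, Real.exp (-2 * ∫ s in τ..t, (γ - φ.e s)) *
          inner ℝ (φ.D γ g τ) (res hα (w τ : L2Field) - φ.val τ)) + Real.sqrt α * C := by
  obtain ⟨C1, hC1, hb1⟩ := exists_bound_partial φ.smooth φ.smooth_space T
  obtain ⟨C2, hC2, hb2⟩ := exists_bound_partial (ψ := fun t x => deriv (fun s => φ.toFun s x) t)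
    φ.contDiff_timeDeriv φ.contDiff_timeDeriv_space T
  obtain ⟨M, hM⟩ := isCompact_Icc.exists_bound_of_continuousOn (s := Icc 0 T)
    φ.continuous_e.continuousOn
  have hcA := continuous_weightExp γ φ
  have hcexp : Continuous fun τ => Real.exp (2 * weightExp γ φ τ) := by fun_prop
  have hcK : Continuous fun t => Real.exp (-2 * weightExp γ φ t) *
      ∫ τ in (0 : ℝ)..t, Real.exp (2 * weightExp γ φ τ) :=
    (by fun_prop : Continuous fun t => Real.exp (-2 * weightExp γ φ t)).mul
      (intervalIntegral.continuous_primitive (fun a b => hcexp.intervalIntegrable a b) 0)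
  obtain ⟨N, hN⟩ := isCompact_Icc.exists_bound_of_continuousOn (s := Icc 0 T) hcK.continuousOn
  -- A common bound, after division by `√α`, for the discrepancies tested with `φ` and with `∂ₜφ`.
  set ρ := Real.sqrt Y * (C1 + C2) with hρ
  have hρ0 : 0 ≤ ρ := by positivity
  set P := (4 * |M| + 2 * γ + 2) * ρ with hP
  have hP0 : 0 ≤ P := by positivity
  -- The first summand bounds the weighted time integral of the rate error; the second pays for
  -- returning from the relative energy to the `L²` distance at time `t`. Neither depends on `α` or
  -- `w`.
  refine ⟨|N| * P + 2 * ρ, by positivity, fun α hα w hw hY t ht => ?_⟩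
  have hd1 : ∀ s ∈ Icc 0 T,
      |inner ℝ (w s : L2Field) (φ.val s) - inner ℝ (res hα (w s)) (φ.val s)| ≤
        Real.sqrt α * ρ := by
    intro s hs
    refine (abs_inner_sub_res_le hα (hY s hs) (φ.smooth_space s) (φ.periodic s hs.1)).trans ?_
    rw [hρ]
    gcongr
    linarith [hb1 s hs]
  have hd2 : ∀ s ∈ Icc 0 T, 0 < s →
      |inner ℝ (w s : L2Field) (φ.dtVal s) - inner ℝ (res hα (w s)) (φ.dtVal s)| ≤
        Real.sqrt α * ρ := by
    intro s hs hs0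
    refine (abs_inner_sub_res_le hα (hY s hs) (φ.contDiff_timeDeriv_space s)
      (φ.periodic_timeDeriv hs0)).trans ?_
    rw [hρ]
    gcongr
    linarith [hb2 s hs]
  set A := weightExp γ φ with hA
  have hwc : ContinuousOn w (Ici 0) := fun s hs => (hw s hs).continuousWithinAt
  have hsub : Icc 0 t ⊆ Ici (0 : ℝ) := fun s hs => hs.1
  have hinner : ContinuousOn (fun τ => inner ℝ (φ.D γ g τ) (res hα (w τ : L2Field) - φ.val τ))
      (Icc 0 t) := by
    refine ContinuousOn.inner (φ.continuous_D γ g).continuousOn (ContinuousOn.sub ?_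
      φ.continuous_val.continuousOn)
    exact (res hα).continuous.comp_continuousOn
      (continuous_subtype_val.comp_continuousOn (hwc.mono hsub))
  have hI1 : ContinuousOn (fun τ => Real.exp (2 * A τ) *
      inner ℝ (φ.D γ g τ) (res hα (w τ : L2Field) - φ.val τ)) (Icc 0 t) :=
    hcexp.continuousOn.mul hinner
  have hder : ∀ s ∈ Ici (0 : ℝ), HasDerivWithinAt
      (fun s => Real.exp (2 * A s) * relEnergy hα φ s (w s)) _ (Ici 0) s := fun s hs =>
    ((((hasDerivAt_weightExp γ φ s).const_mul 2).exp).hasDerivWithinAt).mul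
      (hasDerivWithinAt_relEnergy hα φ (hw s hs))
  -- Integration of the inequality multiplied by `exp (2A)`. Derivatives are needed only at interior
  -- times, which is why the estimate `hd2` for `s > 0` suffices.
  have key := intervalIntegral.sub_le_integral_of_hasDeriv_right_of_le ht.1
    (g := fun s => Real.exp (2 * A s) * relEnergy hα φ s (w s))
    (φ := fun τ => -2 * (Real.exp (2 * A τ) *
      inner ℝ (φ.D γ g τ) (res hα (w τ : L2Field) - φ.val τ))
      + Real.sqrt α * P * Real.exp (2 * A τ))
    (fun s hs => ((hder s hs.1).continuousWithinAt).mono hsub)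
    (fun s hs => (hder s hs.1.le).mono fun r hr => hs.1.le.trans (le_of_lt hr))
    ((continuousOn_const.mul hI1).add
      (continuousOn_const.mul hcexp.continuousOn)).integrableOn_Icc
    (fun s hs => by
      have hsT : s ∈ Icc 0 T := ⟨hs.1.le, hs.2.le.trans ht.2⟩
      have h1 := relEnergy_rate_le (g := g) hα φ hs.1.le (w s)
        ((le_abs_self _).trans ((hM s hsT).trans (le_abs_self M))) hγ (hd1 s hsT)
        (hd2 s hsT hs.1)
      have h2 := mul_le_mul_of_nonneg_left h1 (Real.exp_pos (2 * A s)).le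
      rw [hP]
      refine le_trans (le_of_eq ?_) (h2.trans (le_of_eq ?_)) <;> simp only [hA] <;> ring)
  have hA0 : A 0 = 0 := by simp [hA, weightExp]
  have hf1 : IntervalIntegrable (fun τ => -2 * (Real.exp (2 * A τ) *
      inner ℝ (φ.D γ g τ) (res hα (w τ : L2Field) - φ.val τ))) volume 0 t :=
    (hI1.intervalIntegrable_of_Icc ht.1).const_mul (-2)
  have hf2 : IntervalIntegrable (fun τ => Real.sqrt α * P * Real.exp (2 * A τ)) volume 0 t :=
    (hcexp.intervalIntegrable _ _).const_mul _
  rw [hA0, mul_zero, Real.exp_zero, one_mul, intervalIntegral.integral_add hf1 hf2,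
    intervalIntegral.integral_const_mul, intervalIntegral.integral_const_mul] at key
  have hmul := mul_le_mul_of_nonneg_left key (Real.exp_pos (-2 * A t)).le
  have hE : Real.exp (-2 * A t) * Real.exp (2 * A t) = 1 := by
    rw [← Real.exp_add]; simp
  have hint : ∫ τ in (0 : ℝ)..t, Real.exp (-2 * ∫ s in τ..t, (γ - φ.e s)) *
      inner ℝ (φ.D γ g τ) (res hα (w τ : L2Field) - φ.val τ) =
      Real.exp (-2 * A t) * ∫ τ in (0 : ℝ)..t, Real.exp (2 * A τ) *
        inner ℝ (φ.D γ g τ) (res hα (w τ : L2Field) - φ.val τ) := by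
    rw [← intervalIntegral.integral_const_mul]
    congr 1
    ext τ
    rw [integral_eq_weightExp, ← mul_assoc, ← Real.exp_add]
    congr 2
    ring
  have hzero : ∫ s in (0 : ℝ)..t, (γ - φ.e s) = A t := rfl
  rw [hint, hzero]
  have hlast : Real.exp (-2 * A t) * (Real.sqrt α * P *
      ∫ τ in (0 : ℝ)..t, Real.exp (2 * A τ)) ≤ Real.sqrt α * (|N| * P) := by
    have h3 := (le_abs_self _).trans ((hN t ht).trans (le_abs_self N))
    calc _ = (Real.sqrt α * P) * (Real.exp (-2 * A t) *
        ∫ τ in (0 : ℝ)..t, Real.exp (2 * A τ)) := by ring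
      _ ≤ (Real.sqrt α * P) * |N| := by gcongr
      _ = _ := by ring
  have h4 := norm_sub_sq_le_relEnergy hα φ t (w t : L2Field)
  have h5 := (le_abs_self _).trans (hd1 t ht)
  have h6 : Real.exp (-2 * A t) * (Real.exp (2 * A t) * relEnergy hα φ t (w t)) =
      relEnergy hα φ t (w t) := by rw [← mul_assoc, hE, one_mul]
  rw [mul_sub, h6] at hmul
  linarith

end DampedEuler
end

/-! ### Weak compactness in Hilbert space -/

noncomputable section

namespace DampedEuler

section WeakCompactness

variable {H : Type*} [NormedAddCommGroup H] [InnerProductSpace ℝ H] {ι : Type*}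

/-- Bounded families converge weakly as soon as their coefficients in a Hilbert basis do. -/
theorem tendsto_inner_of_hilbertBasis (b : HilbertBasis ι ℝ H) {β : Type*} {l : Filter β}
    {f : β → H} {x : H} {C : ℝ} (hC : ∀ᶠ n in l, ‖f n‖ ≤ C)
    (hf : ∀ p, Tendsto (fun n => inner ℝ (f n) (b p)) l (𝓝 (inner ℝ x (b p)))) (y : H) :
    Tendsto (fun n => inner ℝ (f n) y) l (𝓝 (inner ℝ x y)) := by
  have hspan : ∀ z ∈ Submodule.span ℝ (range b),
      Tendsto (fun n => inner ℝ (f n) z) l (𝓝 (inner ℝ x z)) := by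
    intro z hz
    induction hz using Submodule.span_induction with
    | mem z hz => obtain ⟨p, rfl⟩ := hz; exact hf p
    | zero => simp [tendsto_const_nhds]
    | add a c _ _ ha hc => simpa only [inner_add_right] using ha.add hc
    | smul r a _ ha => simpa only [real_inner_smul_right] using ha.const_mul r
  have hy : y ∈ closure (Submodule.span ℝ (range b) : Set H) := by
    rw [← Submodule.topologicalClosure_coe, b.dense_span]
    trivial
  rw [Metric.tendsto_nhds]
  intro ε hε
  have hK : 0 < |C| + ‖x‖ + 1 := by positivity
  obtain ⟨z, hz, hyz⟩ := Metric.mem_closure_iff.1 hy (ε / 2 / (|C| + ‖x‖ + 1)) (by positivity)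
  filter_upwards [hC, Metric.tendsto_nhds.1 (hspan z hz) (ε / 2) (by positivity)] with n hn hnz
  rw [Real.dist_eq] at hnz ⊢
  rw [dist_eq_norm, lt_div_iff₀ hK] at hyz
  have e : inner ℝ (f n) y - inner ℝ x y =
      (inner ℝ (f n) z - inner ℝ x z) + inner ℝ (f n - x) (y - z) := by
    simp only [inner_sub_left, inner_sub_right]; ring
  have h1 : |inner ℝ (f n - x) (y - z)| ≤ ‖y - z‖ * (|C| + ‖x‖ + 1) := by
    refine (abs_real_inner_le_norm _ _).trans ?_
    rw [mul_comm]
    gcongr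
    have := norm_sub_le (f n) x
    have := le_abs_self C
    linarith
  rw [e]
  have := abs_add_le (inner ℝ (f n) z - inner ℝ x z) (inner ℝ (f n - x) (y - z))
  linarith

/-- Bessel's inequality on finite sets passes to the limit, so the limiting coefficients are square
summable and define a vector. -/
theorem exists_inner_eq_of_tendsto [CompleteSpace H] (b : HilbertBasis ι ℝ H) {f : ℕ → H} {C : ℝ}
    (hC : ∀ n, ‖f n‖ ≤ C) {c : ι → ℝ}
    (hf : ∀ p, Tendsto (fun n => inner ℝ (f n) (b p)) atTop (𝓝 (c p))) :
    ∃ x : H, ∀ p, inner ℝ x (b p) = c p := by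
  have hsum : ∀ s : Finset ι, ∑ p ∈ s, ‖c p‖ ^ (2 : ENNReal).toReal ≤ C ^ 2 := by
    intro s
    have h1 : Tendsto (fun n => ∑ p ∈ s, ‖inner ℝ (f n) (b p)‖ ^ 2) atTop
        (𝓝 (∑ p ∈ s, ‖c p‖ ^ 2)) := tendsto_finsetSum _ fun p _ => ((hf p).norm.pow 2)
    have h2 : ∑ p ∈ s, ‖c p‖ ^ 2 ≤ C ^ 2 := by
      refine le_of_tendsto h1 (Eventually.of_forall fun n => ?_)
      have h3 := b.orthonormal.sum_inner_products_le (f n) (s := s)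
      calc _ = ∑ p ∈ s, ‖inner ℝ (b p) (f n)‖ ^ 2 :=
            Finset.sum_congr rfl fun p _ => by rw [real_inner_comm]
        _ ≤ ‖f n‖ ^ 2 := h3
        _ ≤ C ^ 2 := by gcongr; exact hC n
    simpa using h2
  have hmem : Memℓp c 2 := memℓp_gen' hsum
  refine ⟨b.repr.symm ⟨c, hmem⟩, fun p => ?_⟩
  rw [real_inner_comm, ← b.repr_apply_apply, LinearIsometryEquiv.apply_symm_apply]

/-- A locally bounded sequence of curves with equi-Lipschitz coefficients has a subsequence which
converges weakly at all nonnegative times. -/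
theorem exists_subseq_weak_limit [CompleteSpace H] [Countable ι] (b : HilbertBasis ι ℝ H)
    {v : ℕ → ℝ → H} (hbd : ∀ T : ℝ, ∃ C, ∀ n, ∀ t ∈ Icc 0 T, ‖v n t‖ ≤ C)
    (hlip : ∀ p, ∀ T : ℝ, ∃ L, ∀ n, ∀ s ∈ Icc 0 T, ∀ t ∈ Icc 0 T,
      |inner ℝ (v n t) (b p) - inner ℝ (v n s) (b p)| ≤ L * |t - s|) :
    ∃ θ : ℕ → ℕ, StrictMono θ ∧ ∃ u : ℝ → H, ∀ t, 0 ≤ t → ∀ y,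
      Tendsto (fun n => inner ℝ (v (θ n) t) y) atTop (𝓝 (inner ℝ (u t) y)) := by
  choose C hC using hbd
  -- Countably many bounded scalar sequences, so the product of intervals is sequentially compact.
  -- The absolute value lets all rationals serve as nonnegative times.
  let F : ℕ → ℚ × ι → ℝ := fun n j => inner ℝ (v n |(j.1 : ℝ)|) (b j.2)
  have hF : ∀ n, F n ∈ pi univ fun j : ℚ × ι =>
      Metric.closedBall (0 : ℝ) (C |(j.1 : ℝ)|) := by
    intro n j _
    rw [mem_closedBall_zero_iff]
    refine (norm_inner_le_norm _ _).trans ?_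
    rw [b.orthonormal.1, mul_one]
    exact hC _ n _ ⟨abs_nonneg _, le_rfl⟩
  obtain ⟨a, -, θ, hθ, hlim⟩ := (isCompact_univ_pi fun j : ℚ × ι =>
    isCompact_closedBall (0 : ℝ) (C |(j.1 : ℝ)|)).tendsto_subseq hF
  rw [tendsto_pi_nhds] at hlim
  have hcau : ∀ t, 0 ≤ t → ∀ p, ∃ c, Tendsto (fun n => inner ℝ (v (θ n) t) (b p)) atTop (𝓝 c) := by
    intro t ht p
    apply cauchySeq_tendsto_of_complete
    rw [Metric.cauchySeq_iff']
    intro ε hε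
    obtain ⟨L, hL⟩ := hlip p (t + 1)
    -- A rational time so close to `t` that the Lipschitz bound, uniform in `n`, moves each
    -- coefficient by at most `ε / 4`; convergence at `q` then gives the Cauchy property at `t`.
    obtain ⟨q, hq1, hq2⟩ := exists_rat_btwn (show t < t + min 1 (ε / 4 / (|L| + 1)) by
      have : 0 < ε / 4 / (|L| + 1) := by positivity
      have := lt_min one_pos this
      linarith)
    have hq0 : 0 ≤ (q : ℝ) := ht.trans hq1.le
    have hqt : (q : ℝ) ∈ Icc 0 (t + 1) := ⟨hq0, by
      have := min_le_left 1 (ε / 4 / (|L| + 1)); linarith⟩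
    have hclose : ∀ n, |inner ℝ (v n t) (b p) - inner ℝ (v n q) (b p)| ≤ ε / 4 := by
      intro n
      refine (hL n q hqt t ⟨ht, by linarith⟩).trans ?_
      have h1 : |t - q| ≤ ε / 4 / (|L| + 1) := by
        rw [abs_sub_comm, abs_of_nonneg (by linarith)]
        have := min_le_right 1 (ε / 4 / (|L| + 1)); linarith
      rw [le_div_iff₀ (by positivity)] at h1
      have := le_abs_self L
      nlinarith [abs_nonneg (t - q)]
    have hq := hlim (q, p)
    simp only [F, Function.comp_def, abs_of_nonneg hq0] at hq
    obtain ⟨N, hN⟩ := Metric.cauchySeq_iff'.1 hq.cauchySeq (ε / 4) (by positivity)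
    refine ⟨N, fun n hn => ?_⟩
    have h1 := hN n hn
    rw [Real.dist_eq] at h1 ⊢
    have h2 := abs_le.1 (hclose (θ n))
    have h3 := abs_le.1 (hclose (θ N))
    have h4 := abs_lt.1 h1
    rw [abs_lt]
    constructor <;> linarith [h2.1, h2.2, h3.1, h3.2, h4.1, h4.2]
  have hex : ∀ t, ∃ x : H, 0 ≤ t → ∀ y,
      Tendsto (fun n => inner ℝ (v (θ n) t) y) atTop (𝓝 (inner ℝ x y)) := by
    intro t
    by_cases ht : 0 ≤ t
    · choose c hc using hcau t ht
      have hb : ∀ n, ‖v (θ n) t‖ ≤ C t := fun n => hC t (θ n) t ⟨ht, le_rfl⟩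
      obtain ⟨x, hx⟩ := exists_inner_eq_of_tendsto b hb hc
      refine ⟨x, fun _ => tendsto_inner_of_hilbertBasis b (Eventually.of_forall hb) fun p => ?_⟩
      rw [hx]
      exact hc p
    · exact ⟨0, fun h => absurd h ht⟩
  choose u hu using hex
  exact ⟨θ, hθ, u, hu⟩

theorem norm_le_of_tendsto_inner {β : Type*} {l : Filter β} [l.NeBot] {f : β → H} {x : H} {C : ℝ}
    (hC : ∀ n, ‖f n‖ ≤ C) (h : ∀ y, Tendsto (fun n => inner ℝ (f n) y) l (𝓝 (inner ℝ x y))) :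
    ‖x‖ ≤ C := by
  have h1 : inner ℝ x x ≤ C * ‖x‖ := by
    refine le_of_tendsto (h x) (Eventually.of_forall fun n => ?_)
    exact (real_inner_le_norm _ _).trans (by gcongr; exact hC n)
  rw [real_inner_self_eq_norm_mul_norm] at h1
  rcases (norm_nonneg x).eq_or_lt with h0 | h0
  · rw [← h0]
    obtain ⟨n⟩ := l.nonempty_of_neBot
    exact (norm_nonneg _).trans (hC n)
  · exact le_of_mul_le_mul_right h1 h0

/-- Expanding the square, `‖f - x‖² ≤ 2‖x‖² - 2(f, x)`. -/
theorem tendsto_of_tendsto_inner_of_norm_le {β : Type*} {l : Filter β} {f : β → H} {x : H}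
    (hC : ∀ n, ‖f n‖ ≤ ‖x‖) (h : Tendsto (fun n => inner ℝ (f n) x) l (𝓝 (inner ℝ x x))) :
    Tendsto f l (𝓝 x) := by
  rw [tendsto_iff_norm_sub_tendsto_zero]
  have h1 : Tendsto (fun n => 2 * ‖x‖ ^ 2 - 2 * inner ℝ (f n) x) l (𝓝 0) := by
    have := (h.const_mul 2).const_sub (2 * ‖x‖ ^ 2)
    rwa [real_inner_self_eq_norm_sq, sub_self] at this
  have h2 : Tendsto (fun n => ‖f n - x‖ ^ 2) l (𝓝 0) := by
    refine squeeze_zero (fun _ => sq_nonneg _) (fun n => ?_) h1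
    rw [norm_sub_sq_real]
    have : ‖f n‖ ^ 2 ≤ ‖x‖ ^ 2 := by gcongr; exact hC n
    linarith
  have h3 := h2.sqrt
  simpa [Real.sqrt_sq] using h3

/-- Weak lower semicontinuity of the norm, from `2(f, x) - ‖x‖² ≤ ‖f‖²`. -/
theorem le_of_forall_norm_sq_le {β : Type*} {l : Filter β} [l.NeBot] {f : β → H} {x : H}
    {r : β → ℝ} {R : ℝ} (h : Tendsto (fun n => inner ℝ (f n) x) l (𝓝 (inner ℝ x x)))
    (hr : ∀ n, ‖f n‖ ^ 2 ≤ r n) (hR : Tendsto r l (𝓝 R)) : ‖x‖ ^ 2 ≤ R := by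
  have h1 : Tendsto (fun n => 2 * inner ℝ (f n) x - ‖x‖ ^ 2) l (𝓝 (‖x‖ ^ 2)) := by
    have := (h.const_mul 2).sub_const (‖x‖ ^ 2)
    rw [real_inner_self_eq_norm_sq] at this
    convert this using 2
    ring
  refine le_of_tendsto_of_tendsto' h1 hR fun n => le_trans ?_ (hr n)
  have := sq_nonneg ‖f n - x‖
  rw [norm_sub_sq_real] at this
  linarith

end WeakCompactness

end DampedEuler
end

/-! ### The limit `α → 0` -/

noncomputable section

namespace DampedEuler

theorem inner_res_hartL2 {α : ℝ} (hα : 0 < α) (x : L2Field) (p : (Fin 3 → ℤ) × Fin 3) :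
    inner ℝ (res hα x) (hartL2 p) = mult α p.1 * inner ℝ x (hartL2 p) := by
  rw [inner_res_left, res_hart, real_inner_smul_right]

theorem tendsto_inner_of_hartL2 {β : Type*} {l : Filter β} {f : β → L2Field} {x : L2Field} {C : ℝ}
    (hC : ∀ᶠ n in l, ‖f n‖ ≤ C)
    (hf : ∀ p, Tendsto (fun n => inner ℝ (f n) (hartL2 p)) l (𝓝 (inner ℝ x (hartL2 p))))
    (y : L2Field) : Tendsto (fun n => inner ℝ (f n) y) l (𝓝 (inner ℝ x y)) :=
  tendsto_inner_of_hilbertBasis hartBasis hC (fun p => by simpa only [coe_hartBasis] using hf p) y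

/-- The resolvents `(1 - αΔ)⁻¹` converge strongly to the identity. -/
theorem tendsto_res {α : ℕ → ℝ} (hα : ∀ n, 0 < α n) (h0 : Tendsto α atTop (𝓝 0)) (x : L2Field) :
    Tendsto (fun n => res (hα n) x) atTop (𝓝 x) := by
  -- Each multiplier tends to `1`, which gives weak convergence; since the resolvents are
  -- contractions, it is strong.
  refine tendsto_of_tendsto_inner_of_norm_le (fun n => norm_res_le (hα n) x)
    (tendsto_inner_of_hartL2 (Eventually.of_forall fun n => norm_res_le (hα n) x) (fun p => ?_) x)
  simp only [inner_res_hartL2]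
  have h1 : Tendsto (fun n => mult (α n) p.1) atTop (𝓝 1) := by
    have := ((h0.mul_const (∑ i, (p.1 i : ℝ) ^ 2)).const_add 1).inv₀ (by simp)
    simpa [mult] using this
  simpa using h1.mul_const (inner ℝ x (hartL2 p))

section Flow

variable {α : ℝ} (hα : 0 < α) {γ : ℝ} {g : L2Field} {w : ℝ → H0}

/-- The initial energy is at most `‖w 0‖²`, so for fixed initial `w` the bound is uniform in `α`. -/
theorem energy_flow_le (hγ : 0 < γ)
    (hw : ∀ t ∈ Ici (0 : ℝ), HasDerivWithinAt w (bardinaField hα γ g (w t)) (Ici 0) t) (T : ℝ) :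
    ∀ t ∈ Icc 0 T, inner ℝ (w t : L2Field) (res hα (w t)) ≤
      gronwallBound (‖w 0‖ ^ 2) 1 (‖g‖ ^ 2) T := by
  intro t ht
  refine (energy_le hα hγ (g := g) (θ := fun _ => 1) (fun _ => ⟨zero_le_one, le_rfl⟩)
    (fun s hs => ?_) t ht).trans ?_
  · rw [one_smul]
    exact (hw s hs.1).mono Icc_subset_Ici_self
  · rw [gronwallBound_of_K_ne_0 one_ne_zero, gronwallBound_of_K_ne_0 one_ne_zero]
    have h1 : inner ℝ (w 0 : L2Field) (res hα (w 0)) ≤ ‖w 0‖ ^ 2 := by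
      refine (real_inner_le_norm _ _).trans ?_
      rw [sq]
      exact mul_le_mul_of_nonneg_left (norm_res_le hα _) (norm_nonneg _)
    have h2 := mul_le_mul_of_nonneg_right h1 (Real.exp_pos (1 * T)).le
    linarith

theorem norm_res_le_sqrt {x : L2Field} {Y : ℝ} (h : inner ℝ x (res hα x) ≤ Y) :
    ‖res hα x‖ ≤ Real.sqrt Y :=
  Real.le_sqrt_of_sq_le ((norm_res_sq_le hα x).trans h)

/-- The coefficients of the regularized fields are Lipschitz, uniformly in `α`. -/
theorem abs_coeff_sub_le (hγ : 0 < γ)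
    (hw : ∀ t ∈ Ici (0 : ℝ), HasDerivWithinAt w (bardinaField hα γ g (w t)) (Ici 0) t) {T Y : ℝ}
    (hY : ∀ t ∈ Icc 0 T, inner ℝ (w t : L2Field) (res hα (w t)) ≤ Y)
    (p : (Fin 3 → ℤ) × Fin 3) {s t : ℝ} (hs : s ∈ Icc 0 T) (ht : t ∈ Icc 0 T) :
    |inner ℝ (res hα (w t : L2Field)) (hartL2 p) - inner ℝ (res hα (w s : L2Field)) (hartL2 p)| ≤
      (‖g‖ * ‖toL2 (helm p) (contDiff_helm p).continuous‖
        + ‖transport (helm p) (contDiff_helm p)‖ * Real.sqrt Y * Real.sqrt Y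
        + γ * Real.sqrt Y) * |t - s| := by
  set ψ := toL2 (helm p) (contDiff_helm p).continuous with hψ
  have hψH : ψ ∈ H0 := helm_mem_H0 p
  have hder : ∀ r ∈ Icc 0 T, HasDerivWithinAt
      (fun r => inner ℝ (res hα (w r : L2Field)) (hartL2 p))
      -- Replacing the basis field by its divergence free part is harmless against elements of `𝓗₀`,
      -- and it allows the projector to be dropped.
      (mult α p.1 * inner ℝ (bardinaField hα γ g (w r) : L2Field) ψ) (Icc 0 T) r := by
    intro r hr
    have h1 := ((hw r hr.1).mono (Icc_subset_Ici_self (a := T) (b := 0)))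
    have h2 : HasDerivWithinAt (fun r => (w r : L2Field))
        (bardinaField hα γ g (w r) : L2Field) (Icc 0 T) r :=
      H0.subtypeL.hasFDerivAt.comp_hasDerivWithinAt r h1
    have h3 := ((h2.inner ℝ (hasDerivWithinAt_const r (Icc 0 T) ψ)).const_mul (mult α p.1))
    simp only [inner_zero_right, zero_add] at h3
    refine h3.congr_of_mem (fun x _ => ?_) hr
    rw [inner_res_hartL2, inner_hartL2_of_mem (w x).2]
  refine Convex.norm_image_sub_le_of_norm_hasDerivWithin_le hder (fun r hr => ?_)
    (convex_Icc 0 T) hs ht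
  · rw [inner_bardinaField hα _ hψH, hψ, inner_bil_toL2 hα (w r).2 _ (contDiff_helm p)
      (periodic_helm p), ← hψ]
    have hv := norm_res_le_sqrt hα (hY r hr)
    have hm0 := mult_pos hα.le p.1
    have hm1 := mult_le_one hα.le p.1
    -- The damping term involves `w`, which has no bound uniform in `α`; together with the
    -- multiplier it becomes a coefficient of the bounded field `Rw`.
    have e : mult α p.1 * inner ℝ (w r : L2Field) ψ =
        inner ℝ (res hα (w r : L2Field)) (hartL2 p) := by
      rw [inner_res_hartL2, inner_hartL2_of_mem (w r).2]
    have b1 : |inner ℝ g ψ| ≤ ‖g‖ * ‖ψ‖ := abs_real_inner_le_norm _ _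
    have b2 : |inner ℝ (transport (helm p) (contDiff_helm p) (res hα (w r : L2Field)))
        (res hα (w r : L2Field))| ≤
        ‖transport (helm p) (contDiff_helm p)‖ * Real.sqrt Y * Real.sqrt Y := by
      refine (abs_real_inner_le_norm _ _).trans ?_
      gcongr
      exact (ContinuousLinearMap.le_opNorm _ _).trans (by gcongr)
    have b3 : |inner ℝ (res hα (w r : L2Field)) (hartL2 p)| ≤ Real.sqrt Y := by
      refine (abs_real_inner_le_norm _ _).trans ?_
      rw [orthonormal_hartL2.1, mul_one]
      exact hv
    rw [Real.norm_eq_abs, mul_sub, mul_sub, mul_left_comm, e]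
    set P := inner ℝ g ψ
    set Q := inner ℝ (transport (helm p) (contDiff_helm p) (res hα (w r : L2Field)))
        (res hα (w r : L2Field))
    have c1 : |mult α p.1 * P| ≤ |P| := by
      rw [abs_mul, abs_of_pos hm0]
      exact mul_le_of_le_one_left (abs_nonneg _) hm1
    have c2 : |mult α p.1 * -Q| ≤ |Q| := by
      rw [abs_mul, abs_of_pos hm0, abs_neg]
      exact mul_le_of_le_one_left (abs_nonneg _) hm1
    refine (abs_sub _ _).trans (add_le_add ((abs_sub _ _).trans
      (add_le_add (c1.trans b1) (c2.trans b2))) ?_)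
    rw [abs_mul, abs_of_pos hγ]
    gcongr

end Flow

/-- Solutions of the regularized problems converge weakly, along a sequence `α → 0`. -/
theorem exists_weak_limit {γ : ℝ} (hγ : 0 < γ) (g : L2Field) (u₀ : H0) :
    ∃ (α : ℕ → ℝ) (hα : ∀ n, 0 < α n) (w : ℕ → ℝ → H0) (u : ℝ → H0) (Y : ℝ → ℝ),
      Tendsto α atTop (𝓝 0) ∧ (∀ n, w n 0 = u₀) ∧
      (∀ n, ∀ t ∈ Ici (0 : ℝ),
        HasDerivWithinAt (w n) (bardinaField (hα n) γ g (w n t)) (Ici 0) t) ∧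
      (∀ n T, ∀ t ∈ Icc 0 T, inner ℝ (w n t : L2Field) (res (hα n) (w n t)) ≤ Y T) ∧
      ∀ t, 0 ≤ t → ∀ y : L2Field, Tendsto (fun n => inner ℝ (res (hα n) (w n t : L2Field)) y) atTop
        (𝓝 (inner ℝ (u t : L2Field) y)) := by
  have hβ : ∀ n : ℕ, (0 : ℝ) < 1 / ((n : ℝ) + 1) := fun n => Nat.one_div_pos_of_nat
  choose w hw0 hw using fun n => exists_bardina_flow (hβ n) hγ g u₀
  set Y : ℝ → ℝ := fun T => gronwallBound (‖u₀‖ ^ 2) 1 (‖g‖ ^ 2) T with hYdef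
  have hY : ∀ n T, ∀ t ∈ Icc 0 T, inner ℝ (w n t : L2Field) (res (hβ n) (w n t)) ≤ Y T := by
    intro n T t ht
    have := energy_flow_le (hβ n) hγ (hw n) T t ht
    rwa [hw0] at this
  obtain ⟨θ, hθ, u, hu⟩ := exists_subseq_weak_limit hartBasis
    (v := fun n t => res (hβ n) (w n t : L2Field))
    (fun T => ⟨Real.sqrt (Y T), fun n t ht => norm_res_le_sqrt (hβ n) (hY n T t ht)⟩)
    (fun p T => ⟨_, fun n s hs t ht => by
      simp only [coe_hartBasis]
      exact abs_coeff_sub_le (hβ n) hγ (hw n) (hY n T) p hs ht⟩)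
  -- The space `𝓗₀` is weakly closed, being cut out by orthogonality conditions. The value at
  -- negative times is irrelevant.
  have hmem : ∀ t, ∃ x : H0, 0 ≤ t → (x : L2Field) = u t := by
    intro t
    by_cases ht : 0 ≤ t
    · refine ⟨⟨u t, fun ψ hψ hp => ?_⟩, fun _ => rfl⟩
      refine tendsto_nhds_unique (hu t ht _) ?_
      simp only [res_mem_H0 (hβ _) (w _ t).2 ψ hψ hp]
      exact tendsto_const_nhds
    · exact ⟨0, fun h => absurd h ht⟩
  choose U hU using hmem
  refine ⟨fun n => 1 / ((θ n : ℝ) + 1), fun n => hβ _, fun n => w (θ n), U, Y,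
    tendsto_one_div_add_atTop_nhds_zero_nat.comp hθ.tendsto_atTop, fun n => hw0 _,
    fun n => hw _, fun n => hY _, fun t ht y => ?_⟩
  rw [hU t ht]
  exact hu t ht y

section Limit

variable {γ : ℝ} {g : L2Field} {u₀ : H0} {α : ℕ → ℝ} {hα : ∀ n, 0 < α n} {w : ℕ → ℝ → H0}
  {u : ℝ → H0} {Y : ℝ → ℝ}

theorem norm_weakLimit_le
    (hY : ∀ n T, ∀ t ∈ Icc 0 T, inner ℝ (w n t : L2Field) (res (hα n) (w n t)) ≤ Y T)
    (hlim : ∀ t, 0 ≤ t → ∀ y : L2Field,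
      Tendsto (fun n => inner ℝ (res (hα n) (w n t : L2Field)) y) atTop
        (𝓝 (inner ℝ (u t : L2Field) y))) {T t : ℝ} (ht : t ∈ Icc 0 T) :
    ‖u t‖ ≤ Real.sqrt (Y T) :=
  norm_le_of_tendsto_inner (x := (u t : L2Field))
    (fun n => norm_res_le_sqrt (hα n) (hY n T t ht)) (hlim t ht.1)

theorem weakLimit_initial (h0 : Tendsto α atTop (𝓝 0)) (hw0 : ∀ n, w n 0 = u₀)
    (hlim : ∀ t, 0 ≤ t → ∀ y : L2Field,
      Tendsto (fun n => inner ℝ (res (hα n) (w n t : L2Field)) y) atTop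
        (𝓝 (inner ℝ (u t : L2Field) y))) : u 0 = u₀ := by
  refine Subtype.ext (ext_inner_right ℝ fun y => tendsto_nhds_unique (hlim 0 le_rfl y) ?_)
  simp only [hw0]
  exact ((tendsto_res hα h0 (u₀ : L2Field)).inner tendsto_const_nhds)

/-- The Lipschitz bounds on the coefficients pass to the limit; local boundedness then extends
continuity from basis vectors to all of `L²`. -/
theorem continuousOn_inner_weakLimit (hγ : 0 < γ)
    (hw : ∀ n, ∀ t ∈ Ici (0 : ℝ),
      HasDerivWithinAt (w n) (bardinaField (hα n) γ g (w n t)) (Ici 0) t)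
    (hY : ∀ n T, ∀ t ∈ Icc 0 T, inner ℝ (w n t : L2Field) (res (hα n) (w n t)) ≤ Y T)
    (hlim : ∀ t, 0 ≤ t → ∀ y : L2Field,
      Tendsto (fun n => inner ℝ (res (hα n) (w n t : L2Field)) y) atTop
        (𝓝 (inner ℝ (u t : L2Field) y))) (y : L2Field) :
    ContinuousOn (fun t => inner ℝ (u t : L2Field) y) (Ici 0) := by
  intro t ht
  have hnear : ∀ᶠ s in 𝓝[Ici 0] t, s ∈ Icc 0 (t + 1) := by
    filter_upwards [self_mem_nhdsWithin,
      mem_nhdsWithin_of_mem_nhds (Iic_mem_nhds (lt_add_one t))] with s h1 h2 using ⟨h1, h2⟩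
  refine tendsto_inner_of_hartL2 (f := fun s => (u s : L2Field)) (C := Real.sqrt (Y (t + 1)))
    (hnear.mono fun s hs => norm_weakLimit_le hY hlim hs) (fun p => ?_) y
  rw [tendsto_iff_dist_tendsto_zero]
  refine squeeze_zero' (Eventually.of_forall fun _ => dist_nonneg) (hnear.mono fun s hs => ?_)
    (g := fun s => (‖g‖ * ‖toL2 (helm p) (contDiff_helm p).continuous‖
        + ‖transport (helm p) (contDiff_helm p)‖ * Real.sqrt (Y (t + 1)) * Real.sqrt (Y (t + 1))
        + γ * Real.sqrt (Y (t + 1))) * |s - t|) ?_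
  · rw [Real.dist_eq]
    exact le_of_tendsto' ((hlim s hs.1 _).sub (hlim t ht _)).abs fun n =>
      abs_coeff_sub_le (hα n) hγ (hw n) (hY n _) p ⟨ht, (lt_add_one t).le⟩ hs
  · refine Tendsto.mono_left ?_ nhdsWithin_le_nhds
    refine Continuous.tendsto' (by fun_prop) _ _ (by simp)

theorem tendsto_relEnergy (h0 : Tendsto α atTop (𝓝 0)) (φ : TestField) (x : L2Field) :
    Tendsto (fun n => relEnergy (hα n) φ 0 x) atTop (𝓝 (‖x - φ.val 0‖ ^ 2)) := by
  rw [norm_sub_sq_real, ← real_inner_self_eq_norm_sq x]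
  exact (((tendsto_const_nhds (x := x)).inner (tendsto_res hα h0 x)).sub_const _).add_const _

theorem continuous_weight (γ : ℝ) (φ : TestField) (t : ℝ) :
    Continuous fun τ => Real.exp (-2 * ∫ s in τ..t, (γ - φ.e s)) := by
  have := continuous_weightExp γ φ
  simp only [integral_eq_weightExp]
  fun_prop

/-- Dominated convergence: the integrand is affine in the regularized field, which converges weakly
at each time and is bounded by `√(Y t)` on `[0, t]`. -/
theorem tendsto_integral_weight
    (hw : ∀ n, ∀ t ∈ Ici (0 : ℝ),
      HasDerivWithinAt (w n) (bardinaField (hα n) γ g (w n t)) (Ici 0) t)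
    (hY : ∀ n T, ∀ t ∈ Icc 0 T, inner ℝ (w n t : L2Field) (res (hα n) (w n t)) ≤ Y T)
    (hlim : ∀ t, 0 ≤ t → ∀ y : L2Field,
      Tendsto (fun n => inner ℝ (res (hα n) (w n t : L2Field)) y) atTop
        (𝓝 (inner ℝ (u t : L2Field) y))) (φ : TestField) {t : ℝ} (ht : 0 ≤ t) :
    Tendsto (fun n => ∫ τ in (0 : ℝ)..t, Real.exp (-2 * ∫ s in τ..t, (γ - φ.e s)) *
        inner ℝ (φ.D γ g τ) (res (hα n) (w n τ : L2Field) - φ.val τ)) atTop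
      (𝓝 (∫ τ in (0 : ℝ)..t, Real.exp (-2 * ∫ s in τ..t, (γ - φ.e s)) *
        inner ℝ (φ.D γ g τ) ((u τ : L2Field) - φ.val τ))) := by
  have hc := continuous_weight γ φ t
  have hD := φ.continuous_D γ g
  have hφ := φ.continuous_val
  refine intervalIntegral.tendsto_integral_filter_of_dominated_convergence
    (fun τ => Real.exp (-2 * ∫ s in τ..t, (γ - φ.e s)) *
      (‖φ.D γ g τ‖ * (Real.sqrt (Y t) + ‖φ.val τ‖)))
    (Eventually.of_forall fun n => ?_) (Eventually.of_forall fun n => ?_)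
    (Continuous.intervalIntegrable (by fun_prop) _ _) ?_
  · rw [uIoc_of_le ht]
    have hwc : ContinuousOn (w n) (Ioc 0 t) := fun s hs =>
      ((hw n s hs.1.le).continuousWithinAt).mono fun r hr => hr.1.le
    refine ContinuousOn.aestronglyMeasurable ?_ measurableSet_Ioc
    refine hc.continuousOn.mul (hD.continuousOn.inner (ContinuousOn.sub ?_ hφ.continuousOn))
    exact (res (hα n)).continuous.comp_continuousOn (continuous_subtype_val.comp_continuousOn hwc)
  · refine Eventually.of_forall fun τ hτ => ?_
    rw [uIoc_of_le ht] at hτ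
    rw [norm_mul, Real.norm_of_nonneg (Real.exp_pos _).le]
    refine mul_le_mul_of_nonneg_left ((norm_inner_le_norm _ _).trans ?_) (Real.exp_pos _).le
    refine mul_le_mul_of_nonneg_left ((norm_sub_le _ _).trans ?_) (norm_nonneg _)
    have := norm_res_le_sqrt (hα n) (hY n t τ (Ioc_subset_Icc_self hτ))
    linarith
  · refine Eventually.of_forall fun τ hτ => ?_
    rw [uIoc_of_le ht] at hτ
    refine Tendsto.const_mul _ ?_
    simp only [real_inner_comm _ (φ.D γ g τ), inner_sub_left]
    exact (hlim τ hτ.1.le _).sub_const _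

theorem weakLimit_inequality (hγ : 0 < γ) (h0 : Tendsto α atTop (𝓝 0)) (hw0 : ∀ n, w n 0 = u₀)
    (hw : ∀ n, ∀ t ∈ Ici (0 : ℝ),
      HasDerivWithinAt (w n) (bardinaField (hα n) γ g (w n t)) (Ici 0) t)
    (hY : ∀ n T, ∀ t ∈ Icc 0 T, inner ℝ (w n t : L2Field) (res (hα n) (w n t)) ≤ Y T)
    (hlim : ∀ t, 0 ≤ t → ∀ y : L2Field,
      Tendsto (fun n => inner ℝ (res (hα n) (w n t : L2Field)) y) atTop
        (𝓝 (inner ℝ (u t : L2Field) y))) (φ : TestField) {t : ℝ} (ht : 0 ≤ t) :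
    ‖(u t : L2Field) - φ.val t‖ ^ 2 ≤
      ‖(u₀ : L2Field) - φ.val 0‖ ^ 2 * Real.exp (-2 * ∫ s in (0 : ℝ)..t, (γ - φ.e s))
      - 2 * ∫ τ in (0 : ℝ)..t, Real.exp (-2 * ∫ s in τ..t, (γ - φ.e s)) *
          inner ℝ (φ.D γ g τ) ((u τ : L2Field) - φ.val τ) := by
  obtain ⟨C, -, hC⟩ := exists_relEnergy_le hγ g φ (T := t) (Y t)
  -- Weak lower semicontinuity on the left; on the right every term converges and the error `√α C`
  -- vanishes.
  refine le_of_forall_norm_sq_le (l := atTop)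
    (f := fun n => res (hα n) (w n t : L2Field) - φ.val t) ?_
    (fun n => hC (α n) (hα n) (w n) (hw n) (hY n t) t ⟨ht, le_rfl⟩) ?_
  · simp only [inner_sub_left _ _ ((u t : L2Field) - φ.val t)]
    exact (hlim t ht _).sub_const _
  · have h1 : Tendsto (fun n => Real.sqrt (α n) * C) atTop (𝓝 0) := by
      simpa using h0.sqrt.mul_const C
    simp only [hw0]
    simpa using (((tendsto_relEnergy h0 φ (u₀ : L2Field)).mul_const _).sub
      ((tendsto_integral_weight hw hY hlim φ ht).const_mul 2)).add h1

end Limit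

end DampedEuler
end

/-! ### Existence of a dissipative solution as a weak limit -/

theorem proposition2 (γ : ℝ) (hγ : 0 < γ) (g : DampedEuler.L2Field) (u₀ : DampedEuler.H0) :
    ∃ u : ℝ → DampedEuler.H0,
      DampedEuler.IsDissipativeSolution γ g u₀ u ∧
      ∃ (α : ℕ → ℝ) (v : ℕ → ℝ → DampedEuler.H1),
        (∀ n, 0 < α n) ∧ Tendsto α atTop (𝓝 0) ∧
        (∀ n, DampedEuler.IsBardinaSolution (α n) γ g (v n)) ∧
        Tendsto (fun n => DampedEuler.field (v n 0)) atTop (𝓝 (u₀ : DampedEuler.L2Field)) ∧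
        Tendsto (fun n => DampedEuler.normSqH (α n) (v n 0)) atTop (𝓝 (‖u₀‖ ^ 2)) ∧
        ∀ t : ℝ, 0 ≤ t → ∀ w : DampedEuler.H0,
          Tendsto (fun n => inner ℝ (DampedEuler.field (v n t)) (w : DampedEuler.L2Field)) atTop
            (𝓝 (inner ℝ (u t) w)) := by
  obtain ⟨α, hα, w, u, Y, h0, hw0, hw, hY, hlim⟩ := DampedEuler.exists_weak_limit hγ g u₀
  have hini := DampedEuler.weakLimit_initial h0 hw0 hlim
  refine ⟨u, ⟨fun T => ⟨_, fun t ht => DampedEuler.norm_weakLimit_le hY hlim ht⟩,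
    fun z => DampedEuler.continuousOn_inner_weakLimit hγ hw hY hlim z, hini, fun φ t ht => ?_⟩,
    α, fun n t => DampedEuler.resH1 (hα n) (w n t), hα, h0,
    fun n => DampedEuler.isBardinaSolution_resH1 (hα n) (hw n), ?_, ?_, fun t ht z => ?_⟩
  · rw [hini]
    exact DampedEuler.weakLimit_inequality hγ h0 hw0 hw hY hlim φ ht
  · simp only [DampedEuler.field_resH1, hw0]
    exact DampedEuler.tendsto_res hα h0 _
  -- With `v(0) = R u₀` the squared `𝓗_α` norm of the initial datum is `(u₀, R u₀)`, which tends to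
  -- `‖u₀‖²`.
  · simp only [DampedEuler.normSqH_resH1, hw0]
    have := (tendsto_const_nhds (x := (u₀ : DampedEuler.L2Field))).inner
      (DampedEuler.tendsto_res hα h0 (u₀ : DampedEuler.L2Field)) (𝕜 := ℝ)
    rwa [real_inner_self_eq_norm_sq] at this
  · simp only [DampedEuler.field_resH1]
    exact hlim t ht z
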